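/- \textbf{Setting.} Let $(M,g)$ be a compact smooth Riemannian manifold without boundary and $f\colon M\to\mathbb{R}$ a Morse--Bott function: $f$ is smooth, $\mathrm{crit}(f)$ is an embedded submanifold of $M$ (whose components may have different dimensions), and $T_x\mathrm{crit}(f)=\ker \mathrm{Hess}(f)(x)$ for every $x\in\mathrm{crit}(f)$. Let $g_0$ be a Riemannian metric on $\mathrm{crit}(f)$ and $h$ a Morse function on $\mathrm{crit}(f)$. A \emph{Morse flow line} is a smooth solution $y\colon\mathbb{R}\to\mathrm{crit}(f)$ of $\dot y=-\nabla_{g_0} h(y)$; it may be constant. For $c\in\mathrm{crit}(h)$ let $W^u_h(c)$ and $W^s_h(c)$ be the sets of all $y(0)$, where $y$ is a Morse flow line with $\lim_{s\to-\infty}y(s)=c$, respectively $\lim_{s\to\infty}y(s)=c$. \textbf{Flow lines with cascades.} Let $c,d\in\mathrm{crit}(h)$. A flow line with zero cascades from $c$ to $d$ is a Morse flow line $y$ with $\lim_{s\to-\infty}y(s)=c$ and $\lim_{s\to\infty}y(s)=d$. For $m\ge1$, a flow line with $m$ cascades from $c$ to $d$ is a tuple $((x_k)_{1\le k\le m},(t_k)_{1\le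 k\le m-1})$ of nonconstant smooth solutions $x_k\colon\mathbb{R}\to M$ of $\dot x_k=-\nabla_g f(x_k)$ and real numbers $t_k\ge0$ such that $\lim_{s\to-\infty}x_1(s)$ exists and lies in $W^u_h(c)$, $\lim_{s\to\infty}x_m(s)$ exists and lies in $W^s_h(d)$, and for $1\le k\le m-1$ there is a Morse flow line $y_k$ with $\lim_{s\to\infty}x_k(s)=y_k(0)$ and $\lim_{s\to-\infty}x_{k+1}(s)=y_k(t_k)$. A \emph{broken flow line with cascades} from $c$ to $d$ is a tuple $\mathbf v=(v_j)_{1\le j\le\ell}$, $\ell\ge1$, together with $c_0=c,c_1,\dots,c_\ell=d$ in $\mathrm{crit}(h)$, such that $v_j$ is a flow line with $m_j\ge0$ cascades from $c_{j-1}$ to $c_j$. \textbf{Floer--Gromov convergence.} A sequence $v^\nu$ of flow lines with cascades Floer--Gromov converges to a broken flow line with cascades $\mathbf v=(v_j)_{1\le j\le\ell}$ from $c$ to $d$ if there is $\nu_0$ such that $v^\nu$ is a flow line with cascades from $c$ to $d$ for all $\nu\ge\nu_0$ and one of the following holds. (a) For all $\nu\ge\nu_0$, $v^\nu$ has zero cascades;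 all $v_j$ have zero cascades; and for each $j$ there are $s_j^\nu\in\mathbb{R}$ with $v^\nu(\cdot+s^\nu_j)\to v_j$ in $C^\infty_{loc}$. (b) For all $\nu\ge\nu_0$, $v^\nu=((x^\nu_k)_{1\le k\le m^\nu},(t^\nu_k)_{1\le k\le m^\nu-1})$ has $m^\nu\ge1$ cascades, and: (i) for each $j$ with $m_j=0$ there are Morse flow lines $y^\nu_j$ $(\nu\geq\nu_0)$ converging to $v_j$ in $C^\infty_{loc}$, real numbers $s^\nu_j$ and integers $k^\nu\in[1,m^\nu]$ such that for each $\nu\ge\nu_0$ either $\lim_{s\to-\infty}x^\nu_{k^\nu}(s)=y^\nu_j(s^\nu_j)$ or $\lim_{s\to\infty}x^\nu_{k^\nu}(s)=y^\nu_j(s^\nu_j)$; (ii) put $N=\sum_{p=1}^\ell m_p$, and write $v_j=((x_{i,j})_{1\le i\le m_j},(t_{i,j})_{1\le i\le m_j-1})$ if $m_j\ge1$. Every $\lambda\in\{1,\dots,N\}$ is uniquely $\lambda=\sum_{p<j}m_p+i$ with $1\le i\le m_j$; put $x_\lambda=x_{i,j}$, and $\tau_\lambda=t_{i,j}$ if $i<m_j$,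 $\tau_\lambda=\infty$ if $i=m_j$. There are monotone increasing surjections $\gamma^\nu\colon\{1,\dots,N\}\to\{1,\dots,m^\nu\}$ $(\nu\ge\nu_0)$ and real numbers $s^\nu_\lambda$ such that $x^\nu_{\gamma^\nu(\lambda)}(\cdot+s^\nu_\lambda)\to x_\lambda$ in $C^\infty_{loc}$ for every $\lambda\in\{1,\dots,N\}$, and $\lim_{\nu\to\infty}\tau^\nu_\lambda=\tau_\lambda$ in $[0,\infty]$ for $1\le\lambda\le N-1$, where $\tau^\nu_\lambda=t^\nu_{\gamma^\nu(\lambda)}$ if $\lambda$ is the largest $\lambda'\in\{1,\dots,N\}$ with $\gamma^\nu(\lambda')=\gamma^\nu(\lambda)$, and $\tau^\nu_\lambda=0$ otherwise. \textbf{Theorem (Compactness).} For every sequence $(v^\nu)_{\nu\in\mathbb{N}}$ of flow lines with cascades, where $v^\nu$ runs from some critical point of $h$ to some critical point of $h$ (both may depend on $\nu$), there exist a subsequence $v^{\nu_j}$ and a broken flow line with cascades $\mathbf v$, from some $c\in\mathrm{crit}(h)$ to some $d\in\mathrm{crit}(h)$, such that $v^{\nu_j}$ Floer--Gromov converges to $\mathbf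 v$. -/

import Mathlib

open Set Filter Topology Manifold
open scoped ContDiff

noncomputable section

namespace MorseBott

universe u w

variable {E : Type u} [NormedAddCommGroup E] [NormedSpace ℝ E]
  {M : Type w} [TopologicalSpace M] [ChartedSpace E M]

/-! ### Embedded submanifolds, functions and metrics on them -/

/-- A slice chart of the subset `S` of `M` around the point `x`: a smooth chart of `M` in whose
domain `S` is the preimage of the affine subspace through the image of `x` with direction `dir`. -/
structure SliceChart (S : Set M) (x : M) where
  chart : OpenPartialHomeomorph M E
  mem_maximalAtlas : chart ∈ IsManifold.maximalAtlas 𝓘(ℝ, E) ∞ M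
  mem_source : x ∈ chart.source
  dir : Submodule ℝ E
  mem_iff : ∀ y ∈ chart.source, y ∈ S ↔ chart y - chart x ∈ dir

namespace SliceChart

variable {S : Set M} {x : M}

/-- The local parametrization of `S` given by a slice chart. It is meaningful near `0`,
where it takes values in `S`, and it sends `0` to `x`. -/
def param (σ : SliceChart (E := E) S x) (z : σ.dir) : M :=
  σ.chart.symm (σ.chart x + (z : E))

/-- The tangent space `T_x S`, as a subspace of `T_x M`: the vectors whose coordinates in the
slice chart lie in the direction of the slice. -/
def tangentSpace (σ : SliceChart (E := E) S x) : Submodule ℝ (TangentSpace 𝓘(ℝ, E) x) :=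
  Submodule.comap (mfderiv 𝓘(ℝ, E) 𝓘(ℝ, E) σ.chart x).toLinearMap σ.dir

/-- The coordinate vector of a tangent vector of `S`. -/
def coord (σ : SliceChart (E := E) S x) (v : σ.tangentSpace) : σ.dir :=
  ⟨mfderiv 𝓘(ℝ, E) 𝓘(ℝ, E) σ.chart x v.1, v.2⟩

/-- The differential at `x`, in the slice chart, of a function on `S`. -/
def diff (σ : SliceChart (E := E) S x) (h : M → ℝ) : σ.dir →L[ℝ] ℝ :=
  fderiv ℝ (h ∘ σ.param) 0

/-- The second derivative at `x`, in the slice chart, of a function on `S`; at a critical point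
this is the Hessian. -/
def hess (σ : SliceChart (E := E) S x) (h : M → ℝ) : σ.dir →L[ℝ] σ.dir →L[ℝ] ℝ :=
  fderiv ℝ (fderiv ℝ (h ∘ σ.param)) 0

end SliceChart

variable (E) in
/-- `S` is an embedded smooth submanifold of `M`. Its dimension may vary with the connected
component. -/
def IsSubmanifold (S : Set M) : Prop :=
  ∀ x ∈ S, Nonempty (SliceChart (E := E) S x)

variable (E) in
/-- `h` is a smooth function on the submanifold `S`. Only the values of `h` on `S` matter, here
and below. -/
def SmoothOn (S : Set M) (h : M → ℝ) : Prop :=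
  ∀ x ∈ S, ∀ σ : SliceChart (E := E) S x, ContDiffAt ℝ ∞ (h ∘ σ.param) 0

variable (E) in
/-- The critical points of a function `h` on the submanifold `S`. -/
def critOn (S : Set M) (h : M → ℝ) : Set M :=
  {c | c ∈ S ∧ ∀ σ : SliceChart (E := E) S c, σ.diff h = 0}

variable (E) in
/-- `h` is a Morse function on the submanifold `S`: it is smooth and all its critical points are
nondegenerate. -/
def IsMorseOn (S : Set M) (h : M → ℝ) : Prop :=
  SmoothOn E S h ∧
    ∀ c ∈ critOn E S h, ∀ σ : SliceChart (E := E) S c, ∀ v : σ.dir,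
      (∀ v' : σ.dir, σ.hess h v v' = 0) → v = 0

variable (E) in
/-- A smooth Riemannian metric on the submanifold `S` of `M`. Only the values of `inner x` on
vectors tangent to `S`, for `x ∈ S`, matter. -/
structure MetricOn (S : Set M) where
  inner (x : M) : TangentSpace 𝓘(ℝ, E) x →L[ℝ] TangentSpace 𝓘(ℝ, E) x →L[ℝ] ℝ
  symm : ∀ x ∈ S, ∀ σ : SliceChart (E := E) S x, ∀ v ∈ σ.tangentSpace, ∀ v' ∈ σ.tangentSpace,
    inner x v v' = inner x v' v
  pos : ∀ x ∈ S, ∀ σ : SliceChart (E := E) S x, ∀ v ∈ σ.tangentSpace, v ≠ 0 → 0 < inner x v v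
  smooth : ∀ x ∈ S, ∀ σ : SliceChart (E := E) S x, ∀ a b : σ.dir,
    ContDiffAt ℝ ∞ (fun z : σ.dir =>
      inner (σ.param z) (mfderiv 𝓘(ℝ, σ.dir) 𝓘(ℝ, E) σ.param z a)
        (mfderiv 𝓘(ℝ, σ.dir) 𝓘(ℝ, E) σ.param z b)) 0

/-! ### Morse-Bott functions -/

variable (E) in
/-- The critical set of a function on `M`. -/
def crit (f : M → ℝ) : Set M :=
  {x | mfderiv 𝓘(ℝ, E) 𝓘(ℝ, ℝ) f x = 0}

/-- The Hessian of `f` at a critical point `x`, as a bilinear form on `T_x M`. The tangent space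
at `x` is identified with the model space `E` by the preferred chart at `x`. -/
def hessian (f : M → ℝ) (x : M) :
    TangentSpace 𝓘(ℝ, E) x →L[ℝ] TangentSpace 𝓘(ℝ, E) x →L[ℝ] ℝ :=
  (fderiv ℝ (fderiv ℝ (f ∘ (chartAt E x).symm)) (chartAt E x x) : E →L[ℝ] E →L[ℝ] ℝ)

variable (E) in
/-- `f` is Morse-Bott: it is smooth, its critical set is a submanifold, and at each critical point
the tangent space of the critical set is the kernel of the Hessian. -/
def IsMorseBott (f : M → ℝ) : Prop :=
  ContMDiff 𝓘(ℝ, E) 𝓘(ℝ, ℝ) ∞ f ∧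
  IsSubmanifold E (crit E f) ∧
  ∀ x ∈ crit E f, ∀ σ : SliceChart (E := E) (crit E f) x, ∀ v : TangentSpace 𝓘(ℝ, E) x,
    v ∈ σ.tangentSpace ↔ hessian f x v = 0

/-! ### Gradient flow lines -/

variable (E) in
/-- The velocity of a curve in `M`. -/
def velocity (x : ℝ → M) (s : ℝ) : TangentSpace 𝓘(ℝ, E) (x s) :=
  mfderiv 𝓘(ℝ, ℝ) 𝓘(ℝ, E) x s (1 : ℝ)

/-- `x : ℝ → M` is a smooth solution of `x' = -∇ f (x)`, where the gradient is taken with respect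
to the Riemannian metric `g`, i.e. `g (∇ f, ·) = df`. -/
def IsGradientLine [IsManifold 𝓘(ℝ, E) ∞ M]
    (g : Bundle.ContMDiffRiemannianMetric 𝓘(ℝ, E) ∞ E (TangentSpace 𝓘(ℝ, E) : M → Type u))
    (f : M → ℝ) (x : ℝ → M) : Prop :=
  ContMDiff 𝓘(ℝ, ℝ) 𝓘(ℝ, E) ∞ x ∧
  ∀ (s : ℝ) (v : TangentSpace 𝓘(ℝ, E) (x s)),
    g.inner (x s) (velocity E x s) v = -(mfderiv 𝓘(ℝ, E) 𝓘(ℝ, ℝ) f (x s) v : ℝ)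

/-- `y : ℝ → S` is a smooth solution of `y' = -∇ h (y)` on the submanifold `S`, where the gradient
is taken with respect to the Riemannian metric `g₀` of `S`. -/
def IsMorseLine {S : Set M} (g₀ : MetricOn E S) (h : M → ℝ) (y : ℝ → M) : Prop :=
  ContMDiff 𝓘(ℝ, ℝ) 𝓘(ℝ, E) ∞ y ∧ (∀ s, y s ∈ S) ∧
  ∀ (s : ℝ) (σ : SliceChart (E := E) S (y s)) (v : σ.tangentSpace),
    g₀.inner (y s) (velocity E y s) v = -(σ.diff h (σ.coord v))

/-- The unstable manifold of `c` for the negative gradient flow of `h` on `S`. -/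
def unstableManifold {S : Set M} (g₀ : MetricOn E S) (h : M → ℝ) (c : M) : Set M :=
  {p | ∃ y : ℝ → M, IsMorseLine g₀ h y ∧ y 0 = p ∧ Tendsto y atBot (𝓝 c)}

/-- The stable manifold of `c` for the negative gradient flow of `h` on `S`. -/
def stableManifold {S : Set M} (g₀ : MetricOn E S) (h : M → ℝ) (c : M) : Set M :=
  {p | ∃ y : ℝ → M, IsMorseLine g₀ h y ∧ y 0 = p ∧ Tendsto y atTop (𝓝 c)}

/-! ### Flow lines with cascades -/

/-- The data of a flow line with cascades: either a single curve `y` in the critical set (zero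
cascades), or `m + 1` cascades `x 0, …, x m` and `m` times `t 0, …, t (m - 1)`. -/
inductive CascadeData (M : Type w) : Type w
  | zero (y : ℝ → M) : CascadeData M
  | cascades (m : ℕ) (x : Fin (m + 1) → ℝ → M) (t : Fin m → ℝ) : CascadeData M

namespace CascadeData

/-- The number of cascades. -/
def num {M : Type w} : CascadeData M → ℕ
  | zero _ => 0
  | cascades m _ _ => m + 1

/-- The `k`-th cascade. -/
def cascade {M : Type w} : (v : CascadeData M) → Fin v.num → ℝ → M
  | zero _ => fun k => k.elim0
  | cascades _ x _ => x

/-- The time `t k` spent on the Morse flow line from the `k`-th to the next cascade. The value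
for the last cascade, after which there is no such time, is irrelevant. -/
def time {M : Type w} : (v : CascadeData M) → Fin v.num → ℝ
  | zero _ => fun k => k.elim0
  | cascades m _ t => fun k => if hk : (k : ℕ) < m then t ⟨k, hk⟩ else 0

end CascadeData

/-- `v` is a flow line with cascades from `c` to `d`. -/
def IsFlowLine [IsManifold 𝓘(ℝ, E) ∞ M]
    (g : Bundle.ContMDiffRiemannianMetric 𝓘(ℝ, E) ∞ E (TangentSpace 𝓘(ℝ, E) : M → Type u))
    (f : M → ℝ) (g₀ : MetricOn E (crit E f)) (h : M → ℝ) (c d : M) : CascadeData M → Prop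
  | .zero y => IsMorseLine g₀ h y ∧ Tendsto y atBot (𝓝 c) ∧ Tendsto y atTop (𝓝 d)
  | .cascades m x t =>
    (∀ k, IsGradientLine g f (x k) ∧ ¬ ∃ p, ∀ s, x k s = p) ∧
    (∃ p ∈ unstableManifold g₀ h c, Tendsto (x 0) atBot (𝓝 p)) ∧
    (∃ q ∈ stableManifold g₀ h d, Tendsto (x (Fin.last m)) atTop (𝓝 q)) ∧
    ∀ k : Fin m, 0 ≤ t k ∧ ∃ y : ℝ → M, IsMorseLine g₀ h y ∧
      Tendsto (x k.castSucc) atTop (𝓝 (y 0)) ∧ Tendsto (x k.succ) atBot (𝓝 (y (t k)))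

/-- A broken flow line with cascades from `c` to `d`: a nonempty finite chain of flow lines with
cascades through critical points of `h`. -/
structure BrokenFlowLine [IsManifold 𝓘(ℝ, E) ∞ M]
    (g : Bundle.ContMDiffRiemannianMetric 𝓘(ℝ, E) ∞ E (TangentSpace 𝓘(ℝ, E) : M → Type u))
    (f : M → ℝ) (g₀ : MetricOn E (crit E f)) (h : M → ℝ) (c d : M) where
  length : ℕ
  length_pos : 0 < length
  point : Fin (length + 1) → M
  piece : Fin length → CascadeData M
  point_mem : ∀ j, point j ∈ critOn E (crit E f) h
  point_zero : point 0 = c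
  point_last : point (Fin.last length) = d
  isFlowLine : ∀ j : Fin length, IsFlowLine g f g₀ h (point j.castSucc) (point j.succ) (piece j)

namespace BrokenFlowLine

variable [IsManifold 𝓘(ℝ, E) ∞ M]
  {g : Bundle.ContMDiffRiemannianMetric 𝓘(ℝ, E) ∞ E (TangentSpace 𝓘(ℝ, E) : M → Type u)}
  {f : M → ℝ} {g₀ : MetricOn E (crit E f)} {h : M → ℝ} {c d : M}

/-- The total number of cascades of the pieces. -/
def total (b : BrokenFlowLine g f g₀ h c d) : ℕ :=
  ∑ j, (b.piece j).num

/-- The index `lam` of a cascade in the concatenation of all pieces corresponds to the pair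
`(j, i)` of a piece and of the number of a cascade in it, where `lam` is the sum of the numbers
of cascades of the pieces before `j`, plus `i`. -/
def index (b : BrokenFlowLine g f g₀ h c d) (lam : Fin b.total) :
    (j : Fin b.length) × Fin (b.piece j).num :=
  finSigmaFinEquiv.symm lam

/-- The cascade with index `lam` in the concatenation of all pieces. -/
def cascade (b : BrokenFlowLine g f g₀ h c d) (lam : Fin b.total) : ℝ → M :=
  (b.piece (b.index lam).1).cascade (b.index lam).2

/-- The time between the cascade with index `lam` and the next one: `t` if both belong to the same
piece, and `∞` if `lam` is the last cascade of its piece. -/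
def time (b : BrokenFlowLine g f g₀ h c d) (lam : Fin b.total) : EReal :=
  if ((b.index lam).2 : ℕ) + 1 < (b.piece (b.index lam).1).num then
    (((b.piece (b.index lam).1).time (b.index lam).2 : ℝ) : EReal)
  else ⊤

end BrokenFlowLine

/-! ### Floer-Gromov convergence -/

variable (E) in
/-- Convergence in the `C^∞_loc` topology of curves in `M`: locally in the source and in charts of
the target, all derivatives converge uniformly. -/
def TendstoCInftyLoc (x : ℕ → ℝ → M) (x' : ℝ → M) : Prop :=
  ∀ s₀ : ℝ, ∃ δ > 0,
    (∀ s ∈ Icc (s₀ - δ) (s₀ + δ), x' s ∈ (chartAt E (x' s₀)).source) ∧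
    (∀ᶠ n in atTop, ∀ s ∈ Icc (s₀ - δ) (s₀ + δ), x n s ∈ (chartAt E (x' s₀)).source) ∧
    ∀ k : ℕ, TendstoUniformlyOn
      (fun n => iteratedDeriv k (fun s => chartAt E (x' s₀) (x n s)))
      (iteratedDeriv k (fun s => chartAt E (x' s₀) (x' s)))
      atTop (Icc (s₀ - δ) (s₀ + δ))

/-- The time assigned to the index `lam` by a map `γ` from the cascades of the limit to the
cascades of `v`: the time of the cascade `γ lam` if `lam` is the last index that is mapped to this
cascade, and `0` otherwise. -/
def assignedTime {N : ℕ} (v : CascadeData M) (γ : Fin N → Fin v.num) (lam : Fin N) : ℝ :=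
  open Classical in if ∀ lam', γ lam' = γ lam → lam' ≤ lam then v.time (γ lam) else 0

section

variable [IsManifold 𝓘(ℝ, E) ∞ M]
  {g : Bundle.ContMDiffRiemannianMetric 𝓘(ℝ, E) ∞ E (TangentSpace 𝓘(ℝ, E) : M → Type u)}
  {f : M → ℝ} {g₀ : MetricOn E (crit E f)} {h : M → ℝ} {c d : M}

/-- The requirement of Floer-Gromov convergence for flow lines with zero cascades. -/
def TendstoZero (v : ℕ → CascadeData M) (b : BrokenFlowLine g f g₀ h c d) : Prop :=
  ∃ y : ℕ → ℝ → M, (∀ n, v n = .zero (y n)) ∧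
    ∀ j, ∃ z : ℝ → M, b.piece j = .zero z ∧
      ∃ s : ℕ → ℝ, TendstoCInftyLoc E (fun n r => y n (r + s n)) z

/-- The requirement of Floer-Gromov convergence for flow lines with at least one cascade. -/
def TendstoCascades (v : ℕ → CascadeData M) (b : BrokenFlowLine g f g₀ h c d) : Prop :=
  (∀ n, 0 < (v n).num) ∧
  (∀ (j : Fin b.length) (z : ℝ → M), b.piece j = .zero z →
    ∃ (y : ℕ → ℝ → M) (s : ℕ → ℝ) (k : ∀ n, Fin (v n).num),
      (∀ n, IsMorseLine g₀ h (y n)) ∧ TendstoCInftyLoc E y z ∧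
      ∀ n, Tendsto ((v n).cascade (k n)) atBot (𝓝 (y n (s n))) ∨
        Tendsto ((v n).cascade (k n)) atTop (𝓝 (y n (s n)))) ∧
  ∃ (γ : ∀ n, Fin b.total → Fin (v n).num) (s : ℕ → Fin b.total → ℝ),
    (∀ n, Function.Surjective (γ n) ∧ Monotone (γ n)) ∧
    (∀ lam, TendstoCInftyLoc E
      (fun n r => (v n).cascade (γ n lam) (r + s n lam)) (b.cascade lam)) ∧
    ∀ lam : Fin b.total, (lam : ℕ) + 1 < b.total →
      Tendsto (fun n => ((assignedTime (v n) (γ n) lam : ℝ) : EReal)) atTop (𝓝 (b.time lam))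

/-- Floer-Gromov convergence of a sequence of flow lines with cascades to a broken flow line with
cascades from `c` to `d`: from some index `n₀` on, the members of the sequence are flow lines with
cascades from `c` to `d`, and one of the two requirements above holds for this tail. -/
def FloerGromovTendsto (v : ℕ → CascadeData M) (b : BrokenFlowLine g f g₀ h c d) : Prop :=
  ∃ n₀ : ℕ, (∀ n ≥ n₀, IsFlowLine g f g₀ h c d (v n)) ∧
    (TendstoZero (fun n => v (n + n₀)) b ∨ TendstoCascades (fun n => v (n + n₀)) b)

end

end MorseBott

end

/-! The negative gradient flow of `h` on `crit f` and that of `f` on `M` (with `M` regarded as the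
submanifold `univ` of itself) are treated by one theory. Both are gradient systems on a compact
submanifold that satisfy the Łojasiewicz inequality with exponent 1/2, |h − h(p)| ≤ C |∇h|², near
each critical point p. For Morse functions and for Morse–Bott functions alike this follows from
nondegeneracy of the Hessian transverse to the critical set (`exists_abs_sub_le_sq_norm_fderiv`).

The inequality has three consequences. Critical values are finite in number
(`IsLojasiewicz.finite_values`). Along a flow line near a level a, every smooth function changes by
at most a constant times the sum of the square roots of the distances of the end levels from a
(`IsLojasiewicz.exists_estimate`); hence flow lines converge at both ends. And if flow lines y_n
pass close to a critical point q, then a limit of their shifts at much later times, still near the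
level of q, emanates from q itself and not merely from some critical point on the same level
(`IsLojasiewicz.tendsto_atBot_of_close`). The last point is essential for f, whose critical points
are not isolated.

Breaking is proved in `IsLojasiewicz.exists_chain`. The lines are cut at a level slightly below that
of q; the limit through the cut leaves q and ends at a critical point of strictly smaller value,
from which the argument is repeated. Finiteness of the critical values ends the recursion.

For cascades, `IsFlowLine.num_le` and the finiteness of the critical points of h reduce the theorem
to sequences with fixed ends and a fixed number of cascades. Along a nonprincipal ultrafilter all
end points of cascades converge, and every t_k tends to a finite time or to infinity. Each cascade
converges to a nonempty chain of lines of f, consecutive ones being separated by time 0. A finite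
limit of t_k continues the current piece; an infinite limit makes the connecting Morse lines break,
which ends the piece and inserts pieces with zero cascades. `hasOpenLimit` assembles the limit by
induction from the last cascade to the first.

Only convergence at a single time has to be checked, because convergence of initial values implies
convergence in C^∞_loc (`IsCompactGradient.tendstoCInftyLoc`). So finitely many ultrafilter limits
of points and times determine everything, and `exists_subseq_tendsto` turns them into limits along a
subsequence. -/

noncomputable section

namespace MorseBott

universe u w

variable {E : Type u} [NormedAddCommGroup E] [NormedSpace ℝ E]
  {M : Type w} [TopologicalSpace M] [ChartedSpace E M]


set_option linter.unusedSectionVars false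

/-! ### Linear coordinates on a slice and their compatibility with all other slice charts. -/

section Coordinates

variable [FiniteDimensional ℝ E] [IsManifold 𝓘(ℝ, E) ∞ M]

namespace SliceChart

variable {S : Set M} {x : M} (σ : SliceChart (E := E) S x)

/-- A Euclidean space isomorphic to the direction of the slice. -/
abbrev Coord : Type := EuclideanSpace ℝ (Fin (Module.finrank ℝ σ.dir))

/-- Linear coordinates on the direction of the slice. -/
def equiv : σ.Coord ≃L[ℝ] σ.dir := ContinuousLinearEquiv.ofFinrankEq (by simp)

/-- The inclusion of the direction of the slice into the model space, in linear coordinates. -/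
def incl : σ.Coord →L[ℝ] E := σ.dir.subtypeL.comp σ.equiv.toContinuousLinearMap

theorem incl_mem (z : σ.Coord) : σ.incl z ∈ σ.dir := (σ.equiv z).2

theorem incl_injective : Function.Injective σ.incl :=
  Subtype.val_injective.comp σ.equiv.injective

/-- The set on which the parametrization of a slice is defined. -/
def dom : Set σ.Coord := {z | σ.chart x + σ.incl z ∈ σ.chart.target}

/-- The parametrization of a slice. -/
def loc (z : σ.Coord) : M := σ.chart.symm (σ.chart x + σ.incl z)

theorem loc_eq : σ.loc = σ.param ∘ σ.equiv := rfl

theorem param_eq : σ.param = σ.loc ∘ σ.equiv.symm := by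
  funext z
  simp [loc_eq]

/-- A linear projection onto the direction of the slice, in linear coordinates. -/
def proj : E →L[ℝ] σ.Coord :=
  (σ.equiv.symm : σ.dir →L[ℝ] σ.Coord).comp
    (Submodule.ClosedComplemented.of_finiteDimensional σ.dir).choose

theorem proj_of_mem {v : E} (hv : v ∈ σ.dir) : σ.proj v = σ.equiv.symm ⟨v, hv⟩ :=
  congrArg σ.equiv.symm
    ((Submodule.ClosedComplemented.of_finiteDimensional σ.dir).choose_spec ⟨v, hv⟩)

theorem proj_incl (z : σ.Coord) : σ.proj (σ.incl z) = z := by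
  rw [σ.proj_of_mem (σ.incl_mem z)]
  exact σ.equiv.symm_apply_apply z

theorem incl_proj {v : E} (hv : v ∈ σ.dir) : σ.incl (σ.proj v) = v := by
  rw [σ.proj_of_mem hv]
  exact congrArg Subtype.val (σ.equiv.apply_symm_apply ⟨v, hv⟩)

/-- The coordinates, in the direction of the slice, of a point of `M`. -/
def coords (y : M) : σ.Coord := σ.proj (σ.chart y - σ.chart x)

theorem isOpen_dom : IsOpen σ.dom :=
  σ.chart.open_target.preimage (by fun_prop)

theorem zero_mem_dom : (0 : σ.Coord) ∈ σ.dom := by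
  simpa [dom] using σ.chart.map_source σ.mem_source

variable {σ}

theorem loc_mem_source {z : σ.Coord} (hz : z ∈ σ.dom) : σ.loc z ∈ σ.chart.source :=
  σ.chart.map_target hz

theorem chart_loc {z : σ.Coord} (hz : z ∈ σ.dom) :
    σ.chart (σ.loc z) = σ.chart x + σ.incl z :=
  σ.chart.right_inv hz

theorem loc_mem {z : σ.Coord} (hz : z ∈ σ.dom) : σ.loc z ∈ S := by
  rw [σ.mem_iff _ (loc_mem_source hz), chart_loc hz]
  simpa using σ.incl_mem z

theorem coords_loc {z : σ.Coord} (hz : z ∈ σ.dom) : σ.coords (σ.loc z) = z := by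
  simp [coords, chart_loc hz, proj_incl]

theorem incl_coords {y : M} (hyS : y ∈ S) (hy : y ∈ σ.chart.source) :
    σ.incl (σ.coords y) = σ.chart y - σ.chart x :=
  σ.incl_proj ((σ.mem_iff y hy).1 hyS)

theorem loc_coords {y : M} (hyS : y ∈ S) (hy : y ∈ σ.chart.source) :
    σ.loc (σ.coords y) = y := by
  rw [loc, incl_coords hyS hy]
  simp [σ.chart.left_inv hy]

theorem coords_mem_dom {y : M} (hyS : y ∈ S) (hy : y ∈ σ.chart.source) :
    σ.coords y ∈ σ.dom := by
  rw [dom, Set.mem_ofPred_eq, incl_coords hyS hy]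
  simp [σ.chart.map_source hy]

variable (σ) in
theorem coords_self : σ.coords x = 0 := by simp [coords]

variable (σ) in
theorem loc_zero : σ.loc 0 = x := by
  simp [loc, σ.chart.left_inv σ.mem_source]

theorem base_mem (σ : SliceChart (E := E) S x) : x ∈ S := by
  rw [σ.mem_iff x σ.mem_source]; simp

theorem contMDiffAt_loc {z : σ.Coord} (hz : z ∈ σ.dom) :
    ContMDiffAt 𝓘(ℝ, σ.Coord) 𝓘(ℝ, E) ∞ σ.loc z := by
  have h1 : ContMDiffAt 𝓘(ℝ, E) 𝓘(ℝ, E) ∞ σ.chart.symm (σ.chart x + σ.incl z) :=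
    contMDiffAt_symm_of_mem_maximalAtlas σ.mem_maximalAtlas hz
  have h2 : ContDiff ℝ ∞ (fun z : σ.Coord => σ.chart x + σ.incl z) :=
    contDiff_const.add σ.incl.contDiff
  exact h1.comp z h2.contDiffAt.contMDiffAt

theorem contMDiffAt_chart {y : M} (hy : y ∈ σ.chart.source) :
    ContMDiffAt 𝓘(ℝ, E) 𝓘(ℝ, E) ∞ σ.chart y :=
  contMDiffAt_of_mem_maximalAtlas σ.mem_maximalAtlas hy

theorem contMDiffAt_coords {y : M} (hy : y ∈ σ.chart.source) :
    ContMDiffAt 𝓘(ℝ, E) 𝓘(ℝ, σ.Coord) ∞ σ.coords y := by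
  have h2 : ContDiff ℝ ∞ (fun v : E => σ.proj (v - σ.chart x)) := by fun_prop
  exact h2.contDiffAt.contMDiffAt.comp y (contMDiffAt_chart hy)

theorem continuousAt_coords {y : M} (hy : y ∈ σ.chart.source) :
    ContinuousAt σ.coords y := (contMDiffAt_coords hy).continuousAt

theorem continuousAt_loc {z : σ.Coord} (hz : z ∈ σ.dom) :
    ContinuousAt σ.loc z := (contMDiffAt_loc hz).continuousAt

variable (σ) in
/-- The differential of the parametrization of a slice. -/
def dloc (z : σ.Coord) : σ.Coord →L[ℝ] E := mfderiv 𝓘(ℝ, σ.Coord) 𝓘(ℝ, E) σ.loc z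

variable (σ) in
/-- The differential of the chart of a slice. -/
def dchart (y : M) : E →L[ℝ] E := mfderiv 𝓘(ℝ, E) 𝓘(ℝ, E) σ.chart y

theorem hasMFDerivAt_loc {z : σ.Coord} (hz : z ∈ σ.dom) :
    HasMFDerivAt 𝓘(ℝ, σ.Coord) 𝓘(ℝ, E) σ.loc z (σ.dloc z) :=
  ((contMDiffAt_loc hz).mdifferentiableAt (by simp)).hasMFDerivAt

theorem hasMFDerivAt_chart {y : M} (hy : y ∈ σ.chart.source) :
    HasMFDerivAt 𝓘(ℝ, E) 𝓘(ℝ, E) σ.chart y (σ.dchart y) :=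
  ((contMDiffAt_chart hy).mdifferentiableAt (by simp)).hasMFDerivAt

theorem dchart_dloc {z : σ.Coord} (hz : z ∈ σ.dom) (a : σ.Coord) :
    σ.dchart (σ.loc z) (σ.dloc z a) = σ.incl a := by
  have h3 := (HasMFDerivAt.comp z (hasMFDerivAt_chart (loc_mem_source hz))
    (hasMFDerivAt_loc hz)).mfderiv
  have h4 : mfderiv 𝓘(ℝ, σ.Coord) 𝓘(ℝ, E) (σ.chart ∘ σ.loc) z = σ.incl := by
    have : σ.chart ∘ σ.loc =ᶠ[𝓝 z] fun z : σ.Coord => σ.chart x + σ.incl z := by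
      filter_upwards [σ.isOpen_dom.mem_nhds hz] with z' hz'
      exact chart_loc hz'
    rw [this.mfderiv_eq, mfderiv_eq_fderiv]
    exact (σ.incl.hasFDerivAt.const_add _).fderiv
  rw [h4] at h3
  exact (congrArg (fun L : σ.Coord →L[ℝ] E => L a) h3).symm

theorem dchart_injective {y : M} (hy : y ∈ σ.chart.source) :
    Function.Injective (σ.dchart y) := by
  have he : σ.chart.MDifferentiable 𝓘(ℝ, E) 𝓘(ℝ, E) :=
    ⟨(contMDiffOn_of_mem_maximalAtlas σ.mem_maximalAtlas).mdifferentiableOn (by simp),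
      (contMDiffOn_symm_of_mem_maximalAtlas σ.mem_maximalAtlas).mdifferentiableOn (by simp)⟩
  exact he.mfderiv_injective hy

theorem dloc_injective {z : σ.Coord} (hz : z ∈ σ.dom) : Function.Injective (σ.dloc z) := by
  intro a b hab
  apply σ.incl_injective
  rw [← dchart_dloc hz, ← dchart_dloc hz, hab]

variable (σ) in
theorem mem_tangentSpace_iff (v : E) : v ∈ σ.tangentSpace ↔ σ.dchart x v ∈ σ.dir := Iff.rfl

variable (σ) in
theorem coe_coord (v : σ.tangentSpace) : (σ.coord v : E) = σ.dchart x v.1 := rfl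

variable (σ) in
/-- The slice chart at another point of the slice. -/
@[reducible] def translate {y : M} (hyS : y ∈ S) (hy : y ∈ σ.chart.source) :
    SliceChart (E := E) S y where
  chart := σ.chart
  mem_maximalAtlas := σ.mem_maximalAtlas
  mem_source := hy
  dir := σ.dir
  mem_iff y' hy' := by
    have h := (σ.mem_iff y hy).1 hyS
    rw [σ.mem_iff y' hy', ← σ.dir.sub_mem_iff_left h]
    simp

theorem translate_param {y : M} (hyS : y ∈ S) (hy : y ∈ σ.chart.source) :
    (σ.translate hyS hy).param =
      fun z : σ.dir => σ.loc (σ.equiv.symm z + σ.coords y) := by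
  funext z
  change σ.chart.symm (σ.chart y + (z : E)) = _
  rw [loc, map_add, incl_coords hyS hy]
  have : σ.incl (σ.equiv.symm z) = z := congrArg Subtype.val (σ.equiv.apply_symm_apply z)
  rw [this]
  congr 1
  abel

theorem dloc_mem_tangentSpace {y : M} (hyS : y ∈ S) (hy : y ∈ σ.chart.source) (a : σ.Coord) :
    σ.dloc (σ.coords y) a ∈ (σ.translate hyS hy).tangentSpace := by
  have h := dchart_dloc (coords_mem_dom hyS hy) a
  rw [loc_coords hyS hy] at h
  change σ.dchart y (σ.dloc (σ.coords y) a) ∈ σ.dir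
  rw [h]
  exact σ.incl_mem a

/-- The tangent space of a submanifold and the differential of a function on it, as they are given
by any slice chart, in terms of the coordinates of a fixed slice chart. -/
theorem exists_dloc_eq {y : M} (hy : y ∈ σ.chart.source)
    (σ' : SliceChart (E := E) S y) {h : M → ℝ}
    (hd : DifferentiableAt ℝ (h ∘ σ.loc) (σ.coords y)) (v : σ'.tangentSpace) :
    ∃ a : σ.Coord, (v.1 : E) = σ.dloc (σ.coords y) a ∧
      σ'.diff h (σ'.coord v) = fderiv ℝ (h ∘ σ.loc) (σ.coords y) a := by
  have hyS : y ∈ S := σ'.base_mem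
  have hdom := coords_mem_dom hyS hy
  set a := σ'.equiv.symm (σ'.coord v) with ha
  have hda : σ'.dloc 0 a = (v.1 : E) := by
    apply dchart_injective σ'.mem_source
    have h := dchart_dloc σ'.zero_mem_dom a
    rw [σ'.loc_zero] at h
    rw [h]
    exact congrArg Subtype.val (σ'.equiv.apply_symm_apply (σ'.coord v))
  -- The transition map between the two slices. Near 0 one has `σ'.loc = σ.loc ∘ T`, so the chain
  -- rule transports both tangent vectors and differentials.
  set T : σ'.Coord → σ.Coord := σ.coords ∘ σ'.loc with hT
  have hT0 : T 0 = σ.coords y := by simp [hT, σ'.loc_zero]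
  have hT1 : DifferentiableAt ℝ T 0 := by
    have h1 : ContMDiffAt 𝓘(ℝ, E) 𝓘(ℝ, σ.Coord) ∞ σ.coords (σ'.loc 0) := by
      rw [σ'.loc_zero]; exact contMDiffAt_coords hy
    have := (h1.comp 0 (contMDiffAt_loc σ'.zero_mem_dom)).mdifferentiableAt (by simp)
    exact this.differentiableAt
  have hev : σ'.loc =ᶠ[𝓝 0] σ.loc ∘ T := by
    have hc : ContinuousAt σ'.loc 0 := continuousAt_loc σ'.zero_mem_dom
    have : σ.chart.source ∈ 𝓝 (σ'.loc 0) := by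
      rw [σ'.loc_zero]; exact σ.chart.open_source.mem_nhds hy
    filter_upwards [σ'.isOpen_dom.mem_nhds σ'.zero_mem_dom, hc this] with z hz hz'
    exact (loc_coords (loc_mem hz) hz').symm
  have hd1 : σ'.dloc 0 a = σ.dloc (σ.coords y) (fderiv ℝ T 0 a) := by
    have h2 := hasMFDerivAt_loc (σ := σ) (z := T 0) (by rw [hT0]; exact hdom)
    have h3 := (HasMFDerivAt.comp 0 h2 hT1.hasFDerivAt.hasMFDerivAt).mfderiv
    have h4 : σ'.dloc 0 = (σ.dloc (T 0)).comp (fderiv ℝ T 0) := by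
      conv_lhs => unfold dloc
      rw [hev.mfderiv_eq]
      exact h3
    rw [h4, hT0]
    rfl
  refine ⟨fderiv ℝ T 0 a, by rw [← hd1, hda], ?_⟩
  have hdiff : fderiv ℝ (h ∘ σ'.loc) 0 = (fderiv ℝ (h ∘ σ.loc) (σ.coords y)).comp (fderiv ℝ T 0) := by
    have h5 : h ∘ σ'.loc =ᶠ[𝓝 0] (h ∘ σ.loc) ∘ T := by
      filter_upwards [hev] with z hz
      simp [hz]
    rw [h5.fderiv_eq, fderiv_comp _ (by rw [hT0]; exact hd) hT1, hT0]
  have h6 : σ'.diff h (σ'.coord v) = fderiv ℝ (h ∘ σ'.loc) 0 a := by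
    have h7 : h ∘ σ'.loc = (h ∘ σ'.param) ∘ σ'.equiv := rfl
    rw [h7, ContinuousLinearEquiv.comp_right_fderiv, map_zero]
    unfold diff
    simp [ha]
  rw [h6, hdiff]
  rfl

end SliceChart

end Coordinates

/-! ### The gradient equation as an ordinary differential equation in slice coordinates. -/

section LocalModel

variable [FiniteDimensional ℝ E] [IsManifold 𝓘(ℝ, E) ∞ M]

/-- The metric as a bilinear form on the model space. -/
def MetricOn.form {S : Set M} (g₀ : MetricOn E S) (x : M) : E →L[ℝ] E →L[ℝ] ℝ := g₀.inner x

namespace SliceChart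

variable {S : Set M} {x : M} {σ : SliceChart (E := E) S x} {g₀ : MetricOn E S} {h : M → ℝ}

variable (σ g₀) in
/-- The metric in the coordinates of a slice chart. -/
def gram (z : σ.Coord) : σ.Coord →L[ℝ] σ.Coord →L[ℝ] ℝ :=
  ContinuousLinearMap.bilinearComp (g₀.form (σ.loc z)) (σ.dloc z) (σ.dloc z)

theorem gram_apply (z a b : σ.Coord) :
    σ.gram g₀ z a b = g₀.form (σ.loc z) (σ.dloc z a) (σ.dloc z b) := rfl

/-- `SmoothOn` and `MetricOn.smooth` speak only of the centre of a slice chart. Recentring the chart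
at another point of the slice turns them into smoothness on the whole coordinate domain. -/
theorem contDiffAt_of_translate {F : Type*} [NormedAddCommGroup F] [NormedSpace ℝ F]
    {k : σ.Coord → F} {m : WithTop ℕ∞} {z : σ.Coord}
    (hk : ContDiffAt ℝ m (fun w : σ.dir => k (σ.equiv.symm w + z)) 0) : ContDiffAt ℝ m k z := by
  have h2 : ContDiffAt ℝ m (fun w : σ.dir => k (σ.equiv.symm w + z)) (σ.equiv (z - z)) := by
    rw [sub_self, map_zero]; exact hk
  have h3 := h2.comp z (f := fun z' : σ.Coord => σ.equiv (z' - z))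
    (σ.equiv.contDiff.contDiffAt.comp z (contDiffAt_id.sub contDiffAt_const))
  convert h3 using 1
  funext z'
  simp

theorem contDiffOn_gram : ContDiffOn ℝ ∞ (σ.gram g₀) σ.dom := by
  rw [contDiffOn_clm_apply]
  intro a
  rw [contDiffOn_clm_apply]
  intro b z hz
  apply ContDiffAt.contDiffWithinAt
  have hS := loc_mem hz
  have hs := loc_mem_source hz
  have h1 := g₀.smooth (σ.loc z) hS (σ.translate hS hs) (σ.equiv a) (σ.equiv b)
  apply contDiffAt_of_translate
  refine h1.congr_of_eventuallyEq ?_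
  have hd : ∀ᶠ w : σ.dir in 𝓝 0, σ.equiv.symm w + z ∈ σ.dom := by
    have hc : ContinuousAt (fun w : σ.dir => σ.equiv.symm w + z) 0 := by fun_prop
    apply hc.eventually_mem
    simpa using σ.isOpen_dom.mem_nhds hz
  filter_upwards [hd] with w hw
  have hp : (σ.translate hS hs).param = fun w : σ.dir => σ.loc (σ.equiv.symm w + z) := by
    rw [translate_param, coords_loc hz]
  have hm : ∀ c : σ.Coord, (mfderiv 𝓘(ℝ, σ.dir) 𝓘(ℝ, E) (σ.translate hS hs).param w :
      σ.dir → E) (σ.equiv c) = σ.dloc (σ.equiv.symm w + z) c := by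
    intro c
    have h2 : HasFDerivAt (fun w : σ.dir => σ.equiv.symm w + z)
        (σ.equiv.symm.toContinuousLinearMap) w := σ.equiv.symm.hasFDerivAt.add_const z
    have h3 := (HasMFDerivAt.comp w (hasMFDerivAt_loc hw) h2.hasMFDerivAt).mfderiv
    rw [hp]
    refine (congrArg (fun L : σ.dir →L[ℝ] E => L (σ.equiv c)) h3).trans ?_
    change σ.dloc (σ.equiv.symm w + z) (σ.equiv.symm (σ.equiv c)) = _
    rw [ContinuousLinearEquiv.symm_apply_apply]
  change g₀.form _ _ _ = g₀.form ((σ.translate hS hs).param w)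
    ((mfderiv 𝓘(ℝ, σ.dir) 𝓘(ℝ, E) (σ.translate hS hs).param w : σ.dir → E) (σ.equiv a))
    ((mfderiv 𝓘(ℝ, σ.dir) 𝓘(ℝ, E) (σ.translate hS hs).param w : σ.dir → E) (σ.equiv b))
  rw [hm, hm, hp]
  rfl

theorem gram_pos {z : σ.Coord} (hz : z ∈ σ.dom) {a : σ.Coord} (ha : a ≠ 0) :
    0 < σ.gram g₀ z a a := by
  have hS := loc_mem hz
  have hs := loc_mem_source hz
  have h1 := dloc_mem_tangentSpace hS hs a
  rw [coords_loc hz] at h1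
  refine g₀.pos (σ.loc z) hS (σ.translate hS hs) (σ.dloc z a) h1 fun h0 => ha ?_
  apply dloc_injective hz
  rw [map_zero]
  exact h0

/-- Positive definiteness gives injectivity, and a space and its dual have the same finite
dimension. -/
theorem isInvertible_gram {z : σ.Coord} (hz : z ∈ σ.dom) : (σ.gram g₀ z).IsInvertible := by
  have hinj : Function.Injective (σ.gram g₀ z : σ.Coord →ₗ[ℝ] σ.Coord →L[ℝ] ℝ) := by
    rw [← LinearMap.ker_eq_bot, LinearMap.ker_eq_bot']
    intro a ha
    by_contra hne
    have := gram_pos (g₀ := g₀) hz hne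
    rw [show σ.gram g₀ z a = 0 from ha] at this
    simp at this
  have hdim : Module.finrank ℝ σ.Coord = Module.finrank ℝ (σ.Coord →L[ℝ] ℝ) := by
    rw [← (LinearMap.toContinuousLinearMap : (σ.Coord →ₗ[ℝ] ℝ) ≃ₗ[ℝ] _).finrank_eq]
    exact (Subspace.dual_finrank_eq).symm
  let e := LinearEquiv.ofInjectiveOfFinrankEq (σ.gram g₀ z : σ.Coord →ₗ[ℝ] σ.Coord →L[ℝ] ℝ) hinj hdim
  refine ⟨e.toContinuousLinearEquiv, ?_⟩
  ext a b
  rfl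

variable (σ g₀ h) in
/-- The negative gradient in the coordinates of a slice chart. -/
def field (z : σ.Coord) : σ.Coord := -(σ.gram g₀ z).inverse (fderiv ℝ (h ∘ σ.loc) z)

theorem eq_field_iff {z : σ.Coord} (hz : z ∈ σ.dom) (a : σ.Coord) :
    σ.gram g₀ z a = -fderiv ℝ (h ∘ σ.loc) z ↔ a = σ.field g₀ h z := by
  have h1 := (isInvertible_gram (g₀ := g₀) hz).inverse_apply_eq
    (x := a) (y := -fderiv ℝ (h ∘ σ.loc) z)
  rw [field, ← map_neg, eq_comm, ← h1, eq_comm]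

theorem gram_field {z : σ.Coord} (hz : z ∈ σ.dom) :
    σ.gram g₀ z (σ.field g₀ h z) = -fderiv ℝ (h ∘ σ.loc) z :=
  (eq_field_iff hz _).2 rfl

theorem contDiffOn_comp_loc (hh : SmoothOn E S h) : ContDiffOn ℝ ∞ (h ∘ σ.loc) σ.dom := by
  intro z hz
  apply ContDiffAt.contDiffWithinAt
  have hS := loc_mem hz
  have hs := loc_mem_source hz
  have h1 := hh (σ.loc z) hS (σ.translate hS hs)
  rw [translate_param hS hs, coords_loc hz] at h1
  exact contDiffAt_of_translate h1

theorem contDiffOn_field (hh : SmoothOn E S h) : ContDiffOn ℝ ∞ (σ.field g₀ h) σ.dom := by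
  intro z hz
  apply ContDiffAt.contDiffWithinAt
  have hn := σ.isOpen_dom.mem_nhds hz
  have h1 : ContDiffAt ℝ ∞ (σ.gram g₀) z := contDiffOn_gram.contDiffAt hn
  have h2 : ContDiffAt ℝ ∞ (fderiv ℝ (h ∘ σ.loc)) z :=
    ((contDiffOn_comp_loc hh).contDiffAt hn).fderiv_right (by simp)
  obtain ⟨e, he⟩ := isInvertible_gram (g₀ := g₀) hz
  have h3 : ContDiffAt ℝ ∞ (fun z => (σ.gram g₀ z).inverse) z := by
    have : ContDiffAt ℝ ∞ ContinuousLinearMap.inverse (σ.gram g₀ z) := by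
      rw [← he]; exact contDiffAt_map_inverse e
    exact this.comp z h1
  exact (h3.clm_apply h2).neg

end SliceChart

theorem smoothOn_of_contMDiff {φ : M → ℝ} (hφ : ContMDiff 𝓘(ℝ, E) 𝓘(ℝ, ℝ) ∞ φ) (S : Set M) :
    SmoothOn E S φ := fun x _ σ => by
  have h1 := (hφ (σ.loc 0)).comp 0 (SliceChart.contMDiffAt_loc σ.zero_mem_dom)
  rw [σ.param_eq, ← Function.comp_assoc]
  have h2 : ContDiffAt ℝ ∞ (φ ∘ σ.loc) (σ.equiv.symm 0) := by
    rw [map_zero]; exact h1.contDiffAt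
  exact h2.comp 0 σ.equiv.symm.contDiff.contDiffAt

variable {S : Set M} {g₀ : MetricOn E S} {h : M → ℝ}

variable (g₀ h) in
/-- The vector `v` is the negative gradient of `h` at the point `p` of `S`. -/
def IsNegGradient (p : M) (v : E) : Prop :=
  ∀ (σ : SliceChart (E := E) S p) (w : σ.tangentSpace), g₀.form p v w.1 = -(σ.diff h (σ.coord w))

variable (g₀ h) in
/-- The curve `y` is a smooth solution of the negative gradient equation at the time `s`. -/
def MorseAt (y : ℝ → M) (s : ℝ) : Prop :=
  ContMDiffAt 𝓘(ℝ, ℝ) 𝓘(ℝ, E) ∞ y s ∧ (∀ᶠ s' in 𝓝 s, y s' ∈ S) ∧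
    IsNegGradient g₀ h (y s) (velocity E y s)

/-- The equation is local in time. This is what permits gluing solutions that are defined on
intervals only. -/
theorem isMorseLine_iff {y : ℝ → M} : IsMorseLine g₀ h y ↔ ∀ s, MorseAt g₀ h y s :=
  ⟨fun H s => ⟨H.1 s, Eventually.of_forall H.2.1, H.2.2 s⟩,
    fun H => ⟨fun s => (H s).1, fun s => (H s).2.1.self_of_nhds, fun s => (H s).2.2⟩⟩

theorem IsMorseLine.morseAt {y : ℝ → M} (H : IsMorseLine g₀ h y) (s : ℝ) : MorseAt g₀ h y s :=
  isMorseLine_iff.1 H s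

theorem MorseAt.mem {y : ℝ → M} {s : ℝ} (H : MorseAt g₀ h y s) : y s ∈ S :=
  H.2.1.self_of_nhds

theorem MorseAt.continuousAt {y : ℝ → M} {s : ℝ} (H : MorseAt g₀ h y s) : ContinuousAt y s :=
  H.1.continuousAt

theorem MorseAt.congr {y y' : ℝ → M} {s : ℝ} (H : MorseAt g₀ h y s) (he : y' =ᶠ[𝓝 s] y) :
    MorseAt g₀ h y' s := by
  refine ⟨H.1.congr_of_eventuallyEq he, ?_, ?_⟩
  · filter_upwards [H.2.1, he] with s' h1 h2
    rw [h2]; exact h1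
  · have h1 : y' s = y s := he.self_of_nhds
    have h2 : (velocity E y' s : E) = velocity E y s := by
      unfold velocity
      exact congrArg (fun L : ℝ →L[ℝ] E => L 1) he.mfderiv_eq
    rw [h1, show velocity E y' s = (velocity E y s : E) from h2]
    exact H.2.2

theorem MorseAt.comp_add {y : ℝ → M} {s a : ℝ} (H : MorseAt g₀ h y (s + a)) :
    MorseAt g₀ h (fun r => y (r + a)) s := by
  have hadd : ContMDiffAt 𝓘(ℝ, ℝ) 𝓘(ℝ, ℝ) ∞ (fun r : ℝ => r + a) s :=
    (contDiffAt_id.add contDiffAt_const).contMDiffAt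
  refine ⟨H.1.comp s hadd, ?_, ?_⟩
  · have : Tendsto (fun r : ℝ => r + a) (𝓝 s) (𝓝 (s + a)) := by
      exact (continuous_add_const a).tendsto s
    exact this.eventually H.2.1
  · have h2 : (velocity E (fun r => y (r + a)) s : E) = velocity E y (s + a) := by
      unfold velocity
      have h3 := HasMFDerivAt.comp s (H.1.mdifferentiableAt (by simp)).hasMFDerivAt
        ((hasDerivAt_id s).add_const a).hasFDerivAt.hasMFDerivAt
      have h4 := h3.mfderiv
      refine (congrArg (fun L : ℝ →L[ℝ] E => L 1) h4).trans ?_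
      change (mfderiv 𝓘(ℝ, ℝ) 𝓘(ℝ, E) y (s + a) : ℝ → E)
        ((ContinuousLinearMap.toSpanSingleton ℝ (1 : ℝ)) 1) = _
      simp
    rw [h2]
    exact H.2.2

theorem IsMorseLine.comp_add {y : ℝ → M} (H : IsMorseLine g₀ h y) (a : ℝ) :
    IsMorseLine g₀ h (fun r => y (r + a)) :=
  isMorseLine_iff.2 fun s => (H.morseAt (s + a)).comp_add

namespace MorseAt

variable {x : M} {σ : SliceChart (E := E) S x}

open SliceChart

theorem eventually_loc_coords {y : ℝ → M} {s : ℝ} (hc : ContinuousAt y s)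
    (hS : ∀ᶠ s' in 𝓝 s, y s' ∈ S) (hs : y s ∈ σ.chart.source) :
    y =ᶠ[𝓝 s] fun r => σ.loc (σ.coords (y r)) := by
  filter_upwards [hS, hc (σ.chart.open_source.mem_nhds hs)] with r h1 h2
  exact (loc_coords h1 h2).symm

theorem velocity_eq {y : ℝ → M} {s : ℝ} {a : σ.Coord} (hc : ContinuousAt y s)
    (hS : ∀ᶠ s' in 𝓝 s, y s' ∈ S) (hs : y s ∈ σ.chart.source)
    (hu : HasDerivAt (fun r => σ.coords (y r)) a s) :
    (velocity E y s : E) = σ.dloc (σ.coords (y s)) a := by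
  have hdom := coords_mem_dom hS.self_of_nhds hs
  have he := eventually_loc_coords hc hS hs
  have h3 := HasMFDerivAt.comp s (hasMFDerivAt_loc hdom) hu.hasFDerivAt.hasMFDerivAt
  have h4 : (mfderiv 𝓘(ℝ, ℝ) 𝓘(ℝ, E) y s) =
      (σ.dloc (σ.coords (y s))).comp (ContinuousLinearMap.toSpanSingleton ℝ a) := by
    rw [he.mfderiv_eq]; exact h3.mfderiv
  unfold velocity
  refine (congrArg (fun L : ℝ →L[ℝ] E => L 1) h4).trans ?_
  simp

/-- In a slice chart, a solution of the gradient equation is an integral curve of the field. -/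
theorem hasDerivAt {y : ℝ → M} {s : ℝ} (hh : SmoothOn E S h) (H : MorseAt g₀ h y s)
    (hs : y s ∈ σ.chart.source) :
    HasDerivAt (fun r => σ.coords (y r)) (σ.field g₀ h (σ.coords (y s))) s := by
  have hS := H.mem
  have hdom := coords_mem_dom hS hs
  have hd : DifferentiableAt ℝ (fun r => σ.coords (y r)) s :=
    (((contMDiffAt_coords hs).comp s H.1).mdifferentiableAt (by simp)).differentiableAt
  have hu := hd.hasDerivAt
  have hv := velocity_eq H.continuousAt H.2.1 hs hu
  set a := deriv (fun r => σ.coords (y r)) s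
  have hdh : DifferentiableAt ℝ (h ∘ σ.loc) (σ.coords (y s)) :=
    ((contDiffOn_comp_loc hh).contDiffAt (σ.isOpen_dom.mem_nhds hdom)).differentiableAt (by simp)
  -- The gradient equation is tested on the vectors `σ.dloc _ b`; since the Gram form is invertible,
  -- this determines the velocity.
  have : a = σ.field g₀ h (σ.coords (y s)) := by
    rw [← eq_field_iff hdom]
    ext b
    have hb := dloc_mem_tangentSpace hS hs b
    have h1 := H.2.2 (σ.translate hS hs) ⟨σ.dloc (σ.coords (y s)) b, hb⟩
    obtain ⟨b', hb', h2⟩ := exists_dloc_eq hs (σ.translate hS hs) hdh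
      ⟨σ.dloc (σ.coords (y s)) b, hb⟩
    have : b' = b := dloc_injective hdom hb'.symm
    rw [h2, this, hv] at h1
    rw [gram_apply, loc_coords hS hs]
    exact h1
  rw [← this]
  exact hu

/-- The gradient condition quantifies over all slice charts at p. By `exists_dloc_eq` every test
vector comes from the coordinates of σ, so solving the equation in a single chart suffices. -/
theorem isNegGradient_dloc (hh : SmoothOn E S h) {p : M} (hS : p ∈ S) (hs : p ∈ σ.chart.source) :
    IsNegGradient g₀ h p (σ.dloc (σ.coords p) (σ.field g₀ h (σ.coords p))) := by
  intro σ' w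
  have hdom := coords_mem_dom hS hs
  have hdh : DifferentiableAt ℝ (h ∘ σ.loc) (σ.coords p) :=
    ((contDiffOn_comp_loc hh).contDiffAt (σ.isOpen_dom.mem_nhds hdom)).differentiableAt (by simp)
  obtain ⟨b, hb, h2⟩ := exists_dloc_eq hs σ' hdh w
  rw [h2]
  have h3 := congrArg (fun L : σ.Coord →L[ℝ] ℝ => L b) (gram_field (g₀ := g₀) (h := h) hdom)
  simp only [gram_apply, loc_coords hS hs] at h3
  rw [show (w.1 : E) = σ.dloc (σ.coords p) b from hb]
  exact h3

theorem hasDerivAt_comp {φ : M → ℝ} (hφ : SmoothOn E S φ) {y : ℝ → M} {s : ℝ}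
    (hh : SmoothOn E S h) (H : MorseAt g₀ h y s) (hs : y s ∈ σ.chart.source) :
    HasDerivAt (fun r => φ (y r))
      (fderiv ℝ (φ ∘ σ.loc) (σ.coords (y s)) (σ.field g₀ h (σ.coords (y s)))) s := by
  have hdom := coords_mem_dom H.mem hs
  have h1 := H.hasDerivAt hh hs
  have hd : DifferentiableAt ℝ (φ ∘ σ.loc) (σ.coords (y s)) :=
    ((contDiffOn_comp_loc hφ).contDiffAt (σ.isOpen_dom.mem_nhds hdom)).differentiableAt (by simp)
  have h2 := hd.hasFDerivAt.comp_hasDerivAt s h1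
  refine h2.congr_of_eventuallyEq ?_
  filter_upwards [eventually_loc_coords H.continuousAt H.2.1 hs] with r hr
  simp only [Function.comp_apply]
  rw [← hr]

end MorseAt

/-- Integral curves of a smooth vector field are smooth. -/
theorem contDiffOn_of_hasDerivAt {F : Type*} [NormedAddCommGroup F] [NormedSpace ℝ F]
    {V : F → F} {Ω : Set F} (hV : ContDiffOn ℝ ∞ V Ω) {u : ℝ → F} {I : Set ℝ} (hI : IsOpen I)
    (hu : ∀ s ∈ I, u s ∈ Ω ∧ HasDerivAt u (V (u s)) s) : ContDiffOn ℝ ∞ u I := by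
  rw [contDiffOn_infty]
  intro n
  induction n with
  | zero =>
    rw [Nat.cast_zero, contDiffOn_zero]
    exact fun s hs => (hu s hs).2.continuousAt.continuousWithinAt
  | succ n ih =>
    rw [Nat.cast_succ, contDiffOn_succ_iff_deriv_of_isOpen hI]
    refine ⟨fun s hs => (hu s hs).2.differentiableAt.differentiableWithinAt, by simp, ?_⟩
    have : ContDiffOn ℝ n (V ∘ u) I :=
      (hV.of_le (by exact_mod_cast le_top)).comp ih fun s hs => (hu s hs).1
    exact this.congr fun s hs => (hu s hs).2.deriv

/-- Converse of `MorseAt.hasDerivAt`; the two together allow the theory of ordinary differential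
equations to be applied. -/
theorem morseAt_of_hasDerivAt (hh : SmoothOn E S h) {x : M} {σ : SliceChart (E := E) S x}
    {u : ℝ → σ.Coord} {I : Set ℝ} (hI : IsOpen I)
    (hu : ∀ s ∈ I, u s ∈ σ.dom ∧ HasDerivAt u (σ.field g₀ h (u s)) s) {s : ℝ} (hs : s ∈ I) :
    MorseAt g₀ h (σ.loc ∘ u) s := by
  have hsm := contDiffOn_of_hasDerivAt (SliceChart.contDiffOn_field (g₀ := g₀) hh) hI hu
  have hs1 := hsm.contDiffAt (hI.mem_nhds hs)
  have hS : ∀ᶠ s' in 𝓝 s, (σ.loc ∘ u) s' ∈ S := by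
    filter_upwards [hI.mem_nhds hs] with s' hs' using SliceChart.loc_mem (hu s' hs').1
  have hc : ContMDiffAt 𝓘(ℝ, ℝ) 𝓘(ℝ, E) ∞ (σ.loc ∘ u) s :=
    (SliceChart.contMDiffAt_loc (hu s hs).1).comp s hs1.contMDiffAt
  have hsrc := SliceChart.loc_mem_source (hu s hs).1
  refine ⟨hc, hS, ?_⟩
  have hev : (fun r => σ.coords ((σ.loc ∘ u) r)) =ᶠ[𝓝 s] u := by
    filter_upwards [hI.mem_nhds hs] with s' hs' using SliceChart.coords_loc (hu s' hs').1
  have hd := (hu s hs).2.congr_of_eventuallyEq hev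
  rw [MorseAt.velocity_eq hc.continuousAt hS hsrc hd]
  have h1 := MorseAt.isNegGradient_dloc (g₀ := g₀) hh hS.self_of_nhds hsrc
  rwa [show σ.coords ((σ.loc ∘ u) s) = u s from SliceChart.coords_loc (hu s hs).1] at h1 ⊢

-- Criticality is likewise tested in all slice charts centred at p. Since differentials transform by
-- `exists_dloc_eq`, any one chart whose domain contains p decides it.
open SliceChart in
theorem mem_critOn_iff (hh : SmoothOn E S h) {x p : M} {σ : SliceChart (E := E) S x} (hp : p ∈ S)
    (hs : p ∈ σ.chart.source) :
    p ∈ critOn E S h ↔ fderiv ℝ (h ∘ σ.loc) (σ.coords p) = 0 := by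
  have hdom := coords_mem_dom hp hs
  have hdh : DifferentiableAt ℝ (h ∘ σ.loc) (σ.coords p) :=
    ((contDiffOn_comp_loc hh).contDiffAt (σ.isOpen_dom.mem_nhds hdom)).differentiableAt (by simp)
  constructor
  · intro hc
    ext b
    have hb := dloc_mem_tangentSpace hp hs b
    obtain ⟨b', hb', h2⟩ := exists_dloc_eq hs (σ.translate hp hs) hdh
      ⟨σ.dloc (σ.coords p) b, hb⟩
    have : b' = b := dloc_injective hdom hb'.symm
    rw [this, hc.2] at h2
    exact h2.symm
  · intro h0
    refine ⟨hp, fun σ' => ?_⟩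
    ext a
    have ha : σ'.dloc 0 (σ'.equiv.symm a) ∈ σ'.tangentSpace := by
      rw [mem_tangentSpace_iff]
      have := dchart_dloc σ'.zero_mem_dom (σ'.equiv.symm a)
      rw [σ'.loc_zero] at this
      rw [this]
      exact σ'.incl_mem _
    have hca : σ'.coord ⟨_, ha⟩ = a := by
      apply Subtype.ext
      rw [coe_coord]
      have := dchart_dloc σ'.zero_mem_dom (σ'.equiv.symm a)
      rw [σ'.loc_zero] at this
      rw [this]
      exact congrArg Subtype.val (σ'.equiv.apply_symm_apply a)
    obtain ⟨b', hb', h2⟩ := exists_dloc_eq hs σ' hdh ⟨_, ha⟩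
    rw [hca, h0] at h2
    simpa using h2

theorem SliceChart.field_eq_zero_iff {x : M} {σ : SliceChart (E := E) S x} {z : σ.Coord}
    (hz : z ∈ σ.dom) : σ.field g₀ h z = 0 ↔ fderiv ℝ (h ∘ σ.loc) z = 0 := by
  rw [eq_comm, ← eq_field_iff hz, map_zero, eq_comm, neg_eq_zero]

end LocalModel

/-! ### Global existence and uniqueness of flow lines on a compact submanifold. -/

section Flow

variable [FiniteDimensional ℝ E] [IsManifold 𝓘(ℝ, E) ∞ M]

/-- A smooth function on a compact submanifold with a Riemannian metric. -/
structure IsCompactGradient {S : Set M} (g₀ : MetricOn E S) (h : M → ℝ) : Prop where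
  submanifold : IsSubmanifold E S
  compact : IsCompact S
  smooth : SmoothOn E S h

/-- Finitely many neighborhoods cover S, and the largest of their constants works because the
property is monotone in the constant. -/
theorem _root_.IsCompact.exists_uniform_bound {X : Type*} [TopologicalSpace X] {S : Set X}
    (hS : IsCompact S) {P : X → ℝ → Prop} (hP : ∀ q C C', C ≤ C' → P q C → P q C')
    (hloc : ∀ p ∈ S, ∃ C, ∀ᶠ q in 𝓝 p, q ∈ S → P q C) : ∃ C, ∀ q ∈ S, P q C := by
  refine hS.induction_on (p := fun T => ∃ C, ∀ q ∈ T, P q C) ⟨0, by simp⟩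
    (fun s t hst ⟨C, hC⟩ => ⟨C, fun q hq => hC q (hst hq)⟩)
    (fun s t ⟨C, hC⟩ ⟨C', hC'⟩ => ⟨max C C', ?_⟩) (fun p hp => ?_)
  · rintro q (hq | hq)
    · exact hP q _ _ (le_max_left _ _) (hC q hq)
    · exact hP q _ _ (le_max_right _ _) (hC' q hq)
  · obtain ⟨C, hC⟩ := hloc p hp
    refine ⟨{q | q ∈ S → P q C} ∩ S, ?_, C, fun q hq => hq.1 hq.2⟩
    exact inter_mem (mem_nhdsWithin_of_mem_nhds hC) self_mem_nhdsWithin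

/-- The Picard fixed point lives in a space of curves that stay in the ball. This information is
kept since the vector fields in question are smooth only on an open set. -/
theorem exists_mem_closedBall_of_isPicardLindelof {F : Type*} [NormedAddCommGroup F]
    [NormedSpace ℝ F] [CompleteSpace F] {f : ℝ → F → F} {tmin tmax : ℝ} {t₀ : Icc tmin tmax}
    {x₀ x : F} {a r L K : NNReal} (hf : IsPicardLindelof f t₀ x₀ a r L K)
    (hx : x ∈ Metric.closedBall x₀ r) :
    ∃ α : ℝ → F, α t₀ = x ∧ ∀ t ∈ Icc tmin tmax, α t ∈ Metric.closedBall x₀ a ∧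
      HasDerivWithinAt α (f t (α t)) (Icc tmin tmax) t := by
  obtain ⟨α, hα⟩ := ODE.FunSpace.exists_isFixedPt_next hf hx
  have hmem : ∀ t, α.compProj t ∈ Metric.closedBall x₀ a := fun t =>
    α.compProj_mem_closedBall hf.mul_max_le
  refine ⟨α.compProj, by rw [ODE.FunSpace.compProj_val, ← hα, ODE.FunSpace.next_apply₀],
    fun t ht => ⟨hmem t, ?_⟩⟩
  refine (ODE.hasDerivWithinAt_picard_Icc t₀.2 hf.continuousOn_uncurry
    α.continuous_compProj.continuousOn (fun _ _ => hmem _) x ht).congr_of_mem ?_ ht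
  intro t' ht'
  nth_rw 1 [← hα]
  rw [ODE.FunSpace.compProj_of_mem ht', ODE.FunSpace.next_apply]

/-- Integral curves of a vector field that is smooth on an open set, with a uniform time of
existence near a point. -/
theorem exists_integralCurve_of_contDiffOn {F : Type*} [NormedAddCommGroup F] [NormedSpace ℝ F]
    [CompleteSpace F] {V : F → F} {Ω : Set F} (hΩ : IsOpen Ω) (hV : ContDiffOn ℝ ∞ V Ω) {x₀ : F}
    (hx₀ : x₀ ∈ Ω) :
    ∃ ε > (0 : ℝ), ∀ᶠ x in 𝓝 x₀, ∀ t₀ : ℝ, ∃ u : ℝ → F, u t₀ = x ∧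
      ∀ t ∈ Ioo (t₀ - ε) (t₀ + ε), u t ∈ Ω ∧ HasDerivAt u (V (u t)) t := by
  have hat : ContDiffAt ℝ 1 V x₀ :=
    (hV.contDiffAt (hΩ.mem_nhds hx₀)).of_le (by exact_mod_cast le_top)
  obtain ⟨K, s, hs, hl⟩ := hat.exists_lipschitzOnWith
  have hbd : ∀ᶠ x in 𝓝 x₀, ‖V x‖ < ‖V x₀‖ + 1 :=
    hat.continuousAt.norm.eventually_lt_const (by linarith)
  obtain ⟨a, ha, has⟩ := Metric.nhds_basis_closedBall.mem_iff.1
    (inter_mem (inter_mem hs (hΩ.mem_nhds hx₀)) hbd)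
  set L : ℝ := ‖V x₀‖ + 1 with hL
  have hLpos : 0 < L := by positivity
  -- A curve of speed at most L that starts within a/2 of the centre stays in the ball of radius a
  -- for this time.
  set ε := a / (2 * L) with hε
  have hεpos : 0 < ε := by positivity
  refine ⟨ε, hεpos, ?_⟩
  filter_upwards [Metric.closedBall_mem_nhds x₀ (half_pos ha)] with x hx t₀
  have ht₀ : t₀ ∈ Icc (t₀ - ε) (t₀ + ε) := by constructor <;> linarith
  have hpl : IsPicardLindelof (fun _ => V) (tmin := t₀ - ε) (tmax := t₀ + ε) ⟨t₀, ht₀⟩ x₀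
      ⟨a, ha.le⟩ ⟨a / 2, (half_pos ha).le⟩ ⟨L, hLpos.le⟩ K := by
    refine IsPicardLindelof.of_time_independent (fun x hx => (has hx).2.le)
      (hl.mono fun x hx => (has hx).1.1) ?_
    change L * max (t₀ + ε - t₀) (t₀ - (t₀ - ε)) ≤ a - a / 2
    rw [add_sub_cancel_left, sub_sub_cancel, max_self, hε]
    apply le_of_eq
    field_simp
    norm_num
  obtain ⟨α, hα0, hα⟩ := exists_mem_closedBall_of_isPicardLindelof hpl hx
  refine ⟨α, hα0, fun t ht => ?_⟩
  have h1 := hα t (Ioo_subset_Icc_self ht)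
  exact ⟨(has h1.1).1.2, h1.2.hasDerivAt (Icc_mem_nhds ht.1 ht.2)⟩

variable {S : Set M} {g₀ : MetricOn E S} {h : M → ℝ}

namespace IsCompactGradient

open SliceChart

theorem exists_morseAt_near (H : IsCompactGradient g₀ h) {p : M} (hp : p ∈ S) :
    ∃ ε > (0 : ℝ), ∀ᶠ q in 𝓝 p, q ∈ S → ∀ t₀ : ℝ, ∃ y : ℝ → M, y t₀ = q ∧
      ∀ t ∈ Ioo (t₀ - ε) (t₀ + ε), MorseAt g₀ h y t := by
  obtain ⟨σ⟩ := H.submanifold p hp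
  obtain ⟨ε, hε, hev⟩ := exists_integralCurve_of_contDiffOn σ.isOpen_dom
    (contDiffOn_field (g₀ := g₀) H.smooth) σ.zero_mem_dom
  refine ⟨ε, hε, ?_⟩
  have hc : Tendsto σ.coords (𝓝 p) (𝓝 0) := by
    have := (continuousAt_coords (σ := σ) σ.mem_source).tendsto
    rwa [σ.coords_self] at this
  filter_upwards [hc.eventually hev, σ.chart.open_source.mem_nhds σ.mem_source] with q hq hq' hqS t₀
  obtain ⟨u, hu0, hu⟩ := hq t₀
  refine ⟨σ.loc ∘ u, by simp [hu0, loc_coords hqS hq'], fun t ht => ?_⟩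
  exact morseAt_of_hasDerivAt H.smooth isOpen_Ioo hu ht

theorem exists_uniform_time (H : IsCompactGradient g₀ h) :
    ∃ ε > (0 : ℝ), ∀ q ∈ S, ∀ t₀ : ℝ, ∃ y : ℝ → M, y t₀ = q ∧
      ∀ t ∈ Ioo (t₀ - ε) (t₀ + ε), MorseAt g₀ h y t := by
  -- The existence time is written as C⁻¹, so that the property becomes monotone in C as
  -- `IsCompact.exists_uniform_bound` requires.
  have hP : ∀ q C C', C ≤ C' → (0 < C ∧ ∀ t₀ : ℝ, ∃ y : ℝ → M, y t₀ = q ∧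
      ∀ t ∈ Ioo (t₀ - C⁻¹) (t₀ + C⁻¹), MorseAt g₀ h y t) → (0 < C' ∧ ∀ t₀ : ℝ, ∃ y : ℝ → M,
      y t₀ = q ∧ ∀ t ∈ Ioo (t₀ - C'⁻¹) (t₀ + C'⁻¹), MorseAt g₀ h y t) := by
    intro q C C' hle hC
    have hinv : C'⁻¹ ≤ C⁻¹ := inv_anti₀ hC.1 hle
    refine ⟨hC.1.trans_le hle, fun t₀ => ?_⟩
    obtain ⟨y, hy0, hy⟩ := hC.2 t₀
    exact ⟨y, hy0, fun t ht => hy t ⟨by linarith [ht.1], by linarith [ht.2]⟩⟩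
  have hloc : ∀ p ∈ S, ∃ C : ℝ, ∀ᶠ q in 𝓝 p, q ∈ S → (0 < C ∧ ∀ t₀ : ℝ, ∃ y : ℝ → M,
      y t₀ = q ∧ ∀ t ∈ Ioo (t₀ - C⁻¹) (t₀ + C⁻¹), MorseAt g₀ h y t) := by
    intro p hp
    obtain ⟨ε, hε, hev⟩ := H.exists_morseAt_near hp
    refine ⟨ε⁻¹, ?_⟩
    filter_upwards [hev] with q hq hqS
    refine ⟨inv_pos.2 hε, ?_⟩
    rw [inv_inv]
    exact hq hqS
  obtain ⟨C, hC⟩ := H.compact.exists_uniform_bound hP hloc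
  have hpos : 0 < max C 1 := lt_max_of_lt_right one_pos
  exact ⟨(max C 1)⁻¹, inv_pos.2 hpos, fun q hq => (hP q _ _ (le_max_left C 1) (hC q hq)).2⟩

theorem eventuallyEq_of_eq (H : IsCompactGradient g₀ h) {y y' : ℝ → M} {s : ℝ}
    (hy : ∀ᶠ r in 𝓝 s, MorseAt g₀ h y r) (hy' : ∀ᶠ r in 𝓝 s, MorseAt g₀ h y' r)
    (he : y s = y' s) : y =ᶠ[𝓝 s] y' := by
  obtain ⟨σ⟩ := H.submanifold _ hy.self_of_nhds.mem
  have hcd : ContDiffAt ℝ 1 (σ.field g₀ h) (σ.coords (y s)) :=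
    ((contDiffOn_field (g₀ := g₀) H.smooth).contDiffAt (σ.isOpen_dom.mem_nhds
      (coords_mem_dom hy.self_of_nhds.mem σ.mem_source))).of_le (by exact_mod_cast le_top)
  obtain ⟨K, T, hT, hl⟩ := hcd.exists_lipschitzOnWith
  have key : ∀ z : ℝ → M, (∀ᶠ r in 𝓝 s, MorseAt g₀ h z r) → z s = y s →
      (∀ᶠ r in 𝓝 s, z r ∈ σ.chart.source ∧ z r ∈ S) ∧ ∀ᶠ r in 𝓝 s,
        HasDerivAt (fun r => σ.coords (z r)) (σ.field g₀ h (σ.coords (z r))) r ∧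
          σ.coords (z r) ∈ T := by
    intro z hz hzs
    have hc := hz.self_of_nhds.continuousAt
    have h1 : ∀ᶠ r in 𝓝 s, z r ∈ σ.chart.source :=
      hc.eventually_mem (by rw [hzs]; exact σ.chart.open_source.mem_nhds σ.mem_source)
    have h2 : ∀ᶠ r in 𝓝 s, σ.coords (z r) ∈ T := by
      have : ContinuousAt (fun r => σ.coords (z r)) s :=
        ContinuousAt.comp (g := σ.coords) (by rw [hzs]; exact continuousAt_coords σ.mem_source) hc
      exact this.eventually_mem (by rw [hzs]; exact hT)
    refine ⟨?_, ?_⟩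
    · filter_upwards [h1, hz] with r h1 h3 using ⟨h1, h3.mem⟩
    · filter_upwards [h1, h2, hz] with r h1 h2 h3
      exact ⟨h3.hasDerivAt H.smooth h1, h2⟩
  obtain ⟨k1, k2⟩ := key y hy rfl
  obtain ⟨k3, k4⟩ := key y' hy' he.symm
  have := ODE_solution_unique_of_eventually (v := fun _ => σ.field g₀ h) (s := fun _ => T)
    (K := K) (Eventually.of_forall fun _ => hl) k2 k4
    (congrArg σ.coords he)
  filter_upwards [this, k1, k3] with r h1 h2 h3
  rw [← loc_coords h2.2 h2.1, ← loc_coords h3.2 h3.1]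
  exact congrArg σ.loc h1

/-- The set of times near which the curves agree is open by definition. It is relatively closed: at
a limit time the values agree because M is Hausdorff, and local uniqueness applies there. -/
theorem eqOn_of_eq [T2Space M] (H : IsCompactGradient g₀ h) {y y' : ℝ → M} {I : Set ℝ}
    (hI : IsOpen I) (hI' : IsPreconnected I)
    (hy : ∀ r ∈ I, MorseAt g₀ h y r) (hy' : ∀ r ∈ I, MorseAt g₀ h y' r) {s : ℝ} (hs : s ∈ I)
    (he : y s = y' s) : EqOn y y' I := by
  have hsub : I ⊆ {r | y =ᶠ[𝓝 r] y'} := by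
    refine hI'.subset_of_closure_inter_subset isOpen_setOfPred_eventually_nhds
      ⟨s, hs, ?_⟩ ?_
    · exact H.eventuallyEq_of_eq (eventually_of_mem (hI.mem_nhds hs) hy)
        (eventually_of_mem (hI.mem_nhds hs) hy') he
    · rintro r ⟨hr, hrI⟩
      refine H.eventuallyEq_of_eq (eventually_of_mem (hI.mem_nhds hrI) hy)
        (eventually_of_mem (hI.mem_nhds hrI) hy') ?_
      have hcl : ∃ᶠ r' in 𝓝 r, y r' = y' r' := by
        refine (mem_closure_iff_frequently.1 hr).mono fun r' hr' => hr'.self_of_nhds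
      by_contra hne
      obtain ⟨U, V, hU, hV, h1, h2, hd⟩ := t2_separation hne
      have e1 := (hy r hrI).continuousAt.eventually_mem (hU.mem_nhds h1)
      have e2 := (hy' r hrI).continuousAt.eventually_mem (hV.mem_nhds h2)
      obtain ⟨r', hr', h3, h4⟩ := (hcl.and_eventually (e1.and e2)).exists
      exact hd.le_bot ⟨h3, hr' ▸ h4⟩
  exact fun r hr => (hsub hr).self_of_nhds

theorem exists_glue [T2Space M] (H : IsCompactGradient g₀ h) {y₁ y₂ : ℝ → M} {a₁ b₁ a₂ b₂ c : ℝ}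
    (h1 : ∀ r ∈ Ioo a₁ b₁, MorseAt g₀ h y₁ r) (h2 : ∀ r ∈ Ioo a₂ b₂, MorseAt g₀ h y₂ r)
    (hc : c ∈ Ioo a₂ b₁) (ha : a₁ ≤ a₂) (hb : b₁ ≤ b₂) (he : y₁ c = y₂ c) :
    ∃ y : ℝ → M, (∀ r ∈ Ioo a₁ b₂, MorseAt g₀ h y r) ∧ EqOn y y₁ (Ioo a₁ b₁) ∧
      EqOn y y₂ (Ioo a₂ b₂) := by
  have heq : EqOn y₁ y₂ (Ioo a₂ b₁) := H.eqOn_of_eq isOpen_Ioo isPreconnected_Ioo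
    (fun r hr => h1 r ⟨ha.trans_lt hr.1, hr.2⟩) (fun r hr => h2 r ⟨hr.1, hr.2.trans_le hb⟩) hc he
  classical
  set y : ℝ → M := fun r => if r < b₁ then y₁ r else y₂ r with hy
  have e1 : EqOn y y₁ (Iio b₁) := fun r hr => if_pos hr
  have e2 : EqOn y y₂ (Ioo a₂ b₂) := fun r hr => by
    by_cases hrb : r < b₁
    · rw [e1 hrb]; exact heq ⟨hr.1, hrb⟩
    · exact if_neg hrb
  refine ⟨y, fun r hr => ?_, fun r hr => e1 hr.2, e2⟩
  by_cases hrb : r < b₁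
  · exact (h1 r ⟨hr.1, hrb⟩).congr (e1.eventuallyEq_of_mem (Iio_mem_nhds hrb))
  · have hr2 : r ∈ Ioo a₂ b₂ := ⟨hc.1.trans (hc.2.trans_le (not_lt.1 hrb)), hr.2⟩
    exact (h2 r hr2).congr (e2.eventuallyEq_of_mem (Ioo_mem_nhds hr2.1 hr2.2))

/-- Every point of `S` lies on a flow line. -/
theorem exists_isMorseLine [T2Space M] (H : IsCompactGradient g₀ h) {p : M} (hp : p ∈ S) :
    ∃ y : ℝ → M, IsMorseLine g₀ h y ∧ y 0 = p := by
  obtain ⟨ε, hε, hex⟩ := H.exists_uniform_time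
  have step : ∀ n : ℕ, ∃ y : ℝ → M, y 0 = p ∧
      ∀ r ∈ Ioo (-((n + 1) * (ε / 2))) ((n + 1) * (ε / 2)), MorseAt g₀ h y r := by
    intro n
    induction n with
    | zero =>
      obtain ⟨y, hy0, hy⟩ := hex p hp 0
      refine ⟨y, hy0, fun r hr => hy r ?_⟩
      constructor <;> [have := hr.1; have := hr.2] <;> push_cast at this <;> linarith
    | succ n ih =>
      obtain ⟨y, hy0, hy⟩ := ih
      set b := ((n : ℝ) + 1) * (ε / 2) with hb
      have hbpos : 0 < b := by positivity
      have hb1 : ε / 2 ≤ b := by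
        have : (0 : ℝ) ≤ n := Nat.cast_nonneg n
        nlinarith
      have hb' : ((n + 1 : ℕ) + 1 : ℝ) * (ε / 2) = b + ε / 2 := by push_cast; rw [hb]; ring
      rw [hb']
      have hm1 : b - ε / 4 ∈ Ioo (-b) b := by constructor <;> linarith
      -- Restarting a quarter of ε before the end, with existence time ε, reaches beyond b + ε/2 and
      -- leaves an overlap for the gluing. The left end is treated in the same way.
      obtain ⟨yr, hyr0, hyr⟩ := hex (y (b - ε / 4)) (hy _ hm1).mem (b - ε / 4)
      obtain ⟨y', hy', he1, -⟩ := H.exists_glue (a₂ := b - ε / 4 - ε / 4) (b₂ := b + ε / 2)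
        (c := b - ε / 4) hy
        (fun r hr => hyr r (by constructor <;> [have := hr.1; have := hr.2] <;> linarith))
        (by constructor <;> linarith) (by linarith) (by linarith) hyr0.symm
      have hm2 : -b + ε / 4 ∈ Ioo (-b) (b + ε / 2) := by constructor <;> linarith
      obtain ⟨yl, hyl0, hyl⟩ := hex (y' (-b + ε / 4)) (hy' _ hm2).mem (-b + ε / 4)
      obtain ⟨y'', hy'', -, he2⟩ := H.exists_glue (a₁ := -(b + ε / 2)) (b₁ := -b + ε / 4 + ε / 4)
        (c := -b + ε / 4) (fun r hr =>
          hyl r (by constructor <;> [have := hr.1; have := hr.2] <;> linarith)) hy'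
        (by constructor <;> linarith) (by linarith) (by linarith) hyl0
      refine ⟨y'', ?_, hy''⟩
      rw [he2 (by constructor <;> linarith), he1 (by constructor <;> linarith), hy0]
  choose Y hY0 hY using step
  have hmono : ∀ n m : ℕ, ∀ r ∈ Ioo (-((n + 1) * (ε / 2))) ((n + 1) * (ε / 2)),
      r ∈ Ioo (-((m + 1) * (ε / 2))) ((m + 1) * (ε / 2)) → Y n r = Y m r := by
    have hle : ∀ n m : ℕ, n ≤ m → EqOn (Y n) (Y m) (Ioo (-((n + 1) * (ε / 2))) ((n + 1) * (ε / 2))) := by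
      intro n m hnm
      have hle : ((n : ℝ) + 1) * (ε / 2) ≤ (m + 1) * (ε / 2) := by gcongr
      refine H.eqOn_of_eq isOpen_Ioo isPreconnected_Ioo (hY n)
        (fun r hr => hY m r ⟨by have := hr.1; linarith, hr.2.trans_le hle⟩) (s := 0) ?_
        (by rw [hY0, hY0])
      have : 0 < ((n : ℝ) + 1) * (ε / 2) := by positivity
      constructor <;> linarith
    intro n m r hn hm
    rcases le_total n m with hnm | hnm
    · exact hle n m hnm hn
    · exact (hle m n hnm hm).symm
  have hlarge : ∀ r : ℝ, ∃ n : ℕ, r ∈ Ioo (-((n + 1) * (ε / 2))) ((n + 1) * (ε / 2)) := by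
    intro r
    obtain ⟨n, hn⟩ := exists_nat_gt (|r| / (ε / 2))
    rw [div_lt_iff₀ (by positivity)] at hn
    refine ⟨n, abs_lt.1 (hn.trans ?_)⟩
    gcongr
    linarith
  choose N hN using hlarge
  refine ⟨fun r => Y (N r) r, isMorseLine_iff.2 fun s => ?_, hY0 _⟩
  refine (hY (N s) s (hN s)).congr ?_
  filter_upwards [Ioo_mem_nhds (hN s).1 (hN s).2] with r hr
  exact hmono _ _ r (hN r) hr

end IsCompactGradient

end Flow

/-! ### Grönwall's inequality, bounds on the speed, and short-time stability. -/

section Estimates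

variable [FiniteDimensional ℝ E] [IsManifold 𝓘(ℝ, E) ∞ M]

/-- Grönwall's inequality for two integral curves, forward and backward in time. -/
theorem dist_le_of_integralCurves {F : Type*} [NormedAddCommGroup F] [NormedSpace ℝ F]
    {V : F → F} {T : Set F} {K : NNReal} (hl : LipschitzOnWith K V T) {u v : ℝ → F} {s₀ δ : ℝ}
    (hu : ∀ s ∈ Icc (s₀ - δ) (s₀ + δ), HasDerivAt u (V (u s)) s ∧ u s ∈ T)
    (hv : ∀ s ∈ Icc (s₀ - δ) (s₀ + δ), HasDerivAt v (V (v s)) s ∧ v s ∈ T) {s : ℝ}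
    (hs : s ∈ Icc (s₀ - δ) (s₀ + δ)) :
    dist (u s) (v s) ≤ dist (u s₀) (v s₀) * Real.exp (K * δ) := by
  have aux : ∀ (W : F → F) (u v : ℝ → F), LipschitzOnWith K W T →
      (∀ s ∈ Icc 0 δ, HasDerivAt u (W (u s)) s ∧ u s ∈ T) →
      (∀ s ∈ Icc 0 δ, HasDerivAt v (W (v s)) s ∧ v s ∈ T) → ∀ s ∈ Icc 0 δ,
      dist (u s) (v s) ≤ dist (u 0) (v 0) * Real.exp (K * δ) := by
    intro W u v hW hu hv s hs
    have h1 := dist_le_of_trajectories_ODE_of_mem (v := fun _ => W) (s := fun _ => T)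
      (fun _ _ => hW) (HasDerivAt.continuousOn fun s hs => (hu s hs).1)
      (fun s hs => (hu s (Ico_subset_Icc_self hs)).1.hasDerivWithinAt)
      (fun s hs => (hu s (Ico_subset_Icc_self hs)).2)
      (HasDerivAt.continuousOn fun s hs => (hv s hs).1)
      (fun s hs => (hv s (Ico_subset_Icc_self hs)).1.hasDerivWithinAt)
      (fun s hs => (hv s (Ico_subset_Icc_self hs)).2) le_rfl s hs
    refine h1.trans ?_
    have := hs.2
    gcongr
    linarith
  rcases le_total s₀ s with h | h
  · have h1 := aux V (fun r => u (s₀ + r)) (fun r => v (s₀ + r)) hl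
      (fun r hr => by
        have := hu (s₀ + r) ⟨by linarith [hr.1, hr.2], by linarith [hr.2]⟩
        exact ⟨HasDerivAt.comp_const_add s₀ r this.1, this.2⟩)
      (fun r hr => by
        have := hv (s₀ + r) ⟨by linarith [hr.1, hr.2], by linarith [hr.2]⟩
        exact ⟨HasDerivAt.comp_const_add s₀ r this.1, this.2⟩)
      (s - s₀) ⟨by linarith, by linarith [hs.2]⟩
    simpa using h1
  -- Backward in time: reversed curves solve the equation of −V, which has the same Lipschitz
  -- constant.
  · have hneg : LipschitzOnWith K (fun x => -V x) T := by
      intro x hx y hy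
      simpa using hl hx hy
    have h1 := aux (fun x => -V x) (fun r => u (s₀ - r)) (fun r => v (s₀ - r)) hneg
      (fun r hr => by
        have := hu (s₀ - r) ⟨by linarith [hr.1, hr.2], by linarith [hr.1, hr.2]⟩
        exact ⟨HasDerivAt.comp_const_sub s₀ r this.1, this.2⟩)
      (fun r hr => by
        have := hv (s₀ - r) ⟨by linarith [hr.1, hr.2], by linarith [hr.1, hr.2]⟩
        exact ⟨HasDerivAt.comp_const_sub s₀ r this.1, this.2⟩)
      (s₀ - s) ⟨by linarith, by linarith [hs.1]⟩
    simpa using h1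

variable {S : Set M} {g₀ : MetricOn E S} {h : M → ℝ}

open SliceChart

/-- At z the constant is the minimum of the quadratic form on the unit sphere. Half of it survives
nearby by continuity of the Gram form in operator norm. -/
theorem SliceChart.exists_gram_coercive {x : M} {σ : SliceChart (E := E) S x} {z : σ.Coord}
    (hz : z ∈ σ.dom) :
    ∃ c > (0 : ℝ), ∀ᶠ z' in 𝓝 z, ∀ a, c * ‖a‖ ^ 2 ≤ σ.gram g₀ z' a a := by
  have hmin : ∃ c > (0 : ℝ), ∀ a : σ.Coord, c * ‖a‖ ^ 2 ≤ σ.gram g₀ z a a := by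
    by_cases hne : (Metric.sphere (0 : σ.Coord) 1).Nonempty
    · obtain ⟨a₀, ha₀, hmin⟩ := (isCompact_sphere (0 : σ.Coord) 1).exists_isMinOn hne
        (f := fun a => σ.gram g₀ z a a) (by fun_prop)
      have ha₀' : a₀ ≠ 0 := by
        rintro rfl
        simp at ha₀
      refine ⟨σ.gram g₀ z a₀ a₀, gram_pos hz ha₀', fun a => ?_⟩
      by_cases ha : a = 0
      · simp [ha]
      have hn : ‖a‖ ≠ 0 := norm_ne_zero_iff.2 ha
      have h1 : ‖a‖⁻¹ • a ∈ Metric.sphere (0 : σ.Coord) 1 := by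
        simp [norm_smul, hn]
      have h2 : σ.gram g₀ z a₀ a₀ ≤ σ.gram g₀ z (‖a‖⁻¹ • a) (‖a‖⁻¹ • a) := hmin h1
      simp only [map_smul, smul_apply, smul_eq_mul] at h2
      have h3 : σ.gram g₀ z a₀ a₀ ≤ ‖a‖⁻¹ * (‖a‖⁻¹ * σ.gram g₀ z a a) := h2
      calc σ.gram g₀ z a₀ a₀ * ‖a‖ ^ 2
          ≤ ‖a‖⁻¹ * (‖a‖⁻¹ * σ.gram g₀ z a a) * ‖a‖ ^ 2 := by gcongr
        _ = σ.gram g₀ z a a := by field_simp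
    -- The slice is a point: without unit vectors, every vector is zero.
    · refine ⟨1, one_pos, fun a => ?_⟩
      have ha : a = 0 := by
        by_contra ha
        exact hne ⟨‖a‖⁻¹ • a, by simp [norm_smul, norm_ne_zero_iff.2 ha]⟩
      simp [ha]
  obtain ⟨c, hc, hcm⟩ := hmin
  refine ⟨c / 2, half_pos hc, ?_⟩
  have hcont := (contDiffOn_gram (g₀ := g₀)
    |>.contDiffAt (σ.isOpen_dom.mem_nhds hz)).continuousAt
  filter_upwards [Metric.continuousAt_iff'.1 hcont (c / 2) (half_pos hc)] with z' hz' a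
  rw [dist_eq_norm] at hz'
  have h1 : ‖(σ.gram g₀ z' - σ.gram g₀ z) a a‖ ≤ c / 2 * ‖a‖ ^ 2 := by
    refine (ContinuousLinearMap.le_opNorm₂ _ _ _).trans ?_
    rw [mul_assoc, ← sq]
    gcongr
  have h2 := neg_le_of_abs_le (by simpa [Real.norm_eq_abs] using h1)
  have h3 := hcm a
  linarith

namespace MorseAt

/-- The energy identity: the defining equation of the gradient is evaluated on the gradient itself.
-/
theorem deriv_comp_le_zero (hh : SmoothOn E S h) {x : M} (σ : SliceChart (E := E) S x) {y : ℝ → M}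
    {s : ℝ} (H : MorseAt g₀ h y s) (hs : y s ∈ σ.chart.source) :
    HasDerivAt (fun r => h (y r)) (-(σ.gram g₀ (σ.coords (y s)) (σ.field g₀ h (σ.coords (y s)))
      (σ.field g₀ h (σ.coords (y s))))) s := by
  have h1 := hasDerivAt_comp hh hh H hs
  have h2 := congrArg (fun L : σ.Coord →L[ℝ] ℝ => L (σ.field g₀ h (σ.coords (y s))))
    (gram_field (g₀ := g₀) (h := h) (coords_mem_dom H.mem hs))
  have h3 : σ.gram g₀ (σ.coords (y s)) (σ.field g₀ h (σ.coords (y s)))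
      (σ.field g₀ h (σ.coords (y s))) =
      -(fderiv ℝ (h ∘ σ.loc) (σ.coords (y s)) (σ.field g₀ h (σ.coords (y s)))) := h2
  rw [h3, neg_neg]
  exact h1

end MorseAt

namespace IsCompactGradient

theorem hasDerivAt_comp (H : IsCompactGradient g₀ h) {φ : M → ℝ} (hφ : SmoothOn E S φ) {y : ℝ → M}
    {s : ℝ} (hy : MorseAt g₀ h y s) :
    HasDerivAt (fun r => φ (y r)) (deriv (fun r => φ (y r)) s) s := by
  obtain ⟨σ⟩ := H.submanifold _ hy.mem
  exact (MorseAt.hasDerivAt_comp hφ H.smooth hy σ.mem_source).differentiableAt.hasDerivAt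

theorem deriv_nonpos (H : IsCompactGradient g₀ h) {y : ℝ → M} {s : ℝ} (hy : MorseAt g₀ h y s) :
    deriv (fun r => h (y r)) s ≤ 0 := by
  obtain ⟨σ⟩ := H.submanifold _ hy.mem
  rw [(MorseAt.deriv_comp_le_zero H.smooth σ hy σ.mem_source).deriv, neg_nonpos]
  by_cases h0 : σ.field g₀ h (σ.coords (y s)) = 0
  · simp [h0]
  · exact (gram_pos (coords_mem_dom hy.mem σ.mem_source) h0).le

/-- The speed of flow lines, as seen by a smooth function, is bounded. -/
theorem exists_deriv_bound (H : IsCompactGradient g₀ h) {φ : M → ℝ} (hφ : SmoothOn E S φ) :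
    ∃ C, ∀ q ∈ S, ∀ (y : ℝ → M) (s : ℝ), MorseAt g₀ h y s → y s = q →
      |deriv (fun r => φ (y r)) s| ≤ C := by
  refine H.compact.exists_uniform_bound
    (P := fun q C => ∀ (y : ℝ → M) (s : ℝ), MorseAt g₀ h y s → y s = q →
      |deriv (fun r => φ (y r)) s| ≤ C) (fun q C C' hle hC y s hy hs => (hC y s hy hs).trans hle) ?_
  intro p hp
  obtain ⟨σ⟩ := H.submanifold p hp
  set B : M → ℝ := fun q => fderiv ℝ (φ ∘ σ.loc) (σ.coords q) (σ.field g₀ h (σ.coords q)) with hB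
  have hBc : ContinuousAt B p := by
    have hz : σ.coords p ∈ σ.dom := coords_mem_dom hp σ.mem_source
    have hn := σ.isOpen_dom.mem_nhds hz
    have h1 : ContinuousAt (fun z => fderiv ℝ (φ ∘ σ.loc) z (σ.field g₀ h z)) (σ.coords p) :=
      (((contDiffOn_comp_loc hφ).contDiffAt hn).fderiv_right (m := ∞) (by simp)).continuousAt.clm_apply
        ((contDiffOn_field H.smooth).contDiffAt hn).continuousAt
    exact ContinuousAt.comp (g := fun z => fderiv ℝ (φ ∘ σ.loc) z (σ.field g₀ h z)) h1
      (continuousAt_coords σ.mem_source)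
  refine ⟨|B p| + 1, ?_⟩
  filter_upwards [hBc.abs.eventually_lt_const (lt_add_one _),
    σ.chart.open_source.mem_nhds σ.mem_source] with q h1 h2 hqS y s hy hs
  subst hs
  rw [(MorseAt.hasDerivAt_comp hφ H.smooth hy h2).deriv]
  exact h1.le

/-- The speed of flow lines, as seen by a smooth function, is controlled by the decay of `h`. -/
theorem exists_deriv_sq_bound (H : IsCompactGradient g₀ h) {φ : M → ℝ} (hφ : SmoothOn E S φ) :
    ∃ C, ∀ q ∈ S, ∀ (y : ℝ → M) (s : ℝ), MorseAt g₀ h y s → y s = q →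
      (deriv (fun r => φ (y r)) s) ^ 2 ≤ C * -(deriv (fun r => h (y r)) s) := by
  refine H.compact.exists_uniform_bound
    (P := fun q C => ∀ (y : ℝ → M) (s : ℝ), MorseAt g₀ h y s → y s = q →
      (deriv (fun r => φ (y r)) s) ^ 2 ≤ C * -(deriv (fun r => h (y r)) s))
      (fun q C C' hle hC y s hy hs => (hC y s hy hs).trans ?_) ?_
  · have := H.deriv_nonpos hy
    gcongr
    linarith
  intro p hp
  obtain ⟨σ⟩ := H.submanifold p hp
  have hz : σ.coords p ∈ σ.dom := coords_mem_dom hp σ.mem_source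
  have hn := σ.isOpen_dom.mem_nhds hz
  have hcd := continuousAt_coords (σ := σ) σ.mem_source
  have hD : ContinuousAt (fun q => ‖fderiv ℝ (φ ∘ σ.loc) (σ.coords q)‖) p :=
    (ContinuousAt.comp (g := fderiv ℝ (φ ∘ σ.loc))
      (((contDiffOn_comp_loc hφ).contDiffAt hn).fderiv_right (m := ∞) (by simp)).continuousAt hcd).norm
  obtain ⟨c, hc, hev⟩ := exists_gram_coercive (g₀ := g₀) hz
  set D := ‖fderiv ℝ (φ ∘ σ.loc) (σ.coords p)‖ + 1 with hDdef
  -- D bounds the differential of φ and c is the coercivity constant of the metric: (dφ V)² ≤ D²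
  -- ‖V‖² ≤ (D²/c) g(V, V), and g(V, V) is the rate of decay of h.
  refine ⟨D ^ 2 / c, ?_⟩
  filter_upwards [hD.eventually_lt_const (lt_add_one _), hcd.eventually hev,
    σ.chart.open_source.mem_nhds σ.mem_source] with q h1 h2 h3 hqS y s hy hs
  subst hs
  rw [(MorseAt.hasDerivAt_comp hφ H.smooth hy h3).deriv,
    (MorseAt.deriv_comp_le_zero H.smooth σ hy h3).deriv, neg_neg]
  set V := σ.field g₀ h (σ.coords (y s))
  have h4 : |fderiv ℝ (φ ∘ σ.loc) (σ.coords (y s)) V| ≤ D * ‖V‖ := by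
    rw [← Real.norm_eq_abs]
    exact (ContinuousLinearMap.le_opNorm _ _).trans
      (mul_le_mul_of_nonneg_right h1.le (norm_nonneg _))
  rw [← sq_abs]
  calc |fderiv ℝ (φ ∘ σ.loc) (σ.coords (y s)) V| ^ 2 ≤ (D * ‖V‖) ^ 2 := by gcongr
    _ = D ^ 2 / c * (c * ‖V‖ ^ 2) := by field_simp
    _ ≤ _ := by gcongr; exact h2 V

variable [CompactSpace M] [T2Space M]

/-- Flow lines do not leave a neighborhood of a point of `S` in a short time. -/
theorem exists_trap (H : IsCompactGradient g₀ h) {p : M} {U : Set M} (hU : U ∈ 𝓝 p) :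
    ∃ δ > (0 : ℝ), ∀ᶠ q in 𝓝 p, ∀ (y : ℝ → M) (s₀ s : ℝ), IsMorseLine g₀ h y → y s₀ = q →
      |s - s₀| ≤ δ → y s ∈ U := by
  -- A bump function, 1 at p and 0 outside the interior of U. It exceeds 1/2 near p and changes by
  -- at most 1/4 during the time δ, so it cannot reach 0.
  obtain ⟨φ, hφ0, hφ1, -⟩ := exists_contMDiffMap_zero_one_of_isClosed (n := ⊤) 𝓘(ℝ, E)
    (s := (interior U)ᶜ) (t := {p}) isOpen_interior.isClosed_compl isClosed_singleton
    (disjoint_singleton_right.2 (by simpa using mem_interior_iff_mem_nhds.2 hU))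
  have hφs : SmoothOn E S φ := smoothOn_of_contMDiff φ.contMDiff S
  obtain ⟨C, hC⟩ := H.exists_deriv_bound hφs
  have hC1 : 0 < max C 1 := lt_max_of_lt_right one_pos
  refine ⟨1 / (4 * max C 1), by positivity, ?_⟩
  have hp1 : φ p = 1 := hφ1 (mem_singleton p)
  have hev : ∀ᶠ q in 𝓝 p, 1 / 2 < φ q :=
    (φ.contMDiff.continuous.tendsto p).eventually_const_lt (by rw [hp1]; norm_num)
  filter_upwards [hev] with q hq y s₀ s hy hs0 hs
  have h1 := Convex.norm_image_sub_le_of_norm_deriv_le (f := fun r => φ (y r)) (C := max C 1)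
    (fun r _ => (H.hasDerivAt_comp hφs (hy.morseAt r)).differentiableAt)
    (fun r _ => (hC (y r) (hy.2.1 r) y r (hy.morseAt r) rfl).trans (le_max_left _ _))
    convex_univ (mem_univ s₀) (mem_univ s)
  have h2 : max C 1 * ‖s - s₀‖ ≤ 1 / 4 := by
    calc max C 1 * ‖s - s₀‖ ≤ max C 1 * (1 / (4 * max C 1)) := by
          gcongr; exact hs
      _ = 1 / 4 := by field_simp
  have h3 := neg_le_of_abs_le ((h1.trans h2 : |φ (y s) - φ (y s₀)| ≤ 1 / 4))
  rw [hs0] at h3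
  by_contra hys
  have h4 : φ (y s) = 0 := hφ0 fun hi => hys (interior_subset hi)
  linarith

/-- Flow lines that are close to each other at one time stay close for a short time. -/
theorem exists_stability (H : IsCompactGradient g₀ h) {p : M} (σ : SliceChart (E := E) S p) :
    ∃ δ > (0 : ℝ), ∃ C : ℝ, ∃ W ∈ 𝓝 p, ∀ q ∈ W, ∀ q' ∈ W, ∀ (y y' : ℝ → M) (s₀ s : ℝ),
      IsMorseLine g₀ h y → IsMorseLine g₀ h y' → y s₀ = q → y' s₀ = q' → |s - s₀| ≤ δ →
      y s ∈ σ.chart.source ∧ y' s ∈ σ.chart.source ∧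
      dist (σ.coords (y s)) (σ.coords (y' s)) ≤ C * dist (σ.coords q) (σ.coords q') := by
  have hcd : ContDiffAt ℝ 1 (σ.field g₀ h) (σ.coords p) :=
    ((contDiffOn_field (g₀ := g₀) H.smooth).contDiffAt (σ.isOpen_dom.mem_nhds
      (coords_mem_dom σ.base_mem σ.mem_source))).of_le (by exact_mod_cast le_top)
  obtain ⟨K, T, hT, hl⟩ := hcd.exists_lipschitzOnWith
  have hU : σ.chart.source ∩ σ.coords ⁻¹' T ∈ 𝓝 p :=
    inter_mem (σ.chart.open_source.mem_nhds σ.mem_source)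
      ((continuousAt_coords σ.mem_source).preimage_mem_nhds hT)
  obtain ⟨δ, hδ, hev⟩ := H.exists_trap hU
  refine ⟨δ, hδ, Real.exp (K * δ), _, hev, fun q hq q' hq' y y' s₀ s hy hy' hys hys' hs => ?_⟩
  refine ⟨(hq y s₀ s hy hys hs).1, (hq' y' s₀ s hy' hys' hs).1, ?_⟩
  have habs : ∀ r ∈ Icc (s₀ - δ) (s₀ + δ), |r - s₀| ≤ δ := fun r hr =>
    abs_le.2 ⟨by linarith [hr.1], by linarith [hr.2]⟩
  have h1 := dist_le_of_integralCurves hl (u := fun r => σ.coords (y r))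
    (v := fun r => σ.coords (y' r)) (s₀ := s₀) (δ := δ)
    (fun r hr => ⟨(hy.morseAt r).hasDerivAt H.smooth (hq y s₀ r hy hys (habs r hr)).1,
      (hq y s₀ r hy hys (habs r hr)).2⟩)
    (fun r hr => ⟨(hy'.morseAt r).hasDerivAt H.smooth (hq' y' s₀ r hy' hys' (habs r hr)).1,
      (hq' y' s₀ r hy' hys' (habs r hr)).2⟩)
    (s := s) ⟨by linarith [(abs_le.1 hs).1], by linarith [(abs_le.1 hs).2]⟩
  rw [mul_comm]
  simpa [hys, hys'] using h1

end IsCompactGradient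

end Estimates

/-! ### Continuous dependence on initial values, and convergence in C^∞_loc. -/

section JointContinuity

variable [FiniteDimensional ℝ E] [IsManifold 𝓘(ℝ, E) ∞ M]
variable {S : Set M} {g₀ : MetricOn E S} {h : M → ℝ}

open SliceChart

theorem SliceChart.tendsto_of_coords {x : M} (σ : SliceChart (E := E) S x) {ι : Type*} {l : Filter ι}
    {a : ι → M} {b : M} (hb : b ∈ S) (hbs : b ∈ σ.chart.source)
    (ha : ∀ᶠ i in l, a i ∈ S ∧ a i ∈ σ.chart.source)
    (hab : Tendsto (fun i => σ.coords (a i)) l (𝓝 (σ.coords b))) : Tendsto a l (𝓝 b) := by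
  have h1 : Tendsto (fun i => σ.loc (σ.coords (a i))) l (𝓝 (σ.loc (σ.coords b))) :=
    (continuousAt_loc (coords_mem_dom hb hbs)).tendsto.comp hab
  rw [loc_coords hb hbs] at h1
  refine h1.congr' ?_
  filter_upwards [ha] with i hi
  exact loc_coords hi.1 hi.2

namespace IsCompactGradient

section

variable [CompactSpace M] [T2Space M]

/-- Convergence at the time s₀ spreads to all times at distance less than δ, by `exists_stability`.
What matters is that δ and W depend only on p and not on the lines. -/
theorem exists_step (H : IsCompactGradient g₀ h) {p : M} (hp : p ∈ S) :
    ∃ δ > (0 : ℝ), ∃ W ∈ 𝓝 p, ∀ {ι : Type} {l : Filter ι} {y : ι → ℝ → M} {z : ℝ → M},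
      (∀ i, IsMorseLine g₀ h (y i)) → IsMorseLine g₀ h z → ∀ s₀ s : ℝ, z s₀ ∈ W →
      Tendsto (fun i => y i s₀) l (𝓝 (z s₀)) → |s - s₀| < δ →
      Tendsto (fun q : ι × ℝ => y q.1 q.2) (l ×ˢ 𝓝 s) (𝓝 (z s)) := by
  obtain ⟨σ⟩ := H.submanifold p hp
  obtain ⟨δ, hδ, C, W, hW, hst⟩ := H.exists_stability σ
  have hcd : ∀ᶠ q in 𝓝 p, q ∈ σ.chart.source := σ.chart.open_source.mem_nhds σ.mem_source
  refine ⟨δ, hδ, interior W ∩ σ.chart.source, inter_mem (interior_mem_nhds.2 hW) hcd, ?_⟩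
  intro ι l y z hy hz s₀ s hzW hyz hs
  have h1 : ∀ᶠ i in l, y i s₀ ∈ W :=
    (hyz.eventually (isOpen_interior.mem_nhds hzW.1)).mono fun _ h => interior_subset h
  have h2 : ∀ᶠ s' in 𝓝 s, |s' - s₀| < δ :=
    (continuous_abs.comp (continuous_id.sub continuous_const)).continuousAt.eventually_lt_const hs
  have hzs := hst _ (interior_subset hzW.1) _ (interior_subset hzW.1) z z s₀ s hz hz rfl rfl hs.le
  have h3 : ∀ᶠ q : ι × ℝ in l ×ˢ 𝓝 s, y q.1 s₀ ∈ W ∧ |q.2 - s₀| < δ := h1.prod_mk h2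
  have h4 : ∀ᶠ q : ι × ℝ in l ×ˢ 𝓝 s, y q.1 q.2 ∈ σ.chart.source ∧ 
      dist (σ.coords (z q.2)) (σ.coords (y q.1 q.2)) ≤
        C * dist (σ.coords (z s₀)) (σ.coords (y q.1 s₀)) := by
    filter_upwards [h3] with q hq
    exact (hst _ (interior_subset hzW.1) _ hq.1 z (y q.1) s₀ q.2 hz (hy _) rfl rfl hq.2.le).2
  refine σ.tendsto_of_coords (hz.2.1 s) hzs.1 (h4.mono fun q hq => ⟨(hy _).2.1 _, hq.1⟩) ?_
  have h5 : Tendsto (fun q : ι × ℝ => σ.coords (z q.2)) (l ×ˢ 𝓝 s) (𝓝 (σ.coords (z s))) :=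
    ((continuousAt_coords hzs.1).tendsto.comp (hz.1.continuous.tendsto s)).comp tendsto_snd
  have h6 : Tendsto (fun q : ι × ℝ => C * dist (σ.coords (z s₀)) (σ.coords (y q.1 s₀)))
      (l ×ˢ 𝓝 s) (𝓝 0) := by
    have h7 : Tendsto (fun i => σ.coords (y i s₀)) l (𝓝 (σ.coords (z s₀))) :=
      (continuousAt_coords hzW.2).tendsto.comp hyz
    have h8 := ((tendsto_const_nhds (x := σ.coords (z s₀))).dist h7).const_mul C
    rw [dist_self, mul_zero] at h8
    exact h8.comp tendsto_fst
  have h9 : Tendsto (fun q : ι × ℝ => dist (σ.coords (z q.2)) (σ.coords (y q.1 q.2)))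
      (l ×ˢ 𝓝 s) (𝓝 0) :=
    squeeze_zero' (Eventually.of_forall fun _ => dist_nonneg) (h4.mono fun _ h => h.2) h6
  exact (tendsto_iff_of_dist h9).1 h5

/-- The flow is jointly continuous in the initial value and the time. -/
theorem tendsto_prod (H : IsCompactGradient g₀ h) {ι : Type} {l : Filter ι} {y : ι → ℝ → M}
    {z : ℝ → M} (hy : ∀ i, IsMorseLine g₀ h (y i)) (hz : IsMorseLine g₀ h z) {s₁ : ℝ}
    (hs₁ : Tendsto (fun i => y i s₁) l (𝓝 (z s₁))) (s : ℝ) :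
    Tendsto (fun q : ι × ℝ => y q.1 q.2) (l ×ˢ 𝓝 s) (𝓝 (z s)) := by
  have hslice : ∀ r, Tendsto (fun q : ι × ℝ => y q.1 q.2) (l ×ˢ 𝓝 r) (𝓝 (z r)) →
      Tendsto (fun i => y i r) l (𝓝 (z r)) := fun r hr =>
    hr.comp (tendsto_id.prodMk (tendsto_const_nhds (x := r)))
  set A : Set ℝ := {r | Tendsto (fun i => y i r) l (𝓝 (z r))} with hA
  -- Openness: step away from a time in A. Closedness: near a limit time r there is a time in A at
  -- which z lies in the neighborhood W of z r, and a step from there reaches r because the step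
  -- length is attached to W.
  have hclopen : IsClopen A := by
    constructor
    · rw [← closure_subset_iff_isClosed]
      intro r hr
      obtain ⟨δ, hδ, W, hW, hstep⟩ := H.exists_step (hz.2.1 r)
      have hn : {r' | z r' ∈ W ∧ |r' - r| < δ} ∈ 𝓝 r :=
        inter_mem (hz.1.continuous.continuousAt.preimage_mem_nhds hW) (Metric.ball_mem_nhds r hδ)
      obtain ⟨r', ⟨h1, h2⟩, h3⟩ := mem_closure_iff_nhds.1 hr _ hn
      exact hslice r (hstep hy hz r' r h1 h3 (by rwa [abs_sub_comm]))
    · rw [isOpen_iff_mem_nhds]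
      intro r hr
      obtain ⟨δ, hδ, W, hW, hstep⟩ := H.exists_step (hz.2.1 r)
      filter_upwards [Metric.ball_mem_nhds r hδ] with r' hr'
      exact hslice r' (hstep hy hz r r' (mem_of_mem_nhds hW) hr hr')
  have huniv := hclopen.eq_univ ⟨s₁, hs₁⟩
  have hs : s ∈ A := huniv ▸ mem_univ s
  obtain ⟨δ, hδ, W, hW, hstep⟩ := H.exists_step (hz.2.1 s)
  exact hstep hy hz s s (mem_of_mem_nhds hW) hs (by simpa using hδ)

theorem tendsto_apply (H : IsCompactGradient g₀ h) {ι : Type} {l : Filter ι} {y : ι → ℝ → M}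
    {z : ℝ → M} (hy : ∀ i, IsMorseLine g₀ h (y i)) (hz : IsMorseLine g₀ h z) {s₁ : ℝ}
    (hs₁ : Tendsto (fun i => y i s₁) l (𝓝 (z s₁))) {t : ι → ℝ} {s : ℝ} (ht : Tendsto t l (𝓝 s)) :
    Tendsto (fun i => y i (t i)) l (𝓝 (z s)) :=
  (H.tendsto_prod hy hz hs₁ s).comp (tendsto_id.prodMk ht)

end

theorem eq_of_eq [T2Space M] (H : IsCompactGradient g₀ h) {y y' : ℝ → M}
    (hy : IsMorseLine g₀ h y) (hy' : IsMorseLine g₀ h y') {s : ℝ} (hs : y s = y' s) : y = y' :=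
  funext fun r => H.eqOn_of_eq (I := univ) isOpen_univ isPreconnected_univ
    (fun r _ => hy.morseAt r) (fun r _ => hy'.morseAt r) (mem_univ s) hs (mem_univ r)

/-- The iterated derivatives of a function along a flow line, as functions of the coordinates. -/
def _root_.MorseBott.SliceChart.lieDeriv {x : M} (σ : SliceChart (E := E) S x) (g₀ : MetricOn E S)
    (h : M → ℝ) {F : Type*} [NormedAddCommGroup F] [NormedSpace ℝ F] (T : σ.Coord → F) :
    ℕ → σ.Coord → F
  | 0 => T
  | k + 1 => fun z => fderiv ℝ (lieDeriv σ g₀ h T k) z (σ.field g₀ h z)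

theorem contDiffOn_lieDeriv (H : IsCompactGradient g₀ h) {x : M} {σ : SliceChart (E := E) S x}
    {F : Type*} [NormedAddCommGroup F] [NormedSpace ℝ F] {T : σ.Coord → F} {D : Set σ.Coord}
    (hD : IsOpen D) (hDd : D ⊆ σ.dom) (hT : ContDiffOn ℝ ∞ T D) (k : ℕ) :
    ContDiffOn ℝ ∞ (σ.lieDeriv g₀ h T k) D := by
  induction k with
  | zero => exact hT
  | succ k ih =>
    exact (ih.fderiv_of_isOpen hD (by simp)).clm_apply ((contDiffOn_field H.smooth).mono hDd)

/-- Differentiating in time along a flow line is differentiating along the field. All time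
derivatives are thus fixed functions of the position, and convergence of positions controls them. -/
theorem iteratedDeriv_comp (H : IsCompactGradient g₀ h) {x : M} {σ : SliceChart (E := E) S x}
    {F : Type*} [NormedAddCommGroup F] [NormedSpace ℝ F] {T : σ.Coord → F} {D : Set σ.Coord}
    (hD : IsOpen D) (hDd : D ⊆ σ.dom) (hT : ContDiffOn ℝ ∞ T D) {y : ℝ → M}
    (hy : IsMorseLine g₀ h y) {I : Set ℝ} (hI : IsOpen I)
    (hyI : ∀ s ∈ I, y s ∈ σ.chart.source ∧ σ.coords (y s) ∈ D) (k : ℕ) :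
    ∀ s ∈ I, iteratedDeriv k (fun r => T (σ.coords (y r))) s =
      σ.lieDeriv g₀ h T k (σ.coords (y s)) := by
  induction k with
  | zero => intro s _; simp [lieDeriv]
  | succ k ih =>
    intro s hs
    rw [iteratedDeriv_succ]
    have h1 : iteratedDeriv k (fun r => T (σ.coords (y r))) =ᶠ[𝓝 s]
        fun r => σ.lieDeriv g₀ h T k (σ.coords (y r)) := by
      filter_upwards [hI.mem_nhds hs] with r hr using ih r hr
    rw [h1.deriv_eq]
    have h2 : HasFDerivAt (σ.lieDeriv g₀ h T k) _ (σ.coords (y s)) :=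
      (((H.contDiffOn_lieDeriv hD hDd hT k).contDiffAt (hD.mem_nhds (hyI s hs).2)).differentiableAt
        (by simp)).hasFDerivAt
    exact (h2.comp_hasDerivAt s ((hy.morseAt s).hasDerivAt H.smooth (hyI s hs).1)).deriv

/-- Pointwise convergence of flow lines at one time is convergence in `C^∞_loc`. -/
theorem tendstoCInftyLoc [CompactSpace M] [T2Space M] (H : IsCompactGradient g₀ h)
    {y : ℕ → ℝ → M} {z : ℝ → M} (hy : ∀ i, IsMorseLine g₀ h (y i)) (hz : IsMorseLine g₀ h z)
    {s₁ : ℝ} (hs₁ : Tendsto (fun i => y i s₁) atTop (𝓝 (z s₁))) : TendstoCInftyLoc E y z := by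
  intro s₀
  obtain ⟨σ⟩ := H.submanifold _ (hz.2.1 s₀)
  set U := (chartAt E (z s₀)).source ∩ σ.chart.source with hU
  have hUo : IsOpen U := (chartAt E (z s₀)).open_source.inter σ.chart.open_source
  have hU0 : z s₀ ∈ U := ⟨mem_chart_source E (z s₀), σ.mem_source⟩
  have hjoint := H.tendsto_prod hy hz hs₁
  obtain ⟨A, hA, B, hB, hAB⟩ := eventually_prod_iff.1 ((hjoint s₀).eventually (hUo.mem_nhds hU0))
  have hzU : ∀ᶠ s in 𝓝 s₀, z s ∈ U :=
    hz.1.continuous.continuousAt.preimage_mem_nhds (hUo.mem_nhds hU0)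
  obtain ⟨δ, hδ, hball⟩ := Metric.eventually_nhds_iff_ball.1 (hB.and hzU)
  have hsub : Icc (s₀ - δ / 2) (s₀ + δ / 2) ⊆ Metric.ball s₀ δ := by
    intro s hs
    rw [Metric.mem_ball, Real.dist_eq, abs_lt]
    constructor <;> linarith [hs.1, hs.2]
  refine ⟨δ / 2, half_pos hδ, fun s hs => (hball s (hsub hs)).2.1,
    hA.mono fun n hn s hs => (hAB hn (hball s (hsub hs)).1).1, fun k => ?_⟩
  set T : σ.Coord → E := fun w => chartAt E (z s₀) (σ.loc w) with hT
  set D : Set σ.Coord := σ.dom ∩ σ.loc ⁻¹' (chartAt E (z s₀)).source with hDdef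
  have hloc : ContinuousOn σ.loc σ.dom := fun w hw => (continuousAt_loc hw).continuousWithinAt
  have hDo : IsOpen D :=
    hloc.isOpen_inter_preimage σ.isOpen_dom (chartAt E (z s₀)).open_source
  have hTs : ContDiffOn ℝ ∞ T D := by
    intro w hw
    have h1 : ContMDiffAt 𝓘(ℝ, E) 𝓘(ℝ, E) ∞ (chartAt E (z s₀)) (σ.loc w) :=
      contMDiffAt_of_mem_maximalAtlas (IsManifold.chart_mem_maximalAtlas (z s₀)) hw.2
    exact (contMDiffAt_iff_contDiffAt.1 (h1.comp w (contMDiffAt_loc hw.1))).contDiffWithinAt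
  have key : ∀ x : ℝ → M, IsMorseLine g₀ h x → (∀ s ∈ Metric.ball s₀ δ, x s ∈ U) →
      ∀ s ∈ Metric.ball s₀ δ, iteratedDeriv k (fun r => chartAt E (z s₀) (x r)) s =
        σ.lieDeriv g₀ h T k (σ.coords (x s)) := by
    intro x hx hxU s hs
    have hmem : ∀ r ∈ Metric.ball s₀ δ, x r ∈ σ.chart.source ∧ σ.coords (x r) ∈ D := fun r hr =>
      ⟨(hxU r hr).2, coords_mem_dom (hx.2.1 r) (hxU r hr).2, by
        rw [mem_preimage, loc_coords (hx.2.1 r) (hxU r hr).2]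
        exact (hxU r hr).1⟩
    rw [← H.iteratedDeriv_comp hDo inter_subset_left hTs hx Metric.isOpen_ball hmem k s hs]
    refine Filter.EventuallyEq.iteratedDeriv_eq k ?_
    filter_upwards [Metric.isOpen_ball.mem_nhds hs] with r hr
    simp only [hT, loc_coords (hx.2.1 r) (hxU r hr).2]
  rw [← tendstoLocallyUniformlyOn_iff_tendstoUniformlyOn_of_compact isCompact_Icc]
  have hlim : ∀ s ∈ Icc (s₀ - δ / 2) (s₀ + δ / 2), ContinuousAt
      (fun p => σ.lieDeriv g₀ h T k (σ.coords p)) (z s) := by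
    intro s hs
    have h1 := (hball s (hsub hs)).2
    have h2 : σ.coords (z s) ∈ D := ⟨coords_mem_dom (hz.2.1 s) h1.2, by
        rw [mem_preimage, loc_coords (hz.2.1 s) h1.2]
        exact h1.1⟩
    exact ContinuousAt.comp (g := σ.lieDeriv g₀ h T k)
      ((H.contDiffOn_lieDeriv hDo inter_subset_left hTs k).contDiffAt
        (hDo.mem_nhds h2)).continuousAt (continuousAt_coords h1.2)
  -- Joint convergence in index and time makes the pair of both curves tend to a point of the
  -- diagonal, which is local uniform convergence.
  have hunif : TendstoLocallyUniformlyOn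
      (fun n s => σ.lieDeriv g₀ h T k (σ.coords (y n s)))
      (fun s => σ.lieDeriv g₀ h T k (σ.coords (z s))) atTop
      (Icc (s₀ - δ / 2) (s₀ + δ / 2)) := by
    refine (tendstoLocallyUniformlyOn_iff_forall_tendsto).2 fun s hs => ?_
    have h1 := (hlim s hs).tendsto.comp (hjoint s)
    have h2 : Tendsto (fun q : ℕ × ℝ => σ.lieDeriv g₀ h T k (σ.coords (z q.2)))
        (atTop ×ˢ 𝓝 s) (𝓝 (σ.lieDeriv g₀ h T k (σ.coords (z s)))) :=
      ((hlim s hs).tendsto.comp (hz.1.continuous.tendsto s)).comp tendsto_snd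
    exact ((h2.prodMk_nhds h1).mono_right (nhds_le_uniformity _)).mono_left
      (prod_mono_right _ nhdsWithin_le_nhds)
  have h1 := (tendstoLocallyUniformlyOn_iff_tendstoUniformlyOn_of_compact isCompact_Icc).1 hunif
  rw [tendstoLocallyUniformlyOn_iff_tendstoUniformlyOn_of_compact isCompact_Icc]
  refine (h1.congr ?_).congr_right ?_
  · filter_upwards [hA] with n hn s hs
    exact (key (y n) (hy n) (fun r hr => hAB hn (hball r hr).1) s (hsub hs)).symm
  · intro s hs
    exact (key z hz (fun r hr => (hball r hr).2) s (hsub hs)).symm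

end IsCompactGradient

end JointContinuity

/-! ### The Łojasiewicz inequality, the length estimate, and convergence of flow lines. -/

section Dynamics

/-- Half of the length estimate: `ψ` moves little while `u` decreases to the level `a`. -/
theorem abs_sub_le_of_above {u ψ u' ψ' : ℝ → ℝ} {a C D s t : ℝ} (hst : s ≤ t)
    (hu : ∀ r ∈ Icc s t, HasDerivAt u (u' r) r) (hψ : ∀ r ∈ Icc s t, HasDerivAt ψ (ψ' r) r)
    (hpos : ∀ r ∈ Ioo s t, a < u r) (hneg : ∀ r ∈ Ioo s t, u' r ≤ 0)
    (hC : ∀ r ∈ Ioo s t, u r - a ≤ C * -u' r) (hD : ∀ r ∈ Ioo s t, ψ' r ^ 2 ≤ D * -u' r) :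
    |ψ t - ψ s| ≤ 2 * √(C * D) * (√(u s - a) - √(u t - a)) := by
  set K := 2 * √(C * D) with hK
  -- The hypotheses multiply to |ψ'| √(u − a) ≤ √(CD) (−u'), which says that e ψ + K √(u − a) is
  -- nonincreasing. The signs e = 1 and e = −1 give the absolute value.
  have main : ∀ e : ℝ, |e| = 1 → e * (ψ t - ψ s) ≤ K * (√(u s - a) - √(u t - a)) := by
    intro e he
    have hcont : ContinuousOn (fun r => e * ψ r + K * √(u r - a)) (Icc s t) := by
      intro r hr
      exact (((hψ r hr).continuousAt.const_mul e).add
        ((((hu r hr).continuousAt.sub continuousAt_const).sqrt).const_mul K)).continuousWithinAt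
    have hder : ∀ r ∈ Ioo s t, HasDerivAt (fun r => e * ψ r + K * √(u r - a))
        (e * ψ' r + K * (u' r / (2 * √(u r - a)))) r := by
      intro r hr
      have hr' := Ioo_subset_Icc_self hr
      exact ((hψ r hr').const_mul e).add
        ((((hu r hr').sub_const a).sqrt (sub_pos.2 (hpos r hr)).ne').const_mul K)
    have hanti : AntitoneOn (fun r => e * ψ r + K * √(u r - a)) (Icc s t) := by
      refine antitoneOn_of_deriv_nonpos (convex_Icc s t) hcont ?_ ?_
      · rw [interior_Icc]
        exact fun r hr => (hder r hr).differentiableAt.differentiableWithinAt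
      · rw [interior_Icc]
        intro r hr
        rw [(hder r hr).deriv]
        have hw : 0 < u r - a := sub_pos.2 (hpos r hr)
        have hm : 0 ≤ -u' r := neg_nonneg.2 (hneg r hr)
        have hsq : 0 < √(u r - a) := Real.sqrt_pos.2 hw
        have hC' : 0 < C := by
          by_contra hC'
          have := hC r hr
          nlinarith
        have h1 : (e * ψ' r) ^ 2 = ψ' r ^ 2 := by
          rw [mul_pow, ← sq_abs e, he]; ring
        have hD' : 0 ≤ D * -u' r := (sq_nonneg _).trans (hD r hr)
        have h2 : e * ψ' r * √(u r - a) ≤ √(C * D) * -u' r := by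
          refine (abs_le_of_sq_le_sq' ?_ ?_).2
          · by_cases hDn : 0 ≤ D
            · rw [mul_pow (e * ψ' r), mul_pow (√(C * D)), h1, Real.sq_sqrt hw.le,
                Real.sq_sqrt (by positivity)]
              calc ψ' r ^ 2 * (u r - a) ≤ (D * -u' r) * (C * -u' r) :=
                    mul_le_mul (hD r hr) (hC r hr) hw.le hD'
                _ = C * D * (-u' r) ^ 2 := by ring
            · have h3 : -u' r = 0 := by nlinarith
              have h4 := hC r hr
              rw [h3] at h4
              linarith
          · positivity
        have h3 : e * ψ' r + K * (u' r / (2 * √(u r - a))) =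
            (e * ψ' r * √(u r - a) - √(C * D) * -u' r) / √(u r - a) := by
          rw [hK]
          field_simp
          ring
        rw [h3]
        exact div_nonpos_of_nonpos_of_nonneg (by linarith) hsq.le
    have := hanti (left_mem_Icc.2 hst) (right_mem_Icc.2 hst) hst
    simp only at this
    linarith
  refine abs_le'.2 ⟨?_, ?_⟩
  · simpa using main 1 (by simp)
  · simpa using main (-1) (by simp)

/-- The length estimate of Łojasiewicz for functions of one variable. -/
theorem abs_sub_le_of_lojasiewicz {u ψ u' ψ' : ℝ → ℝ} {a C D s t : ℝ} (hst : s ≤ t)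
    (hu : ∀ r, HasDerivAt u (u' r) r) (hψ : ∀ r, HasDerivAt ψ (ψ' r) r)
    (hneg : ∀ r, u' r < 0)
    (hC : ∀ r ∈ Icc s t, |u r - a| ≤ C * -u' r) (hD : ∀ r, ψ' r ^ 2 ≤ D * -u' r) :
    |ψ t - ψ s| ≤ 2 * √(C * D) * (√|u s - a| + √|u t - a|) := by
  have hanti : StrictAnti u := strictAnti_of_deriv_neg fun r => by
    rw [(hu r).deriv]; exact hneg r
  have hK : 0 ≤ 2 * √(C * D) := by positivity
  have above : ∀ s' t', s ≤ s' → s' ≤ t' → t' ≤ t → a ≤ u t' →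
      |ψ t' - ψ s'| ≤ 2 * √(C * D) * (√(u s' - a) - √(u t' - a)) := by
    intro s' t' h1 h2 h3 h4
    refine abs_sub_le_of_above h2 (fun r _ => hu r) (fun r _ => hψ r)
      (fun r hr => h4.trans_lt (hanti hr.2)) (fun r _ => (hneg r).le) (fun r hr => ?_)
      (fun r _ => hD r)
    exact (le_abs_self _).trans (hC r ⟨h1.trans hr.1.le, hr.2.le.trans h3⟩)
  have below : ∀ s' t', s ≤ s' → s' ≤ t' → t' ≤ t → u s' ≤ a →
      |ψ t' - ψ s'| ≤ 2 * √(C * D) * (√(a - u t') - √(a - u s')) := by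
    intro s' t' h1 h2 h3 h4
    have hmem : ∀ r ∈ Ioo (-t') (-s'), -r ∈ Icc s t := fun r hr =>
      ⟨by linarith [hr.2], by linarith [hr.1]⟩
    -- Reversing time and negating u exchanges the two sides of the level a.
    have := abs_sub_le_of_above (u := fun r => -u (-r)) (ψ := fun r => ψ (-r))
      (u' := fun r => u' (-r)) (ψ' := fun r => -ψ' (-r)) (a := -a) (C := C) (D := D)
      (neg_le_neg h2) (fun r _ => by
        simpa [Function.comp_def, Pi.neg_def] using ((hu (-r)).scomp r (hasDerivAt_neg r)).neg)
      (fun r _ => by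
        simpa [Function.comp_def] using (hψ (-r)).scomp r (hasDerivAt_neg r))
      (fun r hr => neg_lt_neg ((hanti (show s' < -r by linarith [hr.2])).trans_le h4))
      (fun r _ => (hneg _).le)
      (fun r hr => by
        have := (neg_le_abs _).trans (hC (-r) (hmem r hr))
        linarith) (fun r _ => by simpa using hD (-r))
    simp only [neg_neg, sub_neg_eq_add, neg_add_eq_sub] at this
    rwa [abs_sub_comm]
  rcases le_total a (u t) with h | h
  · refine (above s t le_rfl hst le_rfl h).trans ?_
    rw [abs_of_nonneg (sub_nonneg.2 (h.trans (hanti.antitone hst)))]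
    have := Real.sqrt_nonneg (u t - a)
    have := Real.sqrt_nonneg |u t - a|
    gcongr
    linarith
  rcases le_total (u s) a with h' | h'
  · refine (below s t le_rfl hst le_rfl h').trans ?_
    rw [abs_sub_comm (u t), abs_of_nonneg (sub_nonneg.2 h)]
    have := Real.sqrt_nonneg (a - u s)
    have := Real.sqrt_nonneg |u s - a|
    gcongr
    linarith
  -- The remaining case, where u crosses the level a: split at the crossing time, where the square
  -- roots vanish.
  obtain ⟨c, hc, hca⟩ : a ∈ u '' Icc s t :=
    intermediate_value_Icc' hst (fun r _ => (hu r).continuousAt.continuousWithinAt) ⟨h, h'⟩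
  have h1 := above s c le_rfl hc.1 hc.2 hca.ge
  have h2 := below c t hc.1 hc.2 le_rfl hca.le
  rw [hca, sub_self, Real.sqrt_zero, sub_zero] at h1 h2
  rw [abs_of_nonneg (sub_nonneg.2 h'), abs_sub_comm (u t), abs_of_nonneg (sub_nonneg.2 h)]
  calc |ψ t - ψ s| ≤ |ψ t - ψ c| + |ψ c - ψ s| := abs_sub_le _ _ _
    _ ≤ _ := by linarith

variable [FiniteDimensional ℝ E] [IsManifold 𝓘(ℝ, E) ∞ M]
variable {S : Set M} {g₀ : MetricOn E S} {h : M → ℝ}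

open SliceChart

theorem SmoothOn.continuousOn (hS : IsSubmanifold E S) (hh : SmoothOn E S h) :
    ContinuousOn h S := by
  intro p hp
  obtain ⟨σ⟩ := hS p hp
  have hz := coords_mem_dom hp σ.mem_source
  have h1 : ContinuousAt (h ∘ σ.loc) (σ.coords p) :=
    ((contDiffOn_comp_loc hh).contDiffAt (σ.isOpen_dom.mem_nhds hz)).continuousAt
  have h2 : ContinuousWithinAt (fun q => (h ∘ σ.loc) (σ.coords q)) S p :=
    (ContinuousAt.comp (g := h ∘ σ.loc) h1 (continuousAt_coords σ.mem_source)).continuousWithinAt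
  refine h2.congr_of_eventuallyEq ?_ (by simp [loc_coords hp σ.mem_source])
  filter_upwards [self_mem_nhdsWithin, mem_nhdsWithin_of_mem_nhds
    (σ.chart.open_source.mem_nhds σ.mem_source)] with q h3 h4
  simp [loc_coords h3 h4]

/-- Convergence in a compact manifold can be tested on smooth functions. -/
theorem tendsto_of_smooth [CompactSpace M] [T2Space M] {ι : Type*} {l : Filter ι} {a : ι → M}
    {p : M} (H : ∀ φ : M → ℝ, ContMDiff 𝓘(ℝ, E) 𝓘(ℝ, ℝ) ∞ φ →
      Tendsto (fun i => φ (a i)) l (𝓝 (φ p))) : Tendsto a l (𝓝 p) := by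
  intro U hU
  obtain ⟨φ, hφ0, hφ1, -⟩ := exists_contMDiffMap_zero_one_of_isClosed (n := ⊤) 𝓘(ℝ, E)
    (s := (interior U)ᶜ) (t := {p}) isOpen_interior.isClosed_compl isClosed_singleton
    (disjoint_singleton_right.2 (by simpa using mem_interior_iff_mem_nhds.2 hU))
  have hp1 : φ p = 1 := hφ1 (mem_singleton p)
  have h1 := (H φ φ.contMDiff).eventually_const_lt (u := 1 / 2) (by rw [hp1]; norm_num)
  refine mem_map.2 ?_
  filter_upwards [h1] with i hi
  by_contra hiU
  have h4 : φ (a i) = 0 :=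
    hφ0 (show a i ∈ (interior U)ᶜ from fun h => hiU (show a i ∈ U from interior_subset h))
  rw [h4] at hi
  norm_num at hi

/-- A gradient system on a compact submanifold which satisfies the Łojasiewicz inequality with
exponent `1/2` at the critical points. -/
structure IsLojasiewicz {S : Set M} (g₀ : MetricOn E S) (h : M → ℝ) : Prop
    extends IsCompactGradient g₀ h where
  lojasiewicz : ∀ p ∈ critOn E S h, ∃ C : ℝ, ∀ᶠ q in 𝓝 p, ∀ (y : ℝ → M) (s : ℝ),
    MorseAt g₀ h y s → y s = q → |h q - h p| ≤ C * -(deriv (fun r => h (y r)) s)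

namespace IsCompactGradient

theorem isMorseLine_const (H : IsCompactGradient g₀ h) {p : M} (hp : p ∈ critOn E S h) :
    IsMorseLine g₀ h fun _ => p := by
  obtain ⟨σ⟩ := H.submanifold p hp.1
  have hz := coords_mem_dom hp.1 σ.mem_source
  have h0 := (field_eq_zero_iff (g₀ := g₀) hz).2 ((mem_critOn_iff H.smooth hp.1 σ.mem_source).1 hp)
  rw [isMorseLine_iff]
  intro s
  have h1 : MorseAt g₀ h (σ.loc ∘ fun _ => σ.coords p) s :=
    morseAt_of_hasDerivAt H.smooth isOpen_univ
      (fun s _ => ⟨hz, by rw [h0]; exact hasDerivAt_const s _⟩) (mem_univ s)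
  have h2 : (σ.loc ∘ fun _ => σ.coords p) = fun _ : ℝ => p :=
    funext fun _ => loc_coords hp.1 σ.mem_source
  rwa [h2] at h1

theorem deriv_eq_zero_iff (H : IsCompactGradient g₀ h) {y : ℝ → M} {s : ℝ}
    (hy : MorseAt g₀ h y s) : deriv (fun r => h (y r)) s = 0 ↔ y s ∈ critOn E S h := by
  obtain ⟨σ⟩ := H.submanifold _ hy.mem
  have hz := coords_mem_dom hy.mem σ.mem_source
  rw [mem_critOn_iff H.smooth hy.mem σ.mem_source, ← field_eq_zero_iff (g₀ := g₀) hz,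
    (MorseAt.deriv_comp_le_zero H.smooth σ hy σ.mem_source).deriv, neg_eq_zero]
  constructor
  · intro h1
    by_contra h2
    exact (gram_pos hz h2).ne' h1
  · intro h1
    simp [h1]

theorem eq_const [T2Space M] (H : IsCompactGradient g₀ h) {y : ℝ → M} (hy : IsMorseLine g₀ h y)
    {s : ℝ} (hs : y s ∈ critOn E S h) (r : ℝ) : y r = y s :=
  congrFun (H.eq_of_eq (y' := fun _ => y s) hy (H.isMorseLine_const hs) (s := s) rfl) r

theorem mem_critOn_of_const (H : IsCompactGradient g₀ h) {p : M}
    (hp : IsMorseLine g₀ h fun _ => p) : p ∈ critOn E S h :=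
  (H.deriv_eq_zero_iff (hp.morseAt 0)).1 (by simp)

theorem deriv_neg [T2Space M] (H : IsCompactGradient g₀ h) {y : ℝ → M} (hy : IsMorseLine g₀ h y)
    (hn : ¬ ∃ p, ∀ s, y s = p) (s : ℝ) : deriv (fun r => h (y r)) s < 0 :=
  (H.deriv_nonpos (hy.morseAt s)).lt_of_ne fun h0 =>
    hn ⟨y s, H.eq_const hy ((H.deriv_eq_zero_iff (hy.morseAt s)).1 h0)⟩

theorem strictAnti [T2Space M] (H : IsCompactGradient g₀ h) {y : ℝ → M} (hy : IsMorseLine g₀ h y)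
    (hn : ¬ ∃ p, ∀ s, y s = p) : StrictAnti fun r => h (y r) :=
  strictAnti_of_deriv_neg (H.deriv_neg hy hn)

theorem antitone (H : IsCompactGradient g₀ h) {y : ℝ → M} (hy : IsMorseLine g₀ h y) :
    Antitone fun r => h (y r) :=
  antitone_of_deriv_nonpos (fun s => (H.hasDerivAt_comp H.smooth (hy.morseAt s)).differentiableAt)
    fun s => H.deriv_nonpos (hy.morseAt s)

theorem tendsto_value (H : IsCompactGradient g₀ h) {ι : Type*} {l : Filter ι} {a : ι → M} {p : M}
    (ha : ∀ i, a i ∈ S) (hp : p ∈ S) (hap : Tendsto a l (𝓝 p)) :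
    Tendsto (fun i => h (a i)) l (𝓝 (h p)) :=
  (H.smooth.continuousOn H.submanifold p hp).tendsto.comp
    (tendsto_nhdsWithin_iff.2 ⟨hap, Eventually.of_forall ha⟩)

theorem isClosed [T2Space M] (H : IsCompactGradient g₀ h) : IsClosed S := H.compact.isClosed

theorem exists_bound (H : IsCompactGradient g₀ h) : ∃ B, ∀ q ∈ S, |h q| ≤ B :=
  H.compact.exists_bound_of_continuousOn (H.smooth.continuousOn H.submanifold)

/-- Away from critical points, `h` decays at a definite rate. -/
theorem exists_rate (H : IsCompactGradient g₀ h) {p : M} (hp : p ∈ S) (hpc : p ∉ critOn E S h) :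
    ∃ c > (0 : ℝ), ∀ᶠ q in 𝓝 p, ∀ (y : ℝ → M) (s : ℝ), MorseAt g₀ h y s → y s = q →
      c ≤ -(deriv (fun r => h (y r)) s) := by
  obtain ⟨σ⟩ := H.submanifold p hp
  have hz := coords_mem_dom hp σ.mem_source
  have hV : σ.field g₀ h (σ.coords p) ≠ 0 := fun h0 =>
    hpc ((mem_critOn_iff H.smooth hp σ.mem_source).2 ((field_eq_zero_iff hz).1 h0))
  have hpos := gram_pos (g₀ := g₀) hz hV
  have hn := σ.isOpen_dom.mem_nhds hz
  have hc : ContinuousAt (fun z => σ.gram g₀ z (σ.field g₀ h z) (σ.field g₀ h z)) (σ.coords p) :=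
    (((contDiffOn_gram.contDiffAt hn).continuousAt).clm_apply
      ((contDiffOn_field H.smooth).contDiffAt hn).continuousAt).clm_apply
      ((contDiffOn_field H.smooth).contDiffAt hn).continuousAt
  have hc' : ContinuousAt (fun q => σ.gram g₀ (σ.coords q) (σ.field g₀ h (σ.coords q))
      (σ.field g₀ h (σ.coords q))) p := ContinuousAt.comp
    (g := fun z => σ.gram g₀ z (σ.field g₀ h z) (σ.field g₀ h z)) hc
    (continuousAt_coords σ.mem_source)
  refine ⟨_, half_pos hpos, ?_⟩
  filter_upwards [hc'.eventually_const_lt (half_lt_self hpos),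
    σ.chart.open_source.mem_nhds σ.mem_source] with q h1 h2 y s hy hs
  subst hs
  rw [(MorseAt.deriv_comp_le_zero H.smooth σ hy h2).deriv, neg_neg]
  exact h1.le

end IsCompactGradient

namespace IsLojasiewicz

/-- Extends the inequality from critical points to a whole neighborhood of the level a. At regular
points of that level h decays at a definite rate, and points off the level are excluded by closeness
to a; compactness does the rest. -/
theorem exists_uniform (H : IsLojasiewicz g₀ h) (a : ℝ) :
    ∃ ε > (0 : ℝ), ∃ C : ℝ, ∀ (y : ℝ → M) (s : ℝ), MorseAt g₀ h y s → |h (y s) - a| < ε →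
      |h (y s) - a| ≤ C * -(deriv (fun r => h (y r)) s) := by
  -- One parameter C serves both as the constant and, through 1/C, as the width of the band of
  -- levels.
  have := H.compact.exists_uniform_bound (P := fun q C => 0 < C ∧ ∀ (y : ℝ → M) (s : ℝ),
    MorseAt g₀ h y s → y s = q → |h q - a| < 1 / C →
      |h q - a| ≤ C * -(deriv (fun r => h (y r)) s)) ?_ ?_
  · obtain ⟨C, hC⟩ := this
    refine ⟨1 / max C 1, by positivity, C, fun y s hy hs => ?_⟩
    have h1 := hC (y s) hy.mem
    refine h1.2 y s hy rfl (hs.trans_le ?_)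
    have := h1.1
    gcongr
    exact le_max_left _ _
  · intro q C C' hle hC
    have hC' := hC.1.trans_le hle
    refine ⟨hC', fun y s hy hs hlt => ?_⟩
    have h2 := H.deriv_nonpos hy
    have h3 := hC.1
    refine (hC.2 y s hy hs (hlt.trans_le (by gcongr))).trans ?_
    gcongr
    linarith
  · intro p hp
    have hcont := H.smooth.continuousOn H.submanifold p hp
    by_cases ha : h p = a
    · by_cases hpc : p ∈ critOn E S h
      · obtain ⟨C, hC⟩ := H.lojasiewicz p hpc
        refine ⟨max C 1, ?_⟩
        filter_upwards [hC] with q hq hqS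
        refine ⟨by positivity, fun y s hy hs _ => ?_⟩
        rw [← ha]
        have h2 := H.deriv_nonpos hy
        refine (hq y s hy hs).trans ?_
        gcongr
        · linarith
        · exact le_max_left _ _
      · obtain ⟨c, hc, hev⟩ := H.exists_rate hp hpc
        refine ⟨max (1 / c) 1, ?_⟩
        filter_upwards [hev] with q hq hqS
        refine ⟨by positivity, fun y s hy hs hlt => ?_⟩
        have h1 := hq y s hy hs
        have h2 : 1 / max (1 / c) 1 ≤ 1 := by
          rw [div_le_one (by positivity)]; exact le_max_right _ _
        calc |h q - a| ≤ 1 := hlt.le.trans h2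
          _ = 1 / c * c := by field_simp
          _ ≤ max (1 / c) 1 * -(deriv (fun r => h (y r)) s) := by
            gcongr
            exact le_max_left _ _
    · have hpos : 0 < |h p - a| := abs_pos.2 (sub_ne_zero.2 ha)
      refine ⟨2 / |h p - a|, ?_⟩
      have h1 : ∀ᶠ q in 𝓝[S] p, |h p - a| / 2 < |h q - a| :=
        ((hcont.sub continuousWithinAt_const).abs).eventually_const_lt (half_lt_self hpos)
      filter_upwards [eventually_nhdsWithin_iff.1 h1] with q hq hqS
      refine ⟨by positivity, fun y s hy hs hlt => ?_⟩
      rw [one_div_div] at hlt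
      exact absurd (hq hqS) (not_lt.2 hlt.le)

/-- The inequality, applied to a constant flow line, has right-hand side zero. -/
theorem isolated_values (H : IsLojasiewicz g₀ h) (a : ℝ) :
    ∃ ε > (0 : ℝ), ∀ q ∈ critOn E S h, |h q - a| < ε → h q = a := by
  obtain ⟨ε, hε, C, hC⟩ := H.exists_uniform a
  refine ⟨ε, hε, fun q hq hlt => ?_⟩
  have h1 := hC (fun _ => q) 0 ((H.isMorseLine_const hq).morseAt 0) hlt
  simp only [deriv_const, neg_zero, mul_zero] at h1
  exact sub_eq_zero.1 (abs_eq_zero.1 (le_antisymm h1 (abs_nonneg _)))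

theorem finite_values (H : IsLojasiewicz g₀ h) : (h '' critOn E S h).Finite := by
  choose ε hε hεv using H.isolated_values
  have hK : IsCompact (h '' S) := H.compact.image_of_continuousOn
    (H.smooth.continuousOn H.submanifold)
  obtain ⟨t, -, ht⟩ := hK.elim_nhds_subcover (fun a => Metric.ball a (ε a))
    fun a _ => Metric.ball_mem_nhds a (hε a)
  refine t.finite_toSet.subset ?_
  rintro v hv
  have hvS : v ∈ h '' S := image_mono (fun q hq => hq.1) hv
  obtain ⟨a, ha, hva⟩ := mem_iUnion₂.1 (ht hvS)
  obtain ⟨q, hq, rfl⟩ := hv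
  rw [hεv a q hq hva]
  exact ha

/-- The substitute for a bound on length, tested by smooth functions instead of a distance. The
width ε does not depend on φ, and only the two end levels need to be close to a, since h is monotone
in between. -/
theorem exists_estimate [T2Space M] (H : IsLojasiewicz g₀ h) (a : ℝ) : ∃ ε > (0 : ℝ),
    ∀ φ : M → ℝ, SmoothOn E S φ → ∃ K : ℝ, ∀ (y : ℝ → M) (s t : ℝ), IsMorseLine g₀ h y →
      |h (y s) - a| < ε → |h (y t) - a| < ε →
      |φ (y t) - φ (y s)| ≤ K * (√|h (y s) - a| + √|h (y t) - a|) := by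
  obtain ⟨ε, hε, C, hC⟩ := H.exists_uniform a
  refine ⟨ε, hε, fun φ hφ => ?_⟩
  obtain ⟨D, hD⟩ := H.exists_deriv_sq_bound hφ
  refine ⟨2 * √(C * D), fun y s t hy => ?_⟩
  wlog hst : s ≤ t generalizing s t
  · intro h1 h2
    rw [abs_sub_comm, add_comm]
    exact this t s (le_of_not_ge hst) h2 h1
  intro h1 h2
  by_cases hn : ∃ p, ∀ s, y s = p
  · obtain ⟨p, hp⟩ := hn
    simp only [hp, sub_self, abs_zero]
    positivity
  · have hanti := H.antitone hy
    refine abs_sub_le_of_lojasiewicz hst (u := fun r => h (y r)) (ψ := fun r => φ (y r))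
      (fun r => H.hasDerivAt_comp H.smooth (hy.morseAt r))
      (fun r => H.hasDerivAt_comp hφ (hy.morseAt r)) (H.deriv_neg hy hn)
      (fun r hr => hC y r (hy.morseAt r) ?_) (fun r => hD (y r) (hy.2.1 r) y r (hy.morseAt r) rfl)
    have h3 := hanti hr.1
    have h4 := hanti hr.2
    simp only at h3 h4
    rw [abs_lt] at h1 h2 ⊢
    constructor <;> linarith [h1.1, h1.2, h2.1, h2.2]

variable [CompactSpace M] [T2Space M]

/-- Compactness gives a limit p along an ultrafilter; the length estimate upgrades it to a limit
along l, because every smooth function converges to its value at p. The shift-invariance of l covers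
both ends of the line and makes p critical. -/
theorem exists_tendsto (H : IsLojasiewicz g₀ h) {y : ℝ → M} (hy : IsMorseLine g₀ h y)
    {l : Filter ℝ} [l.NeBot] (hl : Tendsto (fun s => s + 1) l l) {a : ℝ}
    (ha : Tendsto (fun s => h (y s)) l (𝓝 a)) : ∃ p ∈ critOn E S h, Tendsto y l (𝓝 p) := by
  obtain ⟨p, hpS, hp⟩ := H.compact.ultrafilter_le_nhds ((Ultrafilter.of l).map y)
    (le_principal_iff.2 (mem_map.2 (univ_mem' fun s => hy.2.1 s)))
  have hpu : Tendsto y (Ultrafilter.of l) (𝓝 p) := hp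
  have hul : ((Ultrafilter.of l : Ultrafilter ℝ) : Filter ℝ) ≤ l := Ultrafilter.of_le l
  have hpa : h p = a := tendsto_nhds_unique (H.tendsto_value hy.2.1 hpS hpu) (ha.mono_left hul)
  obtain ⟨ε, hε, hest⟩ := H.exists_estimate a
  have hlim : Tendsto y l (𝓝 p) := by
    refine tendsto_of_smooth (E := E) fun φ hφ => ?_
    obtain ⟨K, hK⟩ := hest φ (smoothOn_of_contMDiff hφ S)
    have hev : ∀ᶠ s in l, |h (y s) - a| < ε := by
      simpa [Real.dist_eq] using (Metric.tendsto_nhds.1 ha) ε hε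
    have h0 : Tendsto (fun s => √|h (y s) - a|) l (𝓝 0) := by
      have := ((ha.sub_const a).abs).sqrt
      simpa using this
    have h1 : ∀ᶠ s in l, |φ (y s) - φ p| ≤ K * √|h (y s) - a| := by
      filter_upwards [hev] with s hs
      have h2 : Tendsto (fun t => |φ (y s) - φ (y t)|) (Ultrafilter.of l) (𝓝 |φ (y s) - φ p|) :=
        (tendsto_const_nhds.sub ((hφ.continuous.tendsto p).comp hpu)).abs
      have h3 : Tendsto (fun t => K * (√|h (y t) - a| + √|h (y s) - a|)) (Ultrafilter.of l)
          (𝓝 (K * (0 + √|h (y s) - a|))) :=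
        ((h0.mono_left hul).add tendsto_const_nhds).const_mul K
      rw [zero_add] at h3
      exact le_of_tendsto_of_tendsto h2 h3
        ((hev.filter_mono hul).mono fun t ht => hK y t s hy ht hs)
    have h4 := h0.const_mul K
    rw [mul_zero] at h4
    rw [tendsto_iff_norm_sub_tendsto_zero]
    exact squeeze_zero' (Eventually.of_forall fun _ => norm_nonneg _) h1 h4
  refine ⟨p, ?_, hlim⟩
  -- The flow for time 1 fixes p, since y(s + 1) has the same limit as y(s). If the line through p
  -- were not constant, h would strictly decrease along it.
  obtain ⟨z, hz, hz0⟩ := H.exists_isMorseLine hpS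
  have h1 := H.tendsto_apply (l := l) (y := fun i r => y (r + i)) (fun i => hy.comp_add i) hz
    (s₁ := 0) (by simpa [hz0] using hlim) (t := fun _ => 1) (s := 1) tendsto_const_nhds
  have h2 : z 1 = p := by
    refine tendsto_nhds_unique h1 ?_
    have := hlim.comp hl
    simpa [Function.comp_def, add_comm] using this
  by_cases hn : ∃ q, ∀ s, z s = q
  · obtain ⟨q, hq⟩ := hn
    have : z = fun _ => p := funext fun s => by rw [hq, ← hq 0, hz0]
    exact H.mem_critOn_of_const (this ▸ hz)
  · have := H.strictAnti hz hn zero_lt_one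
    simp only [hz0, h2, lt_irrefl] at this

theorem exists_tendsto_atTop (H : IsLojasiewicz g₀ h) {y : ℝ → M} (hy : IsMorseLine g₀ h y) :
    ∃ p ∈ critOn E S h, Tendsto y atTop (𝓝 p) := by
  obtain ⟨B, hB⟩ := H.exists_bound
  refine H.exists_tendsto hy (tendsto_atTop_add_const_right _ _ tendsto_id)
    (tendsto_atTop_ciInf (H.antitone hy) ⟨-B, ?_⟩)
  rintro _ ⟨s, rfl⟩
  exact neg_le_of_abs_le (hB _ (hy.2.1 s))

theorem exists_tendsto_atBot (H : IsLojasiewicz g₀ h) {y : ℝ → M} (hy : IsMorseLine g₀ h y) :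
    ∃ p ∈ critOn E S h, Tendsto y atBot (𝓝 p) := by
  obtain ⟨B, hB⟩ := H.exists_bound
  refine H.exists_tendsto hy (tendsto_atBot_add_const_right _ _ tendsto_id)
    (tendsto_atBot_ciSup (H.antitone hy) ⟨B, ?_⟩)
  rintro _ ⟨s, rfl⟩
  exact le_of_abs_le (hB _ (hy.2.1 s))

end IsLojasiewicz

end Dynamics

/-! ### Diagonal sequences and the breaking of flow lines. -/

section Chains

theorem exists_diagonal {X : Type*} [Nonempty X] {l : Filter ℕ} (hl : l ≤ atTop)
    {P : ℕ → ℕ → X → Prop} (hP : ∀ j, ∀ᶠ n in l, ∃ x, P j n x) :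
    ∃ x : ℕ → X, ∀ J, ∀ᶠ n in l, ∃ j ≥ J, P j n (x n) := by
  classical
  -- At the index n the strongest condition with number at most n that has a witness is used.
  set k : ℕ → ℕ := fun n => Nat.findGreatest (fun j => ∃ x, P j n x) n with hk
  have hx : ∀ n, ∃ x, (∃ x, P (k n) n x) → P (k n) n x := by
    intro n
    by_cases h : ∃ x, P (k n) n x
    · exact ⟨h.choose, fun _ => h.choose_spec⟩
    · exact ⟨Classical.arbitrary X, fun h' => absurd h' h⟩
  choose x hx using hx
  refine ⟨x, fun J => ?_⟩
  filter_upwards [hP J, hl (eventually_ge_atTop J)] with n hn hJn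
  exact ⟨k n, Nat.le_findGreatest hJn hn, hx n (Nat.findGreatest_spec (P := fun j => ∃ x, P j n x) hJn hn)⟩

theorem exists_tendsto_diagonal {X Y : Type*} [Nonempty X] [TopologicalSpace Y]
    [FirstCountableTopology Y] {q : Y} {l : Filter ℕ} (hl : l ≤ atTop) {a : ℕ → X → Y}
    {Q : ℕ → ℕ → X → Prop} (hQ : ∀ j j' n x, j ≤ j' → Q j' n x → Q j n x)
    (H : ∀ U ∈ 𝓝 q, ∀ j, ∀ᶠ n in l, ∃ x, a n x ∈ U ∧ Q j n x) :
    ∃ x : ℕ → X, Tendsto (fun n => a n (x n)) l (𝓝 q) ∧ ∀ j, ∀ᶠ n in l, Q j n (x n) := by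
  obtain ⟨U, hU⟩ := (𝓝 q).exists_antitone_basis
  obtain ⟨x, hx⟩ := exists_diagonal hl (P := fun j n x => a n x ∈ U j ∧ Q j n x)
    fun j => H (U j) (hU.1.mem_of_mem trivial) j
  refine ⟨x, hU.1.tendsto_right_iff.2 fun J _ => ?_, fun J => ?_⟩
  · filter_upwards [hx J] with n hn
    obtain ⟨j, hj, h1, -⟩ := hn
    exact hU.2 hj h1
  · filter_upwards [hx J] with n hn
    obtain ⟨j, hj, -, h2⟩ := hn
    exact hQ _ _ _ _ hj h2

/-- If no upper bound holds eventually, an ultrafilter makes each one fail eventually; otherwise the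
values eventually lie in a compact interval. -/
theorem _root_.Ultrafilter.tendsto_atTop_or_nhds {ι : Type*} (𝒰 : Ultrafilter ι) {u : ι → ℝ} {b : ℝ}
    (hu : ∀ᶠ n in 𝒰, b ≤ u n) : Tendsto u 𝒰 atTop ∨ ∃ T ≥ b, Tendsto u 𝒰 (𝓝 T) := by
  by_cases hR : ∃ R, ∀ᶠ n in 𝒰, u n ≤ R
  · obtain ⟨R, hR⟩ := hR
    obtain ⟨T, hT, hlim⟩ := (isCompact_Icc (a := b) (b := R)).ultrafilter_le_nhds (𝒰.map u)
      (le_principal_iff.2 (mem_map.2 (hu.and hR)))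
    exact Or.inr ⟨T, hT.1, hlim⟩
  · left
    rw [tendsto_atTop]
    intro R
    by_contra hn
    exact hR ⟨R, (Ultrafilter.eventually_not.2 hn).mono fun n hn => (not_le.1 hn).le⟩

variable [FiniteDimensional ℝ E] [IsManifold 𝓘(ℝ, E) ∞ M]
variable {S : Set M} {g₀ : MetricOn E S} {h : M → ℝ}

/-- A chain of nonconstant flow lines from `q` to `q'`, each of which is a limit of shifts of
the flow lines `y n`. -/
def IsChain (g₀ : MetricOn E S) (h : M → ℝ) (l : Filter ℕ) (y : ℕ → ℝ → M) :
    M → List ((ℕ → ℝ) × (ℝ → M)) → M → Prop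
  | q, [], q' => q = q'
  | q, e :: L, q' => IsMorseLine g₀ h e.2 ∧ (¬ ∃ p, ∀ s, e.2 s = p) ∧
      Tendsto (fun n => y n (e.1 n)) l (𝓝 (e.2 0)) ∧ Tendsto e.2 atBot (𝓝 q) ∧
      ∃ q₁ ∈ critOn E S h, Tendsto e.2 atTop (𝓝 q₁) ∧ IsChain g₀ h l y q₁ L q'

theorem IsCompactGradient.exists_limit (H : IsCompactGradient g₀ h) {ι : Type*}
    (𝒰 : Ultrafilter ι) {a : ι → M} (ha : ∀ n, a n ∈ S) : ∃ p ∈ S, Tendsto a 𝒰 (𝓝 p) :=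
  H.compact.ultrafilter_le_nhds (𝒰.map a) (le_principal_iff.2 (mem_map.2 (univ_mem' ha)))

namespace IsLojasiewicz

variable [CompactSpace M] [T2Space M]

/-- The levels at the times r n and t n + s, for s ≤ 0, are close to a, so the length estimate
bounds the displacement from q to w s by the square root of |h(w s) − a| in the limit. By isolation
of critical values the backward limit of h along w is a, so this bound tends to zero as s → −∞. -/
theorem tendsto_atBot_of_close (H : IsLojasiewicz g₀ h) (a : ℝ) :
    ∃ ε > (0 : ℝ), ∀ {l : Filter ℕ} [l.NeBot] {y : ℕ → ℝ → M} {r t : ℕ → ℝ} {q : M} {w : ℝ → M},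
      (∀ n, IsMorseLine g₀ h (y n)) → q ∈ critOn E S h → h q = a →
      Tendsto (fun n => y n (r n)) l (𝓝 q) → IsMorseLine g₀ h w →
      Tendsto (fun n => y n (t n)) l (𝓝 (w 0)) → Tendsto (fun n => t n - r n) l atTop →
      a - ε < h (w 0) → Tendsto w atBot (𝓝 q) := by
  obtain ⟨ε₁, hε₁, hest⟩ := H.exists_estimate a
  obtain ⟨ε₂, hε₂, hiso⟩ := H.isolated_values a
  refine ⟨min ε₁ ε₂, lt_min hε₁ hε₂, ?_⟩
  intro l _ y r t q w hy hq hqa hr hw ht htr hε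
  have hanti := H.antitone hw
  have hshift : ∀ s, Tendsto (fun n => y n (t n + s)) l (𝓝 (w s)) := by
    intro s
    have := H.tendsto_apply (l := l) (y := fun n r => y n (r + t n))
      (fun n => (hy n).comp_add (t n)) hw (s₁ := 0) (by simpa using ht) (t := fun _ => s) (s := s)
      tendsto_const_nhds
    simpa [add_comm] using this
  have hval : ∀ s, Tendsto (fun n => h (y n (t n + s))) l (𝓝 (h (w s))) := fun s =>
    H.tendsto_value (fun n => (hy n).2.1 _) (hw.2.1 s) (hshift s)
  have hvr : Tendsto (fun n => h (y n (r n))) l (𝓝 a) :=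
    hqa ▸ H.tendsto_value (fun n => (hy n).2.1 _) hq.1 hr
  have hle : ∀ s, h (w s) ≤ a := by
    intro s
    refine le_of_tendsto_of_tendsto (hval s) hvr ?_
    filter_upwards [htr.eventually_ge_atTop (-s)] with n hn
    exact H.antitone (hy n) (by linarith)
  have hclose : ∀ s ≤ 0, |h (w s) - a| < min ε₁ ε₂ := by
    intro s hs
    have h1 := hanti hs
    simp only at h1
    rw [abs_sub_comm, abs_of_nonneg (sub_nonneg.2 (hle s))]
    linarith
  obtain ⟨q', hq', hwq'⟩ := H.exists_tendsto_atBot hw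
  have hvq' : Tendsto (fun s => h (w s)) atBot (𝓝 (h q')) :=
    H.tendsto_value hw.2.1 hq'.1 hwq'
  have hq'a : h q' = a := by
    refine hiso q' hq' ?_
    have h1 : h (w 0) ≤ h q' := ge_of_tendsto hvq' ((eventually_le_atBot 0).mono fun s hs => hanti hs)
    have h2 : h q' ≤ a := le_of_tendsto hvq' (Eventually.of_forall hle)
    rw [abs_sub_comm, abs_of_nonneg (sub_nonneg.2 h2)]
    linarith [min_le_right ε₁ ε₂]
  have h0 : Tendsto (fun s => √|h (w s) - a|) atBot (𝓝 0) := by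
    have := ((hvq'.sub_const a).abs).sqrt
    simpa [hq'a] using this
  refine tendsto_of_smooth (E := E) fun φ hφ => ?_
  obtain ⟨K, hK⟩ := hest φ (smoothOn_of_contMDiff hφ S)
  have h1 : ∀ᶠ s in atBot, |φ (w s) - φ q| ≤ K * √|h (w s) - a| := by
    filter_upwards [eventually_le_atBot 0] with s hs
    have h2 : Tendsto (fun n => |φ (y n (t n + s)) - φ (y n (r n))|) l (𝓝 |φ (w s) - φ q|) :=
      (((hφ.continuous.tendsto _).comp (hshift s)).sub ((hφ.continuous.tendsto _).comp hr)).abs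
    have h3 : Tendsto (fun n => K * (√|h (y n (r n)) - a| + √|h (y n (t n + s)) - a|)) l
        (𝓝 (K * (√|a - a| + √|h (w s) - a|))) :=
      (((hvr.sub_const a).abs.sqrt).add (((hval s).sub_const a).abs.sqrt)).const_mul K
    rw [sub_self, abs_zero, Real.sqrt_zero, zero_add] at h3
    refine le_of_tendsto_of_tendsto h2 h3 ?_
    have h4 := ((hvr.sub_const a).abs).eventually_lt_const (u := ε₁) (by simpa using hε₁)
    have h5 := (((hval s).sub_const a).abs).eventually_lt_const (u := ε₁)
      ((hclose s hs).trans_le (min_le_left _ _))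
    filter_upwards [h4, h5] with n h6 h7
    exact hK (y n) (r n) (t n + s) (hy n) h6 h7
  have h4 := h0.const_mul K
  rw [mul_zero] at h4
  rw [tendsto_iff_norm_sub_tendsto_zero]
  exact squeeze_zero' (Eventually.of_forall fun _ => norm_nonneg _) h1 h4

/-- Compactness up to breaking: flow lines `y n` which are at time `r n` close to the critical
point `q`, and much later, at time `t n`, close to the point `w 0`, converge to a chain of flow
lines from `q` to a critical point whose unstable manifold contains `w 0`. -/
theorem exists_chain (H : IsLojasiewicz g₀ h) [FirstCountableTopology M] {𝒰 : Ultrafilter ℕ}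
    (h𝒰 : (𝒰 : Filter ℕ) ≤ atTop) {y : ℕ → ℝ → M} (hy : ∀ n, IsMorseLine g₀ h (y n)) {q : M}
    (hq : q ∈ critOn E S h) {r t : ℕ → ℝ} {w : ℝ → M}
    (hr : Tendsto (fun n => y n (r n)) 𝒰 (𝓝 q)) (hw : IsMorseLine g₀ h w)
    (ht : Tendsto (fun n => y n (t n)) 𝒰 (𝓝 (w 0)))
    (htr : Tendsto (fun n => t n - r n) 𝒰 atTop) :
    ∃ L, ∃ q' ∈ critOn E S h, IsChain g₀ h 𝒰 y q L q' ∧ Tendsto w atBot (𝓝 q') := by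
  -- Induction on the number of critical values below the level of q, with the starting times r free
  -- to change.
  have hind : ∀ N : ℕ, ∀ q ∈ critOn E S h, ∀ r : ℕ → ℝ,
      {v ∈ h '' critOn E S h | v < h q}.ncard ≤ N → Tendsto (fun n => y n (r n)) 𝒰 (𝓝 q) →
      Tendsto (fun n => t n - r n) 𝒰 atTop →
      ∃ L, ∃ q' ∈ critOn E S h, IsChain g₀ h 𝒰 y q L q' ∧ Tendsto w atBot (𝓝 q') := by
    intro N
    induction N with
    | zero =>
      intro q hq r hN hr htr
      obtain ⟨p, hp, hwp⟩ := H.exists_tendsto_atTop hw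
      have hvw : Tendsto (fun s => h (w s)) atTop (𝓝 (h p)) := H.tendsto_value hw.2.1 hp.1 hwp
      have hpw : h p ≤ h (w 0) :=
        le_of_tendsto hvw ((eventually_ge_atTop 0).mono fun s hs => H.antitone hw hs)
      have hfin : {v ∈ h '' critOn E S h | v < h q}.Finite :=
        H.finite_values.subset fun v hv => hv.1
      -- Without smaller critical values the forward limit of w is not below q. Hence w 0 is not
      -- below q either, and w comes from q directly.
      have hqp : h q ≤ h p := by
        by_contra hlt
        have : h p ∈ {v ∈ h '' critOn E S h | v < h q} := ⟨⟨p, hp, rfl⟩, not_le.1 hlt⟩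
        rw [(Set.ncard_eq_zero hfin).1 (Nat.le_zero.1 hN)] at this
        exact this
      obtain ⟨ε, hε, hcl⟩ := H.tendsto_atBot_of_close (h q)
      exact ⟨[], q, hq, rfl, hcl hy hq rfl hr hw ht htr (by linarith)⟩
    | succ N ih =>
      intro q hq r hN hr htr
      obtain ⟨ε, hε, hcl⟩ := H.tendsto_atBot_of_close (h q)
      by_cases hlev : h q - ε < h (w 0)
      · exact ⟨[], q, hq, rfl, hcl hy hq rfl hr hw ht htr hlev⟩
      rw [not_lt] at hlev
      have hvr := H.tendsto_value (fun n => (hy n).2.1 (r n)) hq.1 hr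
      have hvt := H.tendsto_value (fun n => (hy n).2.1 (t n)) (hw.2.1 0) ht
      -- Strictly below q, so that the limit through this level is nonconstant, yet within the range
      -- where `tendsto_atBot_of_close` identifies its origin as q.
      set b := h q - ε / 2 with hb
      have hs : ∀ n, ∃ s, (b < h (y n (r n)) ∧ h (y n (t n)) < b ∧ r n ≤ t n) →
          (r n ≤ s ∧ s ≤ t n ∧ h (y n s) = b) := by
        intro n
        by_cases hc : b < h (y n (r n)) ∧ h (y n (t n)) < b ∧ r n ≤ t n
        · obtain ⟨s, hs, hsb⟩ := intermediate_value_Icc' hc.2.2 (f := fun s => h (y n s))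
            (fun s _ => (H.hasDerivAt_comp H.smooth
              ((hy n).morseAt s)).continuousAt.continuousWithinAt) ⟨hc.2.1.le, hc.1.le⟩
          exact ⟨s, fun _ => ⟨hs.1, hs.2, hsb⟩⟩
        · exact ⟨0, fun hc' => absurd hc' hc⟩
      choose s hs using hs
      have hev : ∀ᶠ n in (𝒰 : Filter ℕ), r n ≤ s n ∧ s n ≤ t n ∧ h (y n (s n)) = b := by
        filter_upwards [hvr.eventually_const_lt (show b < h q by linarith),
          hvt.eventually_lt_const (show h (w 0) < b by linarith),
          htr.eventually_ge_atTop 0] with n h1 h2 h3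
        exact hs n ⟨h1, h2, by linarith⟩
      obtain ⟨p, hp, hps⟩ := H.exists_limit 𝒰 fun n => (hy n).2.1 (s n)
      have hpb : h p = b := tendsto_nhds_unique
        (H.tendsto_value (fun n => (hy n).2.1 (s n)) hp hps)
        (tendsto_const_nhds.congr' (hev.mono fun n hn => hn.2.2.symm))
      obtain ⟨z, hz, hz0⟩ := H.exists_isMorseLine hp
      have hps' : Tendsto (fun n => y n (s n)) 𝒰 (𝓝 (z 0)) := hz0.symm ▸ hps
      have hlim : ∀ {a u : ℕ → ℝ} {x : ℝ → M} {T : ℝ}, IsMorseLine g₀ h x →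
          Tendsto (fun n => y n (a n)) 𝒰 (𝓝 (x 0)) → Tendsto u 𝒰 (𝓝 T) →
          Tendsto (fun n => y n (a n + u n)) 𝒰 (𝓝 (x T)) := by
        intro a u x T hx ha hu
        have := H.tendsto_apply (l := 𝒰) (y := fun n r => y n (r + a n))
          (fun n => (hy n).comp_add (a n)) hx (s₁ := 0) (by simpa using ha) (t := u) hu
        simpa [add_comm] using this
      -- If the lines needed only bounded time to reach the level b, their limit would still be at
      -- the rest point q, whose level is higher.
      have hsr : Tendsto (fun n => s n - r n) 𝒰 atTop := by
        rcases 𝒰.tendsto_atTop_or_nhds (u := fun n => s n - r n) (b := 0)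
          (hev.mono fun n hn => sub_nonneg.2 hn.1) with h1 | ⟨T, -, hT⟩
        · exact h1
        · exfalso
          have h2 := hlim (H.isMorseLine_const hq) hr hT
          simp only [add_sub_cancel] at h2
          have h3 := tendsto_nhds_unique h2 hps
          rw [← h3] at hpb
          linarith
      have hzq : Tendsto z atBot (𝓝 q) :=
        hcl hy hq rfl hr hz hps' hsr (by rw [hz0, hpb]; linarith)
      have hzn : ¬ ∃ c, ∀ s, z s = c := by
        rintro ⟨c, hc⟩
        have h1 : Tendsto z atBot (𝓝 p) := by
          rw [show z = fun _ => p from funext fun s => by rw [hc, ← hc 0, hz0]]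
          exact tendsto_const_nhds
        rw [tendsto_nhds_unique h1 hzq] at hpb
        linarith
      rcases 𝒰.tendsto_atTop_or_nhds (u := fun n => t n - s n) (b := 0)
          (hev.mono fun n hn => sub_nonneg.2 hn.2.1) with hts | ⟨T, -, hT⟩
      · obtain ⟨q₁, hq₁, hzq₁⟩ := H.exists_tendsto_atTop hz
        have hq₁b : h q₁ ≤ b := by
          rw [← hpb, ← hz0]
          exact le_of_tendsto (H.tendsto_value hz.2.1 hq₁.1 hzq₁)
            ((eventually_ge_atTop 0).mono fun s hs => H.antitone hz hs)
        -- Follow z to near its forward limit q₁ so slowly that the remaining time still tends to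
        -- infinity; the induction hypothesis then applies at q₁.
        obtain ⟨r', hr', hr't⟩ := exists_tendsto_diagonal h𝒰 (q := q₁) (a := y)
          (Q := fun j n x => (j : ℝ) ≤ t n - x)
          (fun j j' n x hjj' hx => (Nat.cast_le.2 hjj').trans hx) (fun U hU j => by
            obtain ⟨k, hk⟩ := (hzq₁.eventually (interior_mem_nhds.2 hU)).exists
            have h1 := hlim hz hps' (tendsto_const_nhds (x := k))
            filter_upwards [h1.eventually (isOpen_interior.mem_nhds hk),
              hts.eventually_ge_atTop (j + k)] with n h2 h3
            exact ⟨s n + k, interior_subset h2, by linarith⟩)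
        have hcard : {v ∈ h '' critOn E S h | v < h q₁}.ncard ≤ N := by
          have hlt : {v ∈ h '' critOn E S h | v < h q₁}.ncard <
              {v ∈ h '' critOn E S h | v < h q}.ncard := by
            refine Set.ncard_lt_ncard ⟨fun v hv => ⟨hv.1, hv.2.trans (by linarith)⟩, fun hsub => ?_⟩
              (H.finite_values.subset fun v hv => hv.1)
            exact lt_irrefl _ (hsub ⟨⟨q₁, hq₁, rfl⟩, by linarith⟩ :
              h q₁ ∈ {v ∈ h '' critOn E S h | v < h q₁}).2
          omega
        have hr'top : Tendsto (fun n => t n - r' n) 𝒰 atTop := by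
          rw [tendsto_atTop]
          intro R
          obtain ⟨j, hj⟩ := exists_nat_ge R
          exact (hr't j).mono fun n hn => hj.trans hn
        obtain ⟨L, q', hq', hL, hwq'⟩ := ih q₁ hq₁ r' hcard hr' hr'top
        exact ⟨(s, z) :: L, q', hq', ⟨hz, hzn, hps', hzq, q₁, hq₁, hzq₁, hL⟩, hwq'⟩
      -- Here w is a time shift of z, so it already emanates from q and no further line is needed.
      · have h1 := hlim hz hps' hT
        simp only [add_sub_cancel] at h1
        have h2 : w = fun s => z (s + T) := H.eq_of_eq hw (hz.comp_add T) (s := 0)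
          (by simpa using tendsto_nhds_unique ht h1)
        refine ⟨[], q, hq, rfl, ?_⟩
        rw [h2]
        exact hzq.comp (tendsto_atBot_add_const_right _ _ tendsto_id)
  exact hind _ q hq r le_rfl hr htr

end IsLojasiewicz

end Chains

/-! ### The Łojasiewicz inequality from transverse nondegeneracy of the Hessian. -/

section LocalInequality

variable {X : Type*} [NormedAddCommGroup X] [NormedSpace ℝ X] [FiniteDimensional ℝ X] {F : X → ℝ}
  {ρ : X →L[ℝ] X}

/-- The differential vanishes at ρ u, so strict differentiability of DF at 0 compares DF(u) with the
Hessian applied to u − ρ u. In finite dimension an injective linear map is bounded below. -/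
theorem exists_norm_le_norm_fderiv (hF : ContDiffAt ℝ ∞ F 0)
    (hρ : ∀ᶠ u in 𝓝 (0 : X), fderiv ℝ F (ρ u) = 0)
    (hinj : ∀ u, fderiv ℝ (fderiv ℝ F) 0 (u - ρ u) = 0 → u - ρ u = 0) :
    ∃ c > (0 : ℝ), ∀ᶠ u in 𝓝 (0 : X), c * ‖u - ρ u‖ ≤ ‖fderiv ℝ F u‖ := by
  set T : X →ₗ[ℝ] X := LinearMap.id - ρ.toLinearMap
  set L : LinearMap.range T →ₗ[ℝ] (X →L[ℝ] ℝ) :=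
    (fderiv ℝ (fderiv ℝ F) 0).toLinearMap.domRestrict (LinearMap.range T)
  have hker : L.ker = ⊥ := by
    rw [LinearMap.ker_eq_bot']
    rintro ⟨_, u, rfl⟩ hu
    exact Subtype.ext (hinj u hu)
  obtain ⟨K, hK, hanti⟩ := L.exists_antilipschitzWith hker
  have hlow : ∀ u, (K : ℝ)⁻¹ * ‖u - ρ u‖ ≤ ‖fderiv ℝ (fderiv ℝ F) 0 (u - ρ u)‖ := by
    intro u
    have h1 := hanti.le_mul_dist ⟨T u, u, rfl⟩ 0
    rw [map_zero, dist_zero_right, dist_zero_right] at h1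
    rw [inv_mul_le_iff₀ (by exact_mod_cast hK)]
    exact h1
  have hc : (0 : ℝ) < (K : ℝ)⁻¹ := inv_pos.2 (by exact_mod_cast hK)
  have hst : HasStrictFDerivAt (fderiv ℝ F) (fderiv ℝ (fderiv ℝ F) 0) 0 :=
    (hF.fderiv_right (m := ∞) (by simp)).hasStrictFDerivAt (by simp)
  have hT : Tendsto (fun u : X => (u, ρ u)) (𝓝 0) (𝓝 (0, 0)) := by
    have : Continuous fun u : X => (u, ρ u) := by fun_prop
    simpa using this.tendsto 0
  refine ⟨(K : ℝ)⁻¹ / 2, half_pos hc, ?_⟩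
  filter_upwards [hT.eventually (hst.isLittleO.def (half_pos hc)), hρ] with u h1 h2
  simp only [h2, sub_zero] at h1
  have h3 := hlow u
  have h4 := norm_sub_norm_le (fderiv ℝ (fderiv ℝ F) 0 (u - ρ u)) (fderiv ℝ F u)
  rw [norm_sub_rev] at h4
  linarith

/-- The Łojasiewicz inequality with exponent `1/2` for a function whose Hessian is nondegenerate
in the directions transverse to a linear family of critical points. -/
theorem exists_abs_sub_le_sq_norm_fderiv (hF : ContDiffAt ℝ ∞ F 0)
    (hρ : ∀ᶠ u in 𝓝 (0 : X), fderiv ℝ F (ρ u) = 0)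
    (hinj : ∀ u, fderiv ℝ (fderiv ℝ F) 0 (u - ρ u) = 0 → u - ρ u = 0) :
    ∃ C, ∀ᶠ u in 𝓝 (0 : X), |F u - F 0| ≤ C * ‖fderiv ℝ F u‖ ^ 2 := by
  obtain ⟨c, hc, hlow⟩ := exists_norm_le_norm_fderiv hF hρ hinj
  have hst : HasStrictFDerivAt (fderiv ℝ F) (fderiv ℝ (fderiv ℝ F) 0) 0 :=
    (hF.fderiv_right (m := ∞) (by simp)).hasStrictFDerivAt (by simp)
  obtain ⟨K, s, hs, hlip⟩ := hst.exists_lipschitzOnWith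
  have hd : ∀ᶠ u in 𝓝 (0 : X), DifferentiableAt ℝ F u :=
    (((hF.of_le (m := 1) (by exact_mod_cast le_top)).eventually (by simp)).mono fun u hu => hu.differentiableAt (by simp))
  obtain ⟨R, hR, hball⟩ := Metric.eventually_nhds_iff_ball.1 (hd.and hs)
  have hρ0 : Tendsto ρ (𝓝 0) (𝓝 0) := by simpa using ρ.continuous.tendsto 0
  obtain ⟨R', hR', hball'⟩ := Metric.eventually_nhds_iff_ball.1
    (hρ.and (hρ0.eventually (Metric.ball_mem_nhds 0 hR)))
  -- All points ρ u are critical, so F ∘ ρ has vanishing derivative on a ball.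
  have hconst : ∀ u ∈ Metric.ball (0 : X) R', F (ρ u) = F 0 := by
    intro u hu
    have hder : ∀ v ∈ Metric.ball (0 : X) R', HasFDerivAt (F ∘ ρ) (0 : X →L[ℝ] ℝ) v := by
      intro v hv
      have h1 := (hball _ (hball' v hv).2).1.hasFDerivAt.comp v ρ.hasFDerivAt
      rw [(hball' v hv).1] at h1
      simpa using h1
    have := Metric.isOpen_ball.is_const_of_fderiv_eq_zero (f := F ∘ ρ) (𝕜 := ℝ)
      (convex_ball (0 : X) R').isPreconnected
      (fun v hv => (hder v hv).differentiableAt.differentiableWithinAt)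
      (fun v hv => (hder v hv).fderiv) hu (Metric.mem_ball_self hR')
    simpa using this
  refine ⟨K / c ^ 2, ?_⟩
  filter_upwards [hlow, Metric.ball_mem_nhds 0 hR, Metric.ball_mem_nhds 0 hR'] with u h1 h2 h3
  have h4 := hball' u h3
  have hseg : segment ℝ (ρ u) u ⊆ Metric.ball 0 R := (convex_ball _ _).segment_subset h4.2 h2
  -- On the segment from ρ u to u the differential is at most K ‖u − ρ u‖, so F deviates from F 0
  -- quadratically in ‖u − ρ u‖. The linear lower bound for DF then converts this into ‖DF(u)‖².
  have h5 := Convex.norm_image_sub_le_of_norm_fderiv_le (f := F) (𝕜 := ℝ)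
    (C := K * ‖u - ρ u‖) (s := segment ℝ (ρ u) u)
    (fun w hw => (hball w (hseg hw)).1) (fun w hw => ?_) (convex_segment _ _)
    (left_mem_segment ℝ (ρ u) u) (right_mem_segment ℝ (ρ u) u)
  · rw [hconst u h3, Real.norm_eq_abs] at h5
    calc |F u - F 0| ≤ K * ‖u - ρ u‖ * ‖u - ρ u‖ := h5
      _ = K / c ^ 2 * (c * ‖u - ρ u‖) ^ 2 := by field_simp
      _ ≤ K / c ^ 2 * ‖fderiv ℝ F u‖ ^ 2 := by gcongr
  · have h6 := hlip.norm_sub_le (hball w (hseg hw)).2 (hball _ h4.2).2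
    rw [h4.1, sub_zero] at h6
    refine h6.trans ?_
    gcongr
    obtain ⟨a, b, ha, hb, hab, rfl⟩ := hw
    have h7 : a • ρ u + b • u - ρ u = b • (u - ρ u) := by
      rw [← eq_sub_iff_add_eq] at hab
      rw [hab, sub_smul, one_smul, smul_sub]
      abel
    rw [h7, norm_smul, Real.norm_of_nonneg hb]
    exact mul_le_of_le_one_left (norm_nonneg _) (by linarith)

end LocalInequality

/-! ### From the local inequality to gradient systems, and the Morse case. -/

section Systems

variable [FiniteDimensional ℝ E] [IsManifold 𝓘(ℝ, E) ∞ M]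

open SliceChart

/-- A local inequality for the differential yields the Łojasiewicz inequality along the flow. -/
theorem IsCompactGradient.exists_rate_of_local {S : Set M} {g₀ : MetricOn E S} {h : M → ℝ}
    (H : IsCompactGradient g₀ h) {p : M} (σ : SliceChart (E := E) S p)
    (hloc : ∃ C, ∀ᶠ u in 𝓝 (0 : σ.Coord), |(h ∘ σ.loc) u - (h ∘ σ.loc) 0| ≤
      C * ‖fderiv ℝ (h ∘ σ.loc) u‖ ^ 2) :
    ∃ C : ℝ, ∀ᶠ q in 𝓝 p, ∀ (y : ℝ → M) (s : ℝ), MorseAt g₀ h y s → y s = q →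
      |h q - h p| ≤ C * -(deriv (fun r => h (y r)) s) := by
  obtain ⟨C, hC⟩ := hloc
  have hz := σ.zero_mem_dom
  obtain ⟨c, hc, hco⟩ := exists_gram_coercive (g₀ := g₀) hz
  have hG0 := ((contDiffOn_gram (g₀ := g₀)).contDiffAt (σ.isOpen_dom.mem_nhds hz)).continuousAt
  set G := ‖σ.gram g₀ 0‖ + 1
  have hcoords : Tendsto σ.coords (𝓝 p) (𝓝 0) := by
    simpa [σ.coords_self] using (continuousAt_coords (σ := σ) σ.mem_source).tendsto
  -- G bounds the Gram form, hence ‖dh‖ ≤ G ‖V‖ for the gradient V, and c ‖V‖² is at most the rate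
  -- of decay of h.
  refine ⟨max C 0 * (G ^ 2 / c), ?_⟩
  filter_upwards [hcoords.eventually hC, hcoords.eventually hco,
    hcoords.eventually (Metric.continuousAt_iff'.1 hG0 1 one_pos),
    σ.chart.open_source.mem_nhds σ.mem_source] with q h1 h2 h3 h4 y s hy hs
  subst hs
  rw [(MorseAt.deriv_comp_le_zero H.smooth σ hy h4).deriv, neg_neg]
  simp only [Function.comp_apply, σ.loc_zero, loc_coords hy.mem h4] at h1
  set V := σ.field g₀ h (σ.coords (y s))
  have h5 : ‖fderiv ℝ (h ∘ σ.loc) (σ.coords (y s))‖ ≤ G * ‖V‖ := by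
    have h6 := gram_field (g₀ := g₀) (h := h) (coords_mem_dom hy.mem h4)
    rw [← norm_neg, ← h6]
    exact (ContinuousLinearMap.le_opNorm _ _).trans
      (mul_le_mul_of_nonneg_right (norm_le_norm_add_const_of_dist_le h3.le) (norm_nonneg _))
  calc |h (y s) - h p| ≤ C * ‖fderiv ℝ (h ∘ σ.loc) (σ.coords (y s))‖ ^ 2 := h1
    _ ≤ max C 0 * ‖fderiv ℝ (h ∘ σ.loc) (σ.coords (y s))‖ ^ 2 := by
      gcongr; exact le_max_left _ _
    _ ≤ max C 0 * (G * ‖V‖) ^ 2 := by gcongr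
    _ = max C 0 * (G ^ 2 / c) * (c * ‖V‖ ^ 2) := by field_simp
    _ ≤ _ := by gcongr; exact h2 V

section Morse

variable {S : Set M} {g₀ : MetricOn E S} {h : M → ℝ}

theorem IsMorseOn.hess_injective (hh : IsMorseOn E S h) {p : M} (hp : p ∈ critOn E S h)
    (σ : SliceChart (E := E) S p) (u : σ.Coord)
    (hu : fderiv ℝ (fderiv ℝ (h ∘ σ.loc)) 0 u = 0) : u = 0 := by
  have h1 : h ∘ σ.loc = (h ∘ σ.param) ∘ σ.equiv := rfl
  have h2 : fderiv ℝ (h ∘ σ.loc) = fun z =>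
      (fderiv ℝ (h ∘ σ.param) (σ.equiv z)).comp σ.equiv.toContinuousLinearMap := by
    funext z
    rw [h1, ContinuousLinearEquiv.comp_right_fderiv]
  have hd : DifferentiableAt ℝ (fderiv ℝ (h ∘ σ.param)) (σ.equiv 0) := by
    rw [map_zero]
    exact ((hh.1 p hp.1 σ).fderiv_right (m := ∞) (by simp)).differentiableAt (by simp)
  have h3' := HasFDerivAt.comp (g := fderiv ℝ (h ∘ σ.param)) (f := σ.equiv) (0 : σ.Coord)
    hd.hasFDerivAt σ.equiv.hasFDerivAt
  have h3 := h3'.clm_comp (hasFDerivAt_const σ.equiv.toContinuousLinearMap (0 : σ.Coord))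
  have h4 : fderiv ℝ (fderiv ℝ (h ∘ σ.loc)) 0 = _ :=
    (congrArg (fun G : σ.Coord → σ.Coord →L[ℝ] ℝ => fderiv ℝ G 0) h2).trans h3.fderiv
  rw [h4] at hu
  have h5 : σ.equiv u = 0 := by
    refine hh.2 p hp σ (σ.equiv u) fun v' => ?_
    have h6 := congrArg (fun L : σ.Coord →L[ℝ] ℝ => L (σ.equiv.symm v')) hu
    unfold hess
    simpa using h6
  simpa using h5

theorem IsMorseOn.isLojasiewicz (hh : IsMorseOn E S h) (hS : IsSubmanifold E S)
    (hc : IsCompact S) : IsLojasiewicz g₀ h where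
  submanifold := hS
  compact := hc
  smooth := hh.1
  lojasiewicz p hp := by
    obtain ⟨σ⟩ := hS p hp.1
    have h0 := (mem_critOn_iff hh.1 hp.1 σ.mem_source).1 hp
    rw [σ.coords_self] at h0
    exact IsCompactGradient.exists_rate_of_local ⟨hS, hc, hh.1⟩ σ
      -- At a nondegenerate critical point the linear family of critical points is the point itself.
      (exists_abs_sub_le_sq_norm_fderiv (ρ := 0)
        ((contDiffOn_comp_loc hh.1).contDiffAt (σ.isOpen_dom.mem_nhds σ.zero_mem_dom))
        (Eventually.of_forall fun u => by simpa using h0)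
        fun u hu => hh.hess_injective hp σ _ hu)

/-- A Morse function on a compact submanifold has finitely many critical points. -/
theorem IsMorseOn.finite_critOn (hh : IsMorseOn E S h) (hS : IsSubmanifold E S)
    (hc : IsCompact S) : (critOn E S h).Finite := by
  have key : ∀ p : M, ∃ U ∈ 𝓝 p, p ∈ S → ∀ q ∈ U, q ∈ critOn E S h → q = p := by
    intro p
    by_cases hpS : p ∈ S
    swap
    · exact ⟨univ, univ_mem, fun h => absurd h hpS⟩
    obtain ⟨σ⟩ := hS p hpS
    have hcoords : Tendsto σ.coords (𝓝 p) (𝓝 0) := by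
      simpa [σ.coords_self] using (continuousAt_coords (σ := σ) σ.mem_source).tendsto
    have hsm := (contDiffOn_comp_loc hh.1).contDiffAt (σ.isOpen_dom.mem_nhds σ.zero_mem_dom)
    by_cases hp : p ∈ critOn E S h
    · have h0 := (mem_critOn_iff hh.1 hp.1 σ.mem_source).1 hp
      rw [σ.coords_self] at h0
      -- The lower bound c ‖u‖ ≤ ‖dh(u)‖ excludes other critical points nearby.
      obtain ⟨c, hc, hev⟩ := exists_norm_le_norm_fderiv (ρ := 0) hsm
        (Eventually.of_forall fun u => by simpa using h0)
        fun u hu => hh.hess_injective hp σ _ hu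
      refine ⟨_, inter_mem (hcoords.eventually hev)
        (σ.chart.open_source.mem_nhds σ.mem_source), fun _ q hq hqc => ?_⟩
      have h1 : c * ‖σ.coords q - (0 : σ.Coord →L[ℝ] σ.Coord) (σ.coords q)‖ ≤
        ‖fderiv ℝ (h ∘ σ.loc) (σ.coords q)‖ := hq.1
      rw [(mem_critOn_iff hh.1 hqc.1 hq.2).1 hqc] at h1
      have h2 : σ.coords q = 0 := by
        rw [← norm_eq_zero]
        refine le_antisymm ?_ (norm_nonneg _)
        simp only [zero_apply, sub_zero, norm_zero] at h1
        nlinarith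
      rw [← loc_coords hqc.1 hq.2, h2, σ.loc_zero]
    · have h0 : fderiv ℝ (h ∘ σ.loc) 0 ≠ 0 := fun h0 => hp
        ((mem_critOn_iff hh.1 hpS σ.mem_source).2 (by rwa [σ.coords_self]))
      have hcont : ContinuousAt (fderiv ℝ (h ∘ σ.loc)) 0 :=
        (hsm.fderiv_right (m := ∞) (by simp)).continuousAt
      refine ⟨_, inter_mem (hcoords.eventually (hcont.eventually_ne h0))
        (σ.chart.open_source.mem_nhds σ.mem_source), fun _ q hq hqc => ?_⟩
      exact absurd ((mem_critOn_iff hh.1 hqc.1 hq.2).1 hqc) hq.1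
  choose U hU hUq using key
  obtain ⟨t, ht, htS⟩ := hc.elim_nhds_subcover U fun p _ => hU p
  refine t.finite_toSet.subset fun q hq => ?_
  obtain ⟨p, hp, hqp⟩ := mem_iUnion₂.1 (htS hq.1)
  rw [hUq p (ht p hp) q hqp hq]
  exact hp

end Morse

end Systems

/-! ### The flow of a Morse–Bott function on the ambient manifold as a gradient system. -/

section MorseBottSystem

variable [FiniteDimensional ℝ E] [IsManifold 𝓘(ℝ, E) ∞ M]

open SliceChart

/-- The section given by the differential of a parametrization is smooth. -/
theorem contMDiffAt_mfderiv_apply {F : Type*} [NormedAddCommGroup F] [NormedSpace ℝ F]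
    {D : Set F} (hD : IsOpen D) {κ : F → M} (hκ : ContMDiffOn 𝓘(ℝ, F) 𝓘(ℝ, E) ∞ κ D) {z : F}
    (hz : z ∈ D) (a : F) :
    ContMDiffAt 𝓘(ℝ, F) 𝓘(ℝ, E).tangent ∞
      (fun z => (⟨κ z, mfderiv 𝓘(ℝ, F) 𝓘(ℝ, E) κ z a⟩ : TangentBundle 𝓘(ℝ, E) M)) z := by
  have h1 := hκ.contMDiffOn_tangentMapWithin (m := ∞) (by simp) hD.uniqueMDiffOn
  have h2 : ContMDiffAt 𝓘(ℝ, F) 𝓘(ℝ, F).tangent ∞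
      (fun z : F => (⟨z, a⟩ : TangentBundle 𝓘(ℝ, F) F)) z :=
    contMDiffAt_vectorSpace_iff_contDiffAt.2 contDiffAt_const
  have hn : (Bundle.TotalSpace.proj ⁻¹' D : Set (TangentBundle 𝓘(ℝ, F) F)) ∈
      𝓝 (⟨z, a⟩ : TangentBundle 𝓘(ℝ, F) F) :=
    (hD.preimage (FiberBundle.continuous_proj F _)).mem_nhds hz
  have h3 := ((h1 ⟨z, a⟩ hz).contMDiffAt hn).comp z h2
  refine h3.congr_of_eventuallyEq ?_
  filter_upwards [hD.mem_nhds hz] with w hw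
  exact (tangentMapWithin_eq_tangentMap (p := (⟨w, a⟩ : TangentBundle 𝓘(ℝ, F) F))
    (hD.uniqueMDiffOn w hw)
    (((hκ w hw).contMDiffAt (hD.mem_nhds hw)).mdifferentiableAt (by simp))).symm

/-- A Riemannian metric on `M`, as a metric on the submanifold `M` of `M`. -/
def MetricOn.ofRiemannian
    (g : Bundle.ContMDiffRiemannianMetric 𝓘(ℝ, E) ∞ E (TangentSpace 𝓘(ℝ, E) : M → Type u)) :
    MetricOn E (univ : Set M) where
  inner := g.inner
  symm x _ _ v _ v' _ := g.symm x v v'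
  pos x _ _ v _ hv := g.pos x v hv
  smooth x _ σ a b := by
    set D : Set σ.dir := σ.equiv.symm ⁻¹' σ.dom with hD
    have hDo : IsOpen D := σ.isOpen_dom.preimage σ.equiv.symm.continuous
    have h0 : (0 : σ.dir) ∈ D := by simpa [hD] using σ.zero_mem_dom
    have hsm : ContMDiffOn 𝓘(ℝ, σ.dir) 𝓘(ℝ, E) ∞ σ.param D := by
      intro z hz
      rw [σ.param_eq]
      exact ((contMDiffAt_loc (σ := σ) hz).comp z
        σ.equiv.symm.contDiff.contMDiff.contMDiffAt).contMDiffWithinAt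
    have hb := (hsm 0 h0).contMDiffAt (hDo.mem_nhds h0)
    have h1 : ContMDiffAt 𝓘(ℝ, σ.dir) (𝓘(ℝ, E).prod 𝓘(ℝ)) ∞
        (fun z => Bundle.TotalSpace.mk' ℝ (E := Bundle.Trivial M ℝ) (σ.param z)
          (g.inner (σ.param z) (mfderiv 𝓘(ℝ, σ.dir) 𝓘(ℝ, E) σ.param z a)
            (mfderiv 𝓘(ℝ, σ.dir) 𝓘(ℝ, E) σ.param z b))) 0 := by
      apply ContMDiffAt.clm_bundle_apply₂ (F₁ := E) (F₂ := E)
      · exact (g.contMDiff _).comp 0 hb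
      · exact contMDiffAt_mfderiv_apply hDo hsm h0 a
      · exact contMDiffAt_mfderiv_apply hDo hsm h0 b
    simp only [Bundle.contMDiffAt_totalSpace] at h1
    exact h1.2.contDiffAt

/-- The slice chart of `M` given by a chart. -/
@[reducible] def SliceChart.ofChart (e : OpenPartialHomeomorph M E)
    (he : e ∈ IsManifold.maximalAtlas 𝓘(ℝ, E) ∞ M) {p : M} (hp : p ∈ e.source) :
    SliceChart (E := E) (univ : Set M) p where
  chart := e
  mem_maximalAtlas := he
  mem_source := hp
  dir := ⊤
  mem_iff _ _ := by simp

theorem isSubmanifold_univ : IsSubmanifold E (univ : Set M) := fun p _ =>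
  ⟨SliceChart.ofChart (chartAt E p) (IsManifold.chart_mem_maximalAtlas p) (mem_chart_source E p)⟩

theorem SliceChart.dloc_surjective {p : M} (σ : SliceChart (E := E) (univ : Set M) p)
    (hσ : σ.dir = ⊤) {z : σ.Coord} (hz : z ∈ σ.dom) : Function.Surjective (σ.dloc z) := by
  intro v
  have h : σ.dchart (σ.loc z) v ∈ σ.dir := hσ ▸ Submodule.mem_top
  refine ⟨σ.equiv.symm ⟨_, h⟩, dchart_injective (loc_mem_source hz) ?_⟩
  rw [dchart_dloc hz]
  exact congrArg Subtype.val (σ.equiv.apply_symm_apply ⟨_, h⟩)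

theorem fderiv_comp_loc {S : Set M} {p : M} (σ : SliceChart (E := E) S p) {f : M → ℝ}
    (hf : ContMDiff 𝓘(ℝ, E) 𝓘(ℝ, ℝ) ∞ f) {z : σ.Coord} (hz : z ∈ σ.dom) (a : σ.Coord) :
    fderiv ℝ (f ∘ σ.loc) z a = (mfderiv 𝓘(ℝ, E) 𝓘(ℝ, ℝ) f (σ.loc z) : E → ℝ) (σ.dloc z a) := by
  have h1 := (HasMFDerivAt.comp z ((hf _).mdifferentiableAt (by simp)).hasMFDerivAt
    (hasMFDerivAt_loc hz)).mfderiv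
  rw [mfderiv_eq_fderiv] at h1
  exact congrArg (fun L : σ.Coord →L[ℝ] ℝ => L a) h1

section

variable {f : M → ℝ}

theorem SliceChart.diff_coord (hf : ContMDiff 𝓘(ℝ, E) 𝓘(ℝ, ℝ) ∞ f) {S : Set M} {p : M}
    (σ : SliceChart (E := E) S p) (v : σ.tangentSpace) :
    σ.diff f (σ.coord v) = (mfderiv 𝓘(ℝ, E) 𝓘(ℝ, ℝ) f p : E → ℝ) v.1 := by
  have hdom := coords_mem_dom σ.base_mem σ.mem_source
  obtain ⟨a, ha, h1⟩ := exists_dloc_eq σ.mem_source σ (h := f)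
    (((contDiffOn_comp_loc (smoothOn_of_contMDiff hf S)).contDiffAt
      (σ.isOpen_dom.mem_nhds hdom)).differentiableAt (by simp)) v
  rw [h1, fderiv_comp_loc σ hf hdom, ← ha, loc_coords σ.base_mem σ.mem_source]

variable (g : Bundle.ContMDiffRiemannianMetric 𝓘(ℝ, E) ∞ E (TangentSpace 𝓘(ℝ, E) : M → Type u))

/-- The bridge that makes the whole theory available for f. In the backward direction a chart with
direction `⊤` is used, for which every vector is tangent to the slice. -/
theorem isGradientLine_iff (hf : ContMDiff 𝓘(ℝ, E) 𝓘(ℝ, ℝ) ∞ f) {x : ℝ → M} :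
    IsGradientLine g f x ↔ IsMorseLine (MetricOn.ofRiemannian g) f x := by
  refine and_congr_right fun _ => ⟨fun H => ⟨fun s => mem_univ _, fun s σ v => ?_⟩, fun H s v => ?_⟩
  · rw [SliceChart.diff_coord hf]
    exact H s v.1
  · set σ := SliceChart.ofChart (chartAt E (x s)) (IsManifold.chart_mem_maximalAtlas _)
      (mem_chart_source E (x s))
    have h1 := H.2 s σ ⟨v, show _ ∈ (⊤ : Submodule ℝ E) from Submodule.mem_top⟩
    rw [SliceChart.diff_coord hf] at h1
    exact h1

theorem critOn_univ (hf : ContMDiff 𝓘(ℝ, E) 𝓘(ℝ, ℝ) ∞ f) : critOn E univ f = crit E f := by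
  ext p
  set σ := SliceChart.ofChart (chartAt E p) (IsManifold.chart_mem_maximalAtlas p)
      (mem_chart_source E p)
  have hdom := coords_mem_dom (mem_univ p) σ.mem_source
  rw [mem_critOn_iff (smoothOn_of_contMDiff hf univ) (mem_univ p) σ.mem_source]
  constructor
  · intro h0
    change (mfderiv 𝓘(ℝ, E) 𝓘(ℝ, ℝ) f p : E →L[ℝ] ℝ) = 0
    ext v
    obtain ⟨a, rfl⟩ := σ.dloc_surjective rfl hdom v
    have h1 := fderiv_comp_loc σ hf hdom a
    rw [h0, loc_coords (mem_univ p) σ.mem_source] at h1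
    exact h1.symm
  · intro h0
    ext a
    rw [fderiv_comp_loc σ hf hdom, loc_coords (mem_univ p) σ.mem_source,
      show mfderiv 𝓘(ℝ, E) 𝓘(ℝ, ℝ) f p = 0 from h0]
    rfl


/-- The manifold derivative at 0 is read in the preferred chart at p, the same identification of the
tangent space with E as in `hessian`. -/
theorem SliceChart.dloc_zero {S : Set M} {p : M} (σ : SliceChart (E := E) S p) :
    σ.dloc 0 = fderiv ℝ (fun z => chartAt E p (σ.loc z)) 0 := by
  have h1 := (contMDiffAt_loc σ.zero_mem_dom).mdifferentiableAt (by simp)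
  unfold dloc
  rw [h1.mfderiv]
  simp only [mfld_simps, fderivWithin_univ]
  rw [σ.loc_zero]
  rfl

/-- The second derivative of the coordinate change occurs only composed with df, which vanishes at
the critical point. Null vectors of the Hessian therefore do not depend on the chart. -/
theorem SliceChart.fderiv_fderiv_comp_loc (hf : ContMDiff 𝓘(ℝ, E) 𝓘(ℝ, ℝ) ∞ f) {p : M}
    (hp : p ∈ crit E f) (σ : SliceChart (E := E) (univ : Set M) p) (hσ : σ.dir = ⊤)
    (w : σ.Coord) (hw : fderiv ℝ (fderiv ℝ (f ∘ σ.loc)) 0 w = 0) :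
    hessian f p (σ.dloc 0 w) = 0 := by
  set e := chartAt E p with he
  set Fe : E → ℝ := f ∘ e.symm with hFe
  set κ : σ.Coord → E := fun z => e (σ.loc z) with hκ
  have hκ0 : κ 0 = e p := by simp [hκ, σ.loc_zero]
  have hloc : Tendsto σ.loc (𝓝 0) (𝓝 p) := by
    simpa [σ.loc_zero] using (continuousAt_loc σ.zero_mem_dom).tendsto
  have hsrc : ∀ᶠ z in 𝓝 (0 : σ.Coord), z ∈ σ.dom ∧ σ.loc z ∈ e.source :=
    Filter.Eventually.and (σ.isOpen_dom.mem_nhds σ.zero_mem_dom)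
      (hloc.eventually (e.open_source.mem_nhds (mem_chart_source E p)))
  have heA : e ∈ IsManifold.maximalAtlas 𝓘(ℝ, E) ∞ M := IsManifold.chart_mem_maximalAtlas p
  have hκs : ∀ z, z ∈ σ.dom → σ.loc z ∈ e.source → ContDiffAt ℝ ∞ κ z := fun z h1 h2 =>
    ((contMDiffAt_of_mem_maximalAtlas heA h2).comp z (contMDiffAt_loc h1)).contDiffAt
  have hFes : ∀ v ∈ e.target, ContDiffAt ℝ ∞ Fe v := fun v hv =>
    ((hf _).comp v (contMDiffAt_symm_of_mem_maximalAtlas heA hv)).contDiffAt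
  have hcomp : ∀ z, σ.loc z ∈ e.source → (f ∘ σ.loc) z = Fe (κ z) := fun z hz => by
    simp [hFe, hκ, e.left_inv hz]
  have hder : fderiv ℝ (f ∘ σ.loc) =ᶠ[𝓝 0] fun z => (fderiv ℝ Fe (κ z)).comp (fderiv ℝ κ z) := by
    filter_upwards [hsrc.eventually_nhds] with z hz
    have h1 : f ∘ σ.loc =ᶠ[𝓝 z] Fe ∘ κ := hz.mono fun z' hz' => hcomp z' hz'.2
    have h2 := hz.self_of_nhds
    rw [h1.fderiv_eq]
    exact fderiv_comp z ((hFes _ (e.map_source h2.2)).differentiableAt (by simp))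
      ((hκs z h2.1 h2.2).differentiableAt (by simp))
  have h0 := hsrc.self_of_nhds
  have hdκ : fderiv ℝ κ 0 = σ.dloc 0 := σ.dloc_zero.symm
  have hsurj := σ.dloc_surjective hσ σ.zero_mem_dom
  have hcrit : fderiv ℝ Fe (κ 0) = 0 := by
    ext v
    obtain ⟨a, rfl⟩ := hsurj v
    have h1 := congrArg (fun L : σ.Coord →L[ℝ] ℝ => L a) hder.self_of_nhds
    simp only [hdκ, ContinuousLinearMap.comp_apply] at h1
    rw [← h1, fderiv_comp_loc σ hf σ.zero_mem_dom, σ.loc_zero,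
      show mfderiv 𝓘(ℝ, E) 𝓘(ℝ, ℝ) f p = 0 from hp]
    rfl
  have hmem : κ 0 ∈ e.target := e.map_source h0.2
  have h1 : HasFDerivAt (fderiv ℝ Fe) (fderiv ℝ (fderiv ℝ Fe) (κ 0)) (κ 0) :=
    (((hFes _ hmem).fderiv_right (m := ∞) (by simp)).differentiableAt (by simp)).hasFDerivAt
  have h2 : HasFDerivAt κ (fderiv ℝ κ 0) 0 :=
    ((hκs 0 h0.1 h0.2).differentiableAt (by simp)).hasFDerivAt
  have h3 : HasFDerivAt (fderiv ℝ κ) (fderiv ℝ (fderiv ℝ κ) 0) 0 :=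
    (((hκs 0 h0.1 h0.2).fderiv_right (m := ∞) (by simp)).differentiableAt (by simp)).hasFDerivAt
  have h4 := (HasFDerivAt.comp (g := fderiv ℝ Fe) (f := κ) (0 : σ.Coord) h1 h2).clm_comp h3
  have h5 : fderiv ℝ (fderiv ℝ (f ∘ σ.loc)) 0 = _ := hder.fderiv_eq.trans h4.fderiv
  rw [h5] at hw
  change (fderiv ℝ (fderiv ℝ Fe) (e p) : E →L[ℝ] E →L[ℝ] ℝ) (σ.dloc 0 w) = 0
  rw [← hκ0]
  ext v
  obtain ⟨a, rfl⟩ := hsurj v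
  have h6 := congrArg (fun L : σ.Coord →L[ℝ] ℝ => L a) hw
  simpa [hcrit, hdκ] using h6

/-- A slice chart of the critical set, used as a full chart of M, makes the critical set linear.
With ρ the orthogonal projection onto the slice directions T, the points ρ u near 0 are critical,
and by the Morse–Bott condition a null vector u − ρ u lies both in T and in its orthogonal
complement. -/
theorem IsMorseBott.isLojasiewicz [CompactSpace M] (hf : IsMorseBott E f) :
    IsLojasiewicz (MetricOn.ofRiemannian g) f where
  submanifold := isSubmanifold_univ
  compact := isCompact_univ
  smooth := smoothOn_of_contMDiff hf.1 univ
  lojasiewicz p hp := by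
    rw [critOn_univ hf.1] at hp
    obtain ⟨σ⟩ := hf.2.1 p hp
    set σ' := SliceChart.ofChart σ.chart σ.mem_maximalAtlas σ.mem_source with hσ'
    have hsm := smoothOn_of_contMDiff hf.1 (univ : Set M)
    set T : Submodule ℝ σ'.Coord := σ.dir.comap σ'.incl.toLinearMap with hT
    refine IsCompactGradient.exists_rate_of_local ⟨isSubmanifold_univ, isCompact_univ, hsm⟩ σ'
      (exists_abs_sub_le_sq_norm_fderiv (ρ := T.starProjection)
        ((contDiffOn_comp_loc hsm).contDiffAt (σ'.isOpen_dom.mem_nhds σ'.zero_mem_dom)) ?_ ?_)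
    · have hρ0 : Tendsto T.starProjection (𝓝 0) (𝓝 0) := by
        simpa using T.starProjection.continuous.tendsto 0
      filter_upwards [hρ0.eventually (σ'.isOpen_dom.mem_nhds σ'.zero_mem_dom)] with u hu
      have hmem : σ'.loc (T.starProjection u) ∈ crit E f := by
        rw [σ.mem_iff _ (loc_mem_source (σ := σ') hu : σ'.loc _ ∈ σ.chart.source)]
        have h1 : σ.chart (σ'.loc (T.starProjection u)) = σ.chart p + σ'.incl (T.starProjection u) :=
          chart_loc hu
        rw [h1, add_sub_cancel_left]
        exact T.starProjection_apply_mem u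
      ext a
      rw [fderiv_comp_loc σ' hf.1 hu,
        show mfderiv 𝓘(ℝ, E) 𝓘(ℝ, ℝ) f (σ'.loc (T.starProjection u)) = 0 from hmem]
      rfl
    · intro u hu
      have h1 := σ'.fderiv_fderiv_comp_loc hf.1 hp rfl _ hu
      have h2 := (hf.2.2 p hp σ _).2 h1
      have h3 := dchart_dloc σ'.zero_mem_dom (u - T.starProjection u)
      rw [σ'.loc_zero] at h3
      have h4 : σ'.incl (u - T.starProjection u) ∈ σ.dir := h3 ▸ h2
      have h5 := (Submodule.mem_orthogonal T _).1 (T.sub_starProjection_mem_orthogonal u) _ h4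
      exact inner_self_eq_zero.1 h5

theorem apply_eq_of_isMorseLine (hf : ContMDiff 𝓘(ℝ, E) 𝓘(ℝ, ℝ) ∞ f) {g₀ : MetricOn E (crit E f)}
    {h : M → ℝ} {y : ℝ → M} (hy : IsMorseLine g₀ h y) (s t : ℝ) : f (y s) = f (y t) := by
  have hd : ∀ r, HasFDerivAt (fun r => f (y r)) (0 : ℝ →L[ℝ] ℝ) r := by
    intro r
    have h1 := (HasMFDerivAt.comp r ((hf _).mdifferentiableAt (by simp)).hasMFDerivAt
      ((hy.1 r).mdifferentiableAt (by simp)).hasMFDerivAt).hasFDerivAt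
    rw [show mfderiv 𝓘(ℝ, E) 𝓘(ℝ, ℝ) f (y r) = 0 from hy.2.1 r] at h1
    exact h1
  exact is_const_of_fderiv_eq_zero (𝕜 := ℝ) (fun r => (hd r).differentiableAt)
    (fun r => (hd r).fderiv) s t

end

/-- Near a regular point h decays at a positive rate, whereas constant lines at critical points have
rate zero. -/
theorem IsCompactGradient.isClosed_critOn [T2Space M] {S : Set M} {g₀ : MetricOn E S} {h : M → ℝ}
    (H : IsCompactGradient g₀ h) : IsClosed (critOn E S h) := by
  rw [← closure_subset_iff_isClosed]
  intro p hp
  have hpS : p ∈ S := closure_minimal (fun q hq => hq.1) H.isClosed hp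
  by_contra hpc
  obtain ⟨c, hc, hev⟩ := H.exists_rate hpS hpc
  obtain ⟨q, hq, hqc⟩ := mem_closure_iff_nhds.1 hp _ hev
  have := hq (fun _ => q) 0 ((H.isMorseLine_const hqc).morseAt 0) rfl
  simp only [deriv_const, neg_zero] at this
  linarith

end MorseBottSystem

/-! ### Broken flow lines as lists, which can be built from the end. -/

section BrokenLists

/-- Positions in a flattened list are ordered in the same way as by `finSigmaFinEquiv`, on which
`BrokenFlowLine.index` rests. -/
theorem getElem?_flatMap {α β : Type*} (F : α → List β) (P : List α) (j : ℕ) (hj : j < P.length)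
    (i : ℕ) (hi : i < (F P[j]).length) :
    (P.flatMap F)[∑ a : Fin j, (F (P[(a : ℕ)]'(a.2.trans hj))).length + i]? = some ((F P[j])[i]) := by
  induction P generalizing j with
  | nil => simp at hj
  | cons v P ih =>
    rw [List.flatMap_cons]
    cases j with
    | zero =>
      simp only [List.getElem_cons_zero] at hi
      simp [List.getElem?_append_left hi, List.getElem?_eq_getElem hi]
    | succ j =>
      simp only [List.getElem_cons_succ] at hi
      rw [Fin.sum_univ_succ]
      simp only [Fin.val_zero, List.getElem_cons_zero, Fin.val_succ, List.getElem_cons_succ]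
      rw [List.getElem?_append_right (by omega), ← ih j (by simpa using hj) hi]
      congr 1
      omega

namespace CascadeData

variable {M : Type w}

/-- The cascades, together with the times to the next cascade. -/
def entries (v : CascadeData M) : List ((ℝ → M) × EReal) :=
  List.ofFn fun k : Fin v.num =>
    (v.cascade k, if (k : ℕ) + 1 < v.num then ((v.time k : ℝ) : EReal) else ⊤)

theorem length_entries (v : CascadeData M) : v.entries.length = v.num := List.length_ofFn

theorem entries_zero (y : ℝ → M) : (zero y).entries = [] := rfl

theorem entries_cascades {m : ℕ} (X : Fin (m + 1) → ℝ → M) (T : Fin m → ℝ) :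
    (cascades m X T).entries = List.ofFn fun k : Fin (m + 1) =>
      (X k, if hk : (k : ℕ) < m then ((T ⟨k, hk⟩ : ℝ) : EReal) else ⊤) := by
  change (List.ofFn fun k : Fin (m + 1) => (X k, if (k : ℕ) + 1 < m + 1 then
    (((if hk : (k : ℕ) < m then T ⟨k, hk⟩ else 0) : ℝ) : EReal) else ⊤)) = _
  congr 1
  funext k
  by_cases hk : (k : ℕ) < m <;> simp [hk]

theorem entries_single (x : Fin 1 → ℝ → M) (t : Fin 0 → ℝ) :
    (cascades 0 x t).entries = [(x 0, ⊤)] := by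
  simp [entries_cascades]

theorem entries_cons {m : ℕ} (x : ℝ → M) (t : ℝ) (X : Fin (m + 1) → ℝ → M) (T : Fin m → ℝ) :
    (cascades (m + 1) (Fin.cons x X) (Fin.cons t T)).entries =
      (x, (t : EReal)) :: (cascades m X T).entries := by
  rw [entries_cascades, entries_cascades, List.ofFn_succ]
  refine congrArg₂ List.cons (by simp) (congrArg List.ofFn (funext fun i => ?_))
  · by_cases hi : (i : ℕ) < m
    · have h1 : ((i.succ : Fin (m + 2)) : ℕ) < m + 1 := by simpa using hi
      rw [dif_pos hi, dif_pos h1, Fin.cons_succ,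
        show (⟨((i.succ : Fin (m + 2)) : ℕ), h1⟩ : Fin (m + 1)) = Fin.succ ⟨i, hi⟩ from rfl,
        Fin.cons_succ]
    · have h1 : ¬ ((i.succ : Fin (m + 2)) : ℕ) < m + 1 := by simpa using hi
      rw [dif_neg hi, dif_neg h1, Fin.cons_succ]

end CascadeData

variable [IsManifold 𝓘(ℝ, E) ∞ M]
  {g : Bundle.ContMDiffRiemannianMetric 𝓘(ℝ, E) ∞ E (TangentSpace 𝓘(ℝ, E) : M → Type u)}
  {f : M → ℝ} {g₀ : MetricOn E (crit E f)} {h : M → ℝ} {c d : M}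

variable (g f g₀ h) in
/-- A list of flow lines with cascades which form a broken flow line with cascades. -/
def IsBroken : M → List (CascadeData M) → M → Prop
  | c, [], d => c = d
  | c, v :: P, d => ∃ c₁ ∈ critOn E (crit E f) h, IsFlowLine g f g₀ h c c₁ v ∧ IsBroken c₁ P d

theorem IsBroken.exists_points {P : List (CascadeData M)} (H : IsBroken g f g₀ h c P d)
    (hc : c ∈ critOn E (crit E f) h) : ∃ pt : Fin (P.length + 1) → M,
      (∀ j, pt j ∈ critOn E (crit E f) h) ∧ pt 0 = c ∧ pt (Fin.last P.length) = d ∧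
      ∀ j : Fin P.length, IsFlowLine g f g₀ h (pt j.castSucc) (pt j.succ) P[(j : ℕ)] := by
  induction P generalizing c with
  | nil => exact ⟨fun _ => c, fun _ => hc, rfl, H, fun j => j.elim0⟩
  | cons v P ih =>
    obtain ⟨c₁, hc₁, hv, hP⟩ := H
    obtain ⟨pt, hpt, h0, hl, hf⟩ := ih hP hc₁
    refine ⟨Fin.cons c pt, Fin.cases hc hpt, rfl, ?_, Fin.cases ?_ fun j => ?_⟩
    · rw [← hl]
      exact Fin.cons_succ (α := fun _ => M) c pt (Fin.last P.length)
    · change IsFlowLine g f g₀ h c (pt 0) v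
      rw [h0]
      exact hv
    · exact hf j

/-- Confines the dependent indexing to one place: from here on the cascades and times of the limit
are read off from a flat list. -/
theorem IsBroken.exists_brokenFlowLine {P : List (CascadeData M)} (H : IsBroken g f g₀ h c P d)
    (hc : c ∈ critOn E (crit E f) h) (hP : P ≠ []) : ∃ b : BrokenFlowLine g f g₀ h c d,
      (∀ j : Fin b.length, P[(j : ℕ)]? = some (b.piece j)) ∧
      b.total = (P.flatMap CascadeData.entries).length ∧
      ∀ lam : Fin b.total, (P.flatMap CascadeData.entries)[(lam : ℕ)]? = some (b.cascade lam, b.time lam) := by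
  obtain ⟨pt, hpt, h0, hl, hf⟩ := H.exists_points hc
  set b : BrokenFlowLine g f g₀ h c d :=
    ⟨P.length, List.length_pos_iff.2 hP, pt, fun j => P[(j : ℕ)], hpt, h0, hl, hf⟩ with hb
  refine ⟨b, fun j => List.getElem?_eq_getElem j.2, ?_, fun lam => ?_⟩
  · simp only [BrokenFlowLine.total, List.length_flatMap, CascadeData.length_entries]
    exact Fin.sum_univ_fun_getElem P CascadeData.num
  · have hlam : lam = finSigmaFinEquiv (b.index lam) := (Equiv.apply_symm_apply _ _).symm
    have hval : (lam : ℕ) = _ := (congrArg Fin.val hlam).trans (finSigmaFinEquiv_apply _)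
    have hi : ((b.index lam).2 : ℕ) < (P[((b.index lam).1 : ℕ)]).entries.length := by
      rw [CascadeData.length_entries]
      exact (b.index lam).2.2
    have key := getElem?_flatMap CascadeData.entries P (b.index lam).1 (b.index lam).1.2
      (b.index lam).2 hi
    simp only [CascadeData.length_entries] at key
    rw [hval]
    refine key.trans ?_
    congr 1
    simp only [CascadeData.entries, List.getElem_ofFn]
    rfl

variable (g f g₀ h) in
/-- A list of flow lines with cascades which is a broken flow line, except that the limit `p` at
`-∞` of the first cascade of its first piece is not required to lie on an unstable manifold. -/
def IsOpenBroken (p : M) (v : CascadeData M) (P : List (CascadeData M)) (d : M) : Prop :=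
  ∃ (m : ℕ) (X : Fin (m + 1) → ℝ → M) (T : Fin m → ℝ), v = .cascades m X T ∧
    (∀ k, IsGradientLine g f (X k) ∧ ¬ ∃ p, ∀ s, X k s = p) ∧ Tendsto (X 0) atBot (𝓝 p) ∧
    (∀ k : Fin m, 0 ≤ T k ∧ ∃ y : ℝ → M, IsMorseLine g₀ h y ∧
      Tendsto (X k.castSucc) atTop (𝓝 (y 0)) ∧ Tendsto (X k.succ) atBot (𝓝 (y (T k)))) ∧
    ∃ c₁ ∈ critOn E (crit E f) h,
      (∃ q ∈ stableManifold g₀ h c₁, Tendsto (X (Fin.last m)) atTop (𝓝 q)) ∧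
      IsBroken g f g₀ h c₁ P d

theorem IsOpenBroken.close {p : M} {v : CascadeData M} {P : List (CascadeData M)}
    (H : IsOpenBroken g f g₀ h p v P d) (hp : p ∈ unstableManifold g₀ h c) :
    IsBroken g f g₀ h c (v :: P) d := by
  obtain ⟨m, X, T, rfl, hX, hX0, hT, c₁, hc₁, hl, hP⟩ := H
  exact ⟨c₁, hc₁, ⟨hX, ⟨p, hp, hX0⟩, hl, hT⟩, hP⟩

/-- A new piece with one cascade is opened in front of P, so the time to the next cascade is
infinite; `IsOpenBroken.cons` instead extends the first piece and has a finite time. -/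
theorem IsBroken.single {P : List (CascadeData M)} (H : IsBroken g f g₀ h c P d)
    (hc : c ∈ critOn E (crit E f) h) {x : ℝ → M} {p q : M} (hx : IsGradientLine g f x)
    (hn : ¬ ∃ p, ∀ s, x s = p) (hp : Tendsto x atBot (𝓝 p)) (hq : Tendsto x atTop (𝓝 q))
    (hqs : q ∈ stableManifold g₀ h c) :
    ∃ v, IsOpenBroken g f g₀ h p v P d ∧ v.entries = [(x, ⊤)] ∧ ∀ z, v ≠ .zero z :=
  ⟨.cascades 0 (fun _ => x) Fin.elim0, ⟨0, _, _, rfl, fun _ => ⟨hx, hn⟩, hp, fun k => k.elim0,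
    c, hc, ⟨q, hqs, hq⟩, H⟩, CascadeData.entries_single _ _, fun z hz => by cases hz⟩

theorem IsOpenBroken.cons {p : M} {v : CascadeData M} {P : List (CascadeData M)}
    (H : IsOpenBroken g f g₀ h p v P d) {x : ℝ → M} {p' : M} (hx : IsGradientLine g f x)
    (hn : ¬ ∃ p, ∀ s, x s = p) (hp : Tendsto x atBot (𝓝 p')) {t : ℝ} (ht : 0 ≤ t) {y : ℝ → M}
    (hy : IsMorseLine g₀ h y) (hxy : Tendsto x atTop (𝓝 (y 0))) (hyt : y t = p) :
    ∃ v', IsOpenBroken g f g₀ h p' v' P d ∧ v'.entries = (x, (t : EReal)) :: v.entries ∧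
      ∀ z, v' ≠ .zero z := by
  obtain ⟨m, X, T, rfl, hX, hX0, hT, c₁, hc₁, hl, hP⟩ := H
  refine ⟨.cascades (m + 1) (Fin.cons x X) (Fin.cons t T), ⟨m + 1, _, _, rfl,
    Fin.cases ⟨hx, hn⟩ hX, hp, Fin.cases ?_ fun k => ?_, c₁, hc₁, ?_, hP⟩,
    CascadeData.entries_cons x t X T, fun z hz => by cases hz⟩
  · exact hl
  · refine ⟨ht, y, hy, hxy, ?_⟩
    change Tendsto (X 0) atBot (𝓝 (y t))
    rwa [hyt]
  · exact hT k

end BrokenLists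

/-! ### Limits of cascades, assembled piece by piece. -/

section Limits

variable [FiniteDimensional ℝ E] [IsManifold 𝓘(ℝ, E) ∞ M]

section Ends

/-- Replaces ends at −∞ by points at finite times, as `IsLojasiewicz.exists_chain` needs. -/
theorem exists_times_atBot {Y : Type*} [TopologicalSpace Y] [FirstCountableTopology Y]
    {l : Filter ℕ} (hl : l ≤ atTop) {y : ℕ → ℝ → Y} {a : ℕ → Y} {p : Y}
    (hy : ∀ n, Tendsto (y n) atBot (𝓝 (a n))) (ha : Tendsto a l (𝓝 p)) :
    ∃ r : ℕ → ℝ, Tendsto (fun n => y n (r n)) l (𝓝 p) ∧ Tendsto r l atBot := by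
  obtain ⟨r, hr, hr'⟩ := exists_tendsto_diagonal hl (q := p) (a := y)
    (Q := fun j _ x => x ≤ -(j : ℝ))
    (fun j j' n x hjj' hx => hx.trans (neg_le_neg (Nat.cast_le.2 hjj'))) (fun U hU j => by
      filter_upwards [ha.eventually (interior_mem_nhds.2 hU)] with n hn
      exact (((hy n).eventually (isOpen_interior.mem_nhds hn)).and
        (eventually_le_atBot (-(j : ℝ)))).exists.imp fun x hx => ⟨interior_subset hx.1, hx.2⟩)
  refine ⟨r, hr, tendsto_atBot.2 fun b => ?_⟩
  obtain ⟨j, hj⟩ := exists_nat_ge (-b)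
  exact (hr' j).mono fun n hn => hn.trans (by linarith)

theorem exists_times_atTop {Y : Type*} [TopologicalSpace Y] [FirstCountableTopology Y]
    {l : Filter ℕ} (hl : l ≤ atTop) {y : ℕ → ℝ → Y} {a : ℕ → Y} {p : Y}
    (hy : ∀ n, Tendsto (y n) atTop (𝓝 (a n))) (ha : Tendsto a l (𝓝 p)) :
    ∃ r : ℕ → ℝ, Tendsto (fun n => y n (r n)) l (𝓝 p) ∧ Tendsto r l atTop := by
  obtain ⟨r, hr, hr'⟩ := exists_times_atBot hl (y := fun n s => y n (-s))
    (fun n => (hy n).comp tendsto_neg_atBot_atTop) ha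
  exact ⟨fun n => -r n, hr, tendsto_neg_atBot_atTop.comp hr'⟩

variable {S : Set M} {g₀ : MetricOn E S} {h : M → ℝ} [CompactSpace M] [T2Space M]
  [FirstCountableTopology M] {𝒰 : Ultrafilter ℕ} {y : ℕ → ℝ → M}

/-- Flow lines whose ends converge converge to a chain of flow lines. -/
theorem IsLojasiewicz.exists_chain_of_ends (H : IsLojasiewicz g₀ h)
    (h𝒰 : (𝒰 : Filter ℕ) ≤ atTop) (hy : ∀ n, IsMorseLine g₀ h (y n)) {a b : ℕ → M} {p q : M}
    (hp : p ∈ critOn E S h) (hq : q ∈ critOn E S h)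
    (ha : ∀ n, Tendsto (y n) atBot (𝓝 (a n))) (hb : ∀ n, Tendsto (y n) atTop (𝓝 (b n)))
    (hap : Tendsto a 𝒰 (𝓝 p)) (hbq : Tendsto b 𝒰 (𝓝 q)) :
    ∃ L, IsChain g₀ h 𝒰 y p L q := by
  obtain ⟨r, hr, hr'⟩ := exists_times_atBot h𝒰 ha hap
  obtain ⟨t, ht, ht'⟩ := exists_times_atTop h𝒰 hb hbq
  -- The target line is the constant one at q, so the end q' of the chain, being its backward limit,
  -- is q.
  obtain ⟨L, q', -, hL, hlim⟩ := H.exists_chain h𝒰 hy hp hr (H.isMorseLine_const hq) ht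
    (by simpa [sub_eq_add_neg] using ht'.atTop_add_atTop (tendsto_neg_atBot_atTop.comp hr'))
  rw [tendsto_nhds_unique hlim tendsto_const_nhds] at hL
  exact ⟨L, hL⟩

/-- Flow lines which take longer and longer from a point near `b` to a point near `a` break. -/
theorem IsLojasiewicz.exists_breaking (H : IsLojasiewicz g₀ h)
    (h𝒰 : (𝒰 : Filter ℕ) ≤ atTop) (hy : ∀ n, IsMorseLine g₀ h (y n)) {t : ℕ → ℝ} {a b : M}
    (ha : a ∈ S) (hb : b ∈ S) (hyb : Tendsto (fun n => y n 0) 𝒰 (𝓝 b))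
    (hya : Tendsto (fun n => y n (t n)) 𝒰 (𝓝 a)) (ht : Tendsto t 𝒰 atTop) :
    ∃ q ∈ critOn E S h, b ∈ stableManifold g₀ h q ∧ ∃ L, ∃ q' ∈ critOn E S h,
      IsChain g₀ h 𝒰 y q L q' ∧ a ∈ unstableManifold g₀ h q' := by
  obtain ⟨z, hz, hz0⟩ := H.exists_isMorseLine hb
  obtain ⟨w, hw, hw0⟩ := H.exists_isMorseLine ha
  obtain ⟨q, hq, hzq⟩ := H.exists_tendsto_atTop hz
  -- The limit line through b ends at q. The lines are followed to near q while the time left to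
  -- reach a still tends to infinity.
  obtain ⟨r, hr, hrt⟩ := exists_tendsto_diagonal h𝒰 (q := q) (a := y)
    (Q := fun j n x => (j : ℝ) ≤ t n - x)
    (fun j j' n x hjj' hx => (Nat.cast_le.2 hjj').trans hx) (fun U hU j => by
      obtain ⟨k, hk⟩ := (hzq.eventually (interior_mem_nhds.2 hU)).exists
      have h1 := H.tendsto_apply (l := 𝒰) hy hz (s₁ := 0) (hz0.symm ▸ hyb)
        (tendsto_const_nhds (x := k))
      filter_upwards [h1.eventually (isOpen_interior.mem_nhds hk),
        ht.eventually_ge_atTop (j + k)] with n h2 h3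
      exact ⟨k, interior_subset h2, by linarith⟩)
  have hrt' : Tendsto (fun n => t n - r n) 𝒰 atTop := by
    rw [tendsto_atTop]
    intro R
    obtain ⟨j, hj⟩ := exists_nat_ge R
    exact (hrt j).mono fun n hn => hj.trans hn
  obtain ⟨L, q', hq', hL, hlim⟩ := H.exists_chain h𝒰 hy hq hr hw (hw0.symm ▸ hya) hrt'
  exact ⟨q, hq, ⟨z, hz, hz0, hzq⟩, L, q', hq', hL, w, hw, hw0, hlim⟩

end Ends

/-- A cascade of the limit: it is the limit of shifts of the cascades with number `idx`, and
`time` is the limit of the times to the next cascade. -/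
structure LimitCascade (M : Type w) (m : ℕ) where
  idx : Fin (m + 1)
  shift : ℕ → ℝ
  curve : ℝ → M
  time : EReal

namespace LimitCascade

variable {m : ℕ}

/-- The data which enter the limiting broken flow line. -/
def out (e : LimitCascade M m) : (ℝ → M) × EReal := (e.curve, e.time)

/-- The relation between consecutive cascades of the limit. -/
def Step (𝒰 : Filter ℕ) (t : ℕ → Fin m → ℝ) (e e' : LimitCascade M m) : Prop :=
  (e.idx = e'.idx ∧ e.time = 0) ∨ ((e.idx : ℕ) + 1 = e'.idx ∧
    -- The default value is never taken: a cascade with a successor index is not the last one.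
    Tendsto (fun n => ((if hk : (e.idx : ℕ) < m then t n ⟨e.idx, hk⟩ else 0 : ℝ) : EReal)) 𝒰
      (𝓝 e.time))

end LimitCascade

variable (g : Bundle.ContMDiffRiemannianMetric 𝓘(ℝ, E) ∞ E (TangentSpace 𝓘(ℝ, E) : M → Type u))
  (f : M → ℝ) (g₀ : MetricOn E (crit E f)) (h : M → ℝ) (𝒰 : Filter ℕ) {m : ℕ}
  (x : ℕ → Fin (m + 1) → ℝ → M) (t : ℕ → Fin m → ℝ)

/-- The flow line `z` is a limit of flow lines through an end of a cascade. -/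
def IsZeroLimit (z : ℝ → M) : Prop :=
  ∃ (y : ℕ → ℝ → M) (s : ℕ → ℝ) (k : Fin (m + 1)), (∀ n, IsMorseLine g₀ h (y n)) ∧
    IsMorseLine g₀ h z ∧ Tendsto (fun n => y n 0) 𝒰 (𝓝 (z 0)) ∧
    ∀ n, Tendsto (x n k) atBot (𝓝 (y n (s n))) ∨ Tendsto (x n k) atTop (𝓝 (y n (s n)))

/-- The list `P` of flow lines with cascades, whose cascades are listed in `Λ`, is a limit of the
cascades `x n` from some number on. -/
structure IsLimitData (P : List (CascadeData M)) (Λ : List (LimitCascade M m)) : Prop where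
  entries_eq : P.flatMap CascadeData.entries = Λ.map LimitCascade.out
  isZeroLimit : ∀ z, CascadeData.zero z ∈ P → IsZeroLimit f g₀ h 𝒰 x z
  isGradientLine : ∀ e ∈ Λ, IsGradientLine g f e.curve
  tendsto : ∀ e ∈ Λ, Tendsto (fun n => x n e.idx (e.shift n)) 𝒰 (𝓝 (e.curve 0))
  isChain : Λ.IsChain (LimitCascade.Step 𝒰 t)
  last : ∀ e ∈ Λ.getLast?, e.idx = Fin.last m

/-- There is a limit from the cascade with number `k` on, which starts at `c`. -/
def HasClosedLimit (d : M) (k : ℕ) (c : M) : Prop :=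
  ∃ P Λ, IsBroken g f g₀ h c P d ∧ IsLimitData g f g₀ h 𝒰 x t P Λ ∧
    -- An empty list of cascades is allowed only past the last cascade, whose index is m.
    (∀ e ∈ Λ.head?, (e.idx : ℕ) = k) ∧ (Λ = [] → k = m + 1)

/-- There is a limit from the cascade with number `k` on, which starts with a cascade from `p`. -/
def HasOpenLimit (d : M) (k : Fin (m + 1)) (p : M) : Prop :=
  ∃ v P e Λ, IsOpenBroken g f g₀ h p v P d ∧ IsLimitData g f g₀ h 𝒰 x t (v :: P) (e :: Λ) ∧
    e.idx = k

variable {g f g₀ h 𝒰 x t} {d : M}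

theorem HasOpenLimit.close {k : Fin (m + 1)} {p c : M}
    (H : HasOpenLimit g f g₀ h 𝒰 x t d k p) (hp : p ∈ unstableManifold g₀ h c) :
    HasClosedLimit g f g₀ h 𝒰 x t d k c := by
  obtain ⟨v, P, e, Λ, h1, h2, h3⟩ := H
  refine ⟨v :: P, e :: Λ, h1.close hp, h2, fun e' he' => ?_, by simp⟩
  simp only [List.head?_cons, Option.mem_def, Option.some.injEq] at he'
  rw [← he', h3]

/-- The lines of a chain in the critical set become pieces with zero cascades. They add no cascade
and therefore leave Λ unchanged. -/
theorem HasClosedLimit.prepend {k : ℕ} {y : ℕ → ℝ → M} (hy : ∀ n, IsMorseLine g₀ h (y n))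
    {j : Fin (m + 1)}
    (hj : ∀ n, Tendsto (x n j) atBot (𝓝 (y n 0)) ∨ Tendsto (x n j) atTop (𝓝 (y n 0)))
    {q q' : M} {L : List ((ℕ → ℝ) × (ℝ → M))} (hL : IsChain g₀ h 𝒰 y q L q') (H : HasClosedLimit g f g₀ h 𝒰 x t d k q') :
    HasClosedLimit g f g₀ h 𝒰 x t d k q := by
  induction L generalizing q with
  | nil =>
    rw [show q = q' from hL]
    exact H
  | cons e L ih =>
    obtain ⟨h1, h2, h3, h4, q₁, hq₁, h5, h6⟩ := hL
    obtain ⟨P, Λ, h7, h8, h9⟩ := ih h6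
    refine ⟨.zero e.2 :: P, Λ, ⟨q₁, hq₁, ⟨h1, h4, h5⟩, h7⟩, ⟨?_, fun z hz => ?_, h8.isGradientLine,
      h8.tendsto, h8.isChain, h8.last⟩, h9⟩
    · rw [List.flatMap_cons, CascadeData.entries_zero, List.nil_append, h8.entries_eq]
    · rcases List.mem_cons.1 hz with hz | hz
      · cases hz
        -- After the shift by `e.1 n`, the end of the cascade sits at the time `-e.1 n`.
        refine ⟨fun n s => y n (s + e.1 n), fun n => -e.1 n, j, fun n => (hy n).comp_add _, h1,
          by simpa using h3, fun n => by simpa using hj n⟩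
      · exact h8.isZeroLimit z hz

/-- The case of infinite limiting time, which closes the piece after the cascade k. For the last
cascade the condition on times is vacuous. -/
theorem HasClosedLimit.single {k : Fin (m + 1)} {c : M}
    (H : HasClosedLimit g f g₀ h 𝒰 x t d (k + 1) c) (hc : c ∈ critOn E (crit E f) h)
    {z : ℝ → M} {p q : M} (hz : IsGradientLine g f z) (hn : ¬ ∃ p, ∀ s, z s = p)
    (hp : Tendsto z atBot (𝓝 p)) (hq : Tendsto z atTop (𝓝 q)) (hqs : q ∈ stableManifold g₀ h c)
    {s : ℕ → ℝ} (hs : Tendsto (fun n => x n k (s n)) 𝒰 (𝓝 (z 0)))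
    (ht : ∀ hk : (k : ℕ) < m, Tendsto (fun n => t n ⟨k, hk⟩) 𝒰 atTop) :
    HasOpenLimit g f g₀ h 𝒰 x t d k p := by
  obtain ⟨P, Λ, h1, h2, h3, h4⟩ := H
  obtain ⟨v, h5, h6, h7⟩ := h1.single hc hz hn hp hq hqs
  refine ⟨v, P, ⟨k, s, z, ⊤⟩, Λ, h5, ⟨?_, fun z' hz' => ?_, ?_, ?_, ?_, ?_⟩, rfl⟩
  · rw [List.flatMap_cons, h6, h2.entries_eq]
    rfl
  · rcases List.mem_cons.1 hz' with hz' | hz'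
    · exact absurd hz'.symm (h7 z')
    · exact h2.isZeroLimit z' hz'
  · exact List.forall_mem_cons.2 ⟨hz, h2.isGradientLine⟩
  · exact List.forall_mem_cons.2 ⟨hs, h2.tendsto⟩
  · refine List.isChain_cons.2 ⟨fun e he => Or.inr ⟨(h3 e he).symm, ?_⟩, h2.isChain⟩
    have hk : (k : ℕ) < m := by
      have h8 := h3 e he
      have h9 := e.idx.2
      omega
    simp only [dif_pos hk]
    exact EReal.tendsto_coe_nhds_top_iff.2 (ht hk)
  · intro e he
    cases Λ with
    | nil =>
      simp only [List.getLast?_singleton, Option.mem_def, Option.some.injEq] at he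
      subst he
      have := h4 rfl
      exact Fin.ext (by simpa using this)
    | cons e' Λ =>
      rw [List.getLast?_cons_cons] at he
      exact h2.last e he

/-- The case in which the piece continues: either the same cascade k has broken, with time 0 as in
the definition of `assignedTime`, or the time to the next cascade has a finite limit. -/
theorem HasOpenLimit.cons {k k' : Fin (m + 1)} {p' : M}
    (H : HasOpenLimit g f g₀ h 𝒰 x t d k' p') {z : ℝ → M} {p : M} (hz : IsGradientLine g f z)
    (hn : ¬ ∃ p, ∀ s, z s = p) (hp : Tendsto z atBot (𝓝 p)) {T : ℝ} (hT : 0 ≤ T) {y : ℝ → M}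
    (hy : IsMorseLine g₀ h y) (hzy : Tendsto z atTop (𝓝 (y 0))) (hyT : y T = p')
    {s : ℕ → ℝ} (hs : Tendsto (fun n => x n k (s n)) 𝒰 (𝓝 (z 0)))
    (hstep : (k = k' ∧ T = 0) ∨ ((k : ℕ) + 1 = k' ∧
      ∀ hk : (k : ℕ) < m, Tendsto (fun n => t n ⟨k, hk⟩) 𝒰 (𝓝 T))) :
    HasOpenLimit g f g₀ h 𝒰 x t d k p := by
  obtain ⟨v, P, e, Λ, h1, h2, h3⟩ := H
  obtain ⟨v', h5, h6, h7⟩ := h1.cons hz hn hp hT hy hzy hyT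
  refine ⟨v', P, ⟨k, s, z, (T : EReal)⟩, e :: Λ, h5, ⟨?_, fun z' hz' => ?_, ?_, ?_, ?_, ?_⟩, rfl⟩
  · rw [List.flatMap_cons, h6, List.cons_append, ← List.flatMap_cons, h2.entries_eq]
    rfl
  · rcases List.mem_cons.1 hz' with hz' | hz'
    · exact absurd hz'.symm (h7 z')
    · exact h2.isZeroLimit z' (List.mem_cons_of_mem _ hz')
  · exact List.forall_mem_cons.2 ⟨hz, h2.isGradientLine⟩
  · exact List.forall_mem_cons.2 ⟨hs, h2.tendsto⟩
  · refine List.isChain_cons_cons.2 ⟨?_, h2.isChain⟩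
    rcases hstep with ⟨h8, h9⟩ | ⟨h8, h9⟩
    · exact Or.inl ⟨h8.trans h3.symm, by simp [h9]⟩
    · refine Or.inr ⟨by rw [h3]; exact h8, ?_⟩
      have hk : (k : ℕ) < m := by
        have := k'.2
        omega
      simp only [dif_pos hk]
      exact (continuous_coe_real_ereal.tendsto T).comp (h9 hk)
  · intro e' he'
    rw [List.getLast?_cons_cons] at he'
    exact h2.last e' he'

/-- If the last line of a chain of limits of a cascade can be continued, so can the chain. -/
theorem hasOpenLimit_of_isChain {G : MetricOn E (univ : Set M)} {k : Fin (m + 1)} {p q : M}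
    (hline : ∀ z, IsMorseLine G f z → IsGradientLine g f z)
    (hconst : ∀ p ∈ critOn E univ f, ∃ y, IsMorseLine g₀ h y ∧ y 0 = p)
    {L : List ((ℕ → ℝ) × (ℝ → M))} (hne : L ≠ [])
    (hL : IsChain G f 𝒰 (fun n => x n k) p L q)
    (hlast : ∀ (s : ℕ → ℝ) (z : ℝ → M) (p : M), IsGradientLine g f z → (¬ ∃ p, ∀ s, z s = p) →
      Tendsto z atBot (𝓝 p) → Tendsto z atTop (𝓝 q) →
      Tendsto (fun n => x n k (s n)) 𝒰 (𝓝 (z 0)) → HasOpenLimit g f g₀ h 𝒰 x t d k p) :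
    HasOpenLimit g f g₀ h 𝒰 x t d k p := by
  induction L generalizing p with
  | nil => exact absurd rfl hne
  | cons e L ih =>
    obtain ⟨h1, h2, h3, h4, q₁, hq₁, h5, h6⟩ := hL
    by_cases hL : L = []
    · subst hL
      rw [show q₁ = q from h6] at h5
      exact hlast e.1 e.2 p (hline _ h1) h2 h4 h5 h3
    -- The lines on both sides of the breaking point q₁ are joined by the Morse line through q₁,
    -- followed for time 0.
    · obtain ⟨y, hy, hy0⟩ := hconst q₁ hq₁
      exact (ih hL h6).cons (hline _ h1) h2 h4 le_rfl hy (hy0.symm ▸ h5) hy0 h3 (Or.inl ⟨rfl, rfl⟩)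

end Limits

/-! ### From limits along an ultrafilter to Floer–Gromov convergence of a subsequence. -/

section Convergence

variable [FiniteDimensional ℝ E] [IsManifold 𝓘(ℝ, E) ∞ M]

/-- A limit along a filter finer than `atTop` is a cluster point of the sequence in the product,
which is first countable; finitely many limits are thus realized by one subsequence. -/
theorem exists_subseq_tendsto {ι Y : Type*} [Finite ι] [TopologicalSpace Y]
    [FirstCountableTopology Y] {l : Filter ℕ} [l.NeBot] (hl : l ≤ atTop) {a : ι → ℕ → Y} {b : ι → Y}
    (H : ∀ i, Tendsto (a i) l (𝓝 (b i))) :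
    ∃ θ : ℕ → ℕ, StrictMono θ ∧ ∀ i, Tendsto (fun n => a i (θ n)) atTop (𝓝 (b i)) := by
  have h1 : Tendsto (fun n i => a i n) l (𝓝 b) := tendsto_pi_nhds.2 H
  have h2 : (𝓝 b ⊓ map (fun n i => a i n) atTop).NeBot :=
    (inferInstance : (map (fun n i => a i n) l).NeBot).mono (le_inf h1 (map_mono hl))
  obtain ⟨θ, hθ, hlim⟩ := subseq_tendsto_of_neBot h2
  exact ⟨θ, hθ, tendsto_pi_nhds.1 hlim⟩

/-- A discrete intermediate value theorem, since indices grow by at most one per step. It yields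
surjectivity of the maps γ. -/
theorem LimitCascade.exists_idx_eq {m : ℕ} {𝒰 : Filter ℕ} {t : ℕ → Fin m → ℝ}
    {Λ : List (LimitCascade M m)} (hΛ : Λ.IsChain (Step 𝒰 t)) {k : ℕ}
    (hne : Λ ≠ []) (hhead : ∀ e ∈ Λ.head?, (e.idx : ℕ) = k)
    (hlast : ∀ e ∈ Λ.getLast?, e.idx = Fin.last m) (j : Fin (m + 1)) (hj : k ≤ j) :
    ∃ e ∈ Λ, e.idx = j := by
  induction Λ generalizing k with
  | nil => exact absurd rfl hne
  | cons e Λ ih =>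
    have he : (e.idx : ℕ) = k := hhead e (by simp)
    by_cases hjk : (j : ℕ) = k
    · exact ⟨e, List.mem_cons_self, Fin.ext (by omega)⟩
    cases Λ with
    | nil =>
      have h1 : e.idx = Fin.last m := hlast e (by simp)
      rw [h1, Fin.val_last] at he
      have := j.2
      omega
    | cons e' Λ =>
      obtain ⟨h1, h2⟩ := List.isChain_cons_cons.1 hΛ
      have h3 : (e'.idx : ℕ) ≤ k + 1 := by
        rcases h1 with ⟨h4, -⟩ | ⟨h4, -⟩
        · rw [← h4]; omega
        · omega
      obtain ⟨e'', he'', h5⟩ := ih h2 (k := e'.idx) (by simp)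
        (fun e he => by
          simp only [List.head?_cons, Option.mem_def, Option.some.injEq] at he
          rw [he]) (fun e he => hlast e (by rwa [List.getLast?_cons_cons])) (by omega)
      exact ⟨e'', List.mem_cons_of_mem _ he'', h5⟩

variable [CompactSpace M] [T2Space M]
  {g : Bundle.ContMDiffRiemannianMetric 𝓘(ℝ, E) ∞ E (TangentSpace 𝓘(ℝ, E) : M → Type u)}
  {f : M → ℝ} {g₀ : MetricOn E (crit E f)} {h : M → ℝ} {𝒰 : Filter ℕ} [𝒰.NeBot] {m : ℕ}
  {x : ℕ → Fin (m + 1) → ℝ → M} {t : ℕ → Fin m → ℝ} {c d : M}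

theorem HasClosedLimit.exists_tendsto [FirstCountableTopology M]
    (H : HasClosedLimit g f g₀ h 𝒰 x t d 0 c) (h𝒰 : 𝒰 ≤ atTop)
    (hf : IsMorseBott E f) (Hh : IsCompactGradient g₀ h) (hc : c ∈ critOn E (crit E f) h)
    (hv : ∀ n, IsFlowLine g f g₀ h c d (.cascades m (x n) (t n))) :
    ∃ θ : ℕ → ℕ, StrictMono θ ∧ ∃ b : BrokenFlowLine g f g₀ h c d,
      FloerGromovTendsto (fun n => .cascades m (x (θ n)) (t (θ n))) b := by
  obtain ⟨P, Λ, h1, h2, h3, h4⟩ := H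
  have hΛ : Λ ≠ [] := fun h0 => by have := h4 h0; omega
  have hP : P ≠ [] := by
    rintro rfl
    have := h2.entries_eq
    simp only [List.flatMap_nil, List.nil_eq, List.map_eq_nil_iff] at this
    exact hΛ this
  obtain ⟨b, hb1, hb2, hb3⟩ := h1.exists_brokenFlowLine hc hP
  have hN : b.total = Λ.length := by rw [hb2, h2.entries_eq, List.length_map]
  have hlt : ∀ lam : Fin b.total, (lam : ℕ) < Λ.length := fun lam => hN ▸ lam.2
  set ev : Fin b.total → LimitCascade M m := fun lam => Λ[(lam : ℕ)]'(hlt lam) with hev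
  have hevm : ∀ lam, ev lam ∈ Λ := fun lam => List.getElem_mem _
  have hout : ∀ lam, b.cascade lam = (ev lam).curve ∧ b.time lam = (ev lam).time := by
    intro lam
    have h5 := hb3 lam
    rw [h2.entries_eq, List.getElem?_map, List.getElem?_eq_getElem (hlt lam)] at h5
    have h6 := Option.some.inj h5
    exact ⟨(congrArg Prod.fst h6).symm, (congrArg Prod.snd h6).symm⟩
  have hstep : ∀ i (hi : i + 1 < Λ.length), LimitCascade.Step 𝒰 t Λ[i] Λ[i + 1] :=
    List.isChain_iff_getElem.1 h2.isChain
  have hmono' : ∀ i j (hj : j < Λ.length) (hij : i ≤ j), (Λ[i]).idx ≤ (Λ[j]).idx := by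
    intro i j hj hij
    induction j, hij using Nat.le_induction with
    | base => exact le_rfl
    | succ j hij ih =>
      refine (ih (by omega)).trans ?_
      rcases hstep j hj with ⟨h5, -⟩ | ⟨h5, -⟩
      · exact h5.le
      · exact Fin.le_def.2 (by omega)
  have hmono : Monotone fun lam => (ev lam).idx := fun lam lam' hle =>
    hmono' lam lam' (hlt lam') hle
  have hsurj : Function.Surjective fun lam => (ev lam).idx := by
    intro j
    obtain ⟨e, he, hej⟩ := LimitCascade.exists_idx_eq h2.isChain hΛ h3 h2.last j (Nat.zero_le _)
    obtain ⟨i, hi, rfl⟩ := List.getElem_of_mem he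
    exact ⟨⟨i, hN.symm ▸ hi⟩, hej⟩
  have htime : ∀ lam : Fin b.total, (lam : ℕ) + 1 < b.total →
      Tendsto (fun n => ((assignedTime (.cascades m (x n) (t n)) (fun lam => (ev lam).idx) lam : ℝ) :
        EReal)) 𝒰 (𝓝 (ev lam).time) := by
    intro lam hlam
    rcases hstep lam (hN ▸ hlam) with ⟨h5, h6⟩ | ⟨h5, h6⟩
    -- The next cascade of the limit has the same index, so this one is not the last over its index
    -- and is assigned time 0.
    · have hzero : ∀ n, assignedTime (.cascades m (x n) (t n)) (fun lam => (ev lam).idx) lam = 0 := by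
        intro n
        refine if_neg fun hall => ?_
        have h7 := Fin.le_def.1 (hall ⟨lam + 1, hlam⟩ h5.symm)
        simp only at h7
        omega
      simp only [hzero]
      rw [show (ev lam).time = 0 from h6, EReal.coe_zero]
      exact tendsto_const_nhds
    -- The next index is larger, so by monotonicity this is the last cascade over its index and the
    -- true time is assigned.
    · refine h6.congr fun n => ?_
      congr 1
      refine (if_pos fun lam' hlam' => ?_).symm
      by_contra hlt'
      have h7 : (lam : ℕ) + 1 ≤ lam' := Fin.lt_def.1 (not_le.1 hlt')
      have h8 := Fin.le_def.1 (hmono' (lam + 1) lam' (hlt lam') h7)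
      have h9 : (Λ[(lam' : ℕ)]'(hlt lam')).idx = (Λ[(lam : ℕ)]'(hlt lam)).idx := hlam'
      rw [h9] at h8
      omega
  have hzero : ∀ j : Fin b.length, ∃ (y : ℕ → ℝ → M) (s : ℕ → ℝ) (k : Fin (m + 1)) (p : M),
      Tendsto (fun n => y n 0) 𝒰 (𝓝 p) ∧ ∀ z, b.piece j = .zero z → z 0 = p ∧
        IsMorseLine g₀ h z ∧ ∀ n, IsMorseLine g₀ h (y n) ∧
          (Tendsto (x n k) atBot (𝓝 (y n (s n))) ∨ Tendsto (x n k) atTop (𝓝 (y n (s n)))) := by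
    intro j
    by_cases hz : ∃ z, b.piece j = .zero z
    · obtain ⟨z, hz⟩ := hz
      obtain ⟨y, s, k, hy, hzl, hlim, hk⟩ := h2.isZeroLimit z
        (hz ▸ List.mem_of_getElem? (hb1 j))
      refine ⟨y, s, k, z 0, hlim, fun z' hz' => ?_⟩
      rw [hz] at hz'
      cases hz'
      exact ⟨rfl, hzl, fun n => ⟨hy n, hk n⟩⟩
    · exact ⟨fun _ _ => c, fun _ => 0, 0, c, tendsto_const_nhds, fun z hz' => absurd ⟨z, hz'⟩ hz⟩
  choose y s k p hyp hyz using hzero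
  -- Points and times are put into the single space `M × EReal`. The last cascade, on whose time
  -- there is no condition, gets a constant sequence, and the Morse lines get the time 0.
  obtain ⟨θ, hθ, hlim⟩ := exists_subseq_tendsto (ι := Fin b.total ⊕ Fin b.length) (Y := M × EReal)
    h𝒰 (a := Sum.elim
      (fun lam n => (x n (ev lam).idx ((ev lam).shift n),
        if (lam : ℕ) + 1 < b.total then
          ((assignedTime (.cascades m (x n) (t n)) (fun lam => (ev lam).idx) lam : ℝ) : EReal)
        else (ev lam).time))
      (fun j n => (y j n 0, 0)))
    (b := Sum.elim (fun lam => ((ev lam).curve 0, (ev lam).time)) (fun j => (p j, 0))) (by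
      rintro (lam | j)
      · refine (h2.tendsto _ (hevm lam)).prodMk_nhds ?_
        by_cases hlam : (lam : ℕ) + 1 < b.total
        · simp only [if_pos hlam]
          exact htime lam hlam
        · simp only [if_neg hlam]
          exact tendsto_const_nhds
      · exact (hyp j).prodMk_nhds tendsto_const_nhds)
  have hsm := (hf.isLojasiewicz g).toIsCompactGradient
  have hline : ∀ z, IsGradientLine g f z → IsMorseLine (MetricOn.ofRiemannian g) f z := fun z hz =>
    (isGradientLine_iff g hf.1).1 hz
  refine ⟨θ, hθ, b, 0, fun n _ => hv (θ n), Or.inr ⟨fun n => Nat.succ_pos m, fun j z hz => ?_,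
    fun n lam => (ev lam).idx, fun n lam => (ev lam).shift (θ n), fun n => ⟨hsurj, hmono⟩,
    fun lam => ?_, fun lam hlam => ?_⟩⟩
  · obtain ⟨h5, h6, h7⟩ := hyz j z hz
    have h8 := (continuous_fst.tendsto _).comp (hlim (Sum.inr j))
    exact ⟨fun n => y j (θ n), fun n => s j (θ n), fun n => k j, fun n => (h7 (θ n)).1,
      Hh.tendstoCInftyLoc (fun n => (h7 (θ n)).1) h6 (s₁ := 0) (by rw [h5]; exact h8),
      fun n => (h7 (θ n)).2⟩
  · rw [(hout lam).1]
    have h8 := (continuous_fst.tendsto _).comp (hlim (Sum.inl lam))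
    refine hsm.tendstoCInftyLoc (y := fun n r => x (θ n) (ev lam).idx (r + (ev lam).shift (θ n)))
      (fun n => (hline _ ((hv (θ n)).1 (ev lam).idx).1).comp_add _)
      (hline _ (h2.isGradientLine _ (hevm lam))) (s₁ := 0) ?_
    simpa [Function.comp_def] using h8
  · rw [(hout lam).2]
    have h8 := (continuous_snd.tendsto _).comp (hlim (Sum.inl lam))
    simpa [Function.comp_def, hlam] using h8

end Convergence

/-! ### Construction of the limit for a fixed number of cascades. -/

section CascadeLimits

variable [FiniteDimensional ℝ E] [IsManifold 𝓘(ℝ, E) ∞ M]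

section

variable {S : Set M} {g₀ : MetricOn E S} {h : M → ℝ} [T2Space M]

theorem IsCompactGradient.lt_of_tendsto (H : IsCompactGradient g₀ h) {y : ℝ → M}
    (hy : IsMorseLine g₀ h y) (hn : ¬ ∃ p, ∀ s, y s = p) {a b : M} (ha : a ∈ S) (hb : b ∈ S)
    (hya : Tendsto y atBot (𝓝 a)) (hyb : Tendsto y atTop (𝓝 b)) : h b < h a := by
  have h1 := H.strictAnti hy hn
  calc h b ≤ h (y 1) := h1.antitone.le_of_tendsto (H.tendsto_value hy.2.1 hb hyb) 1
    _ < h (y 0) := h1 one_pos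
    _ ≤ h a := h1.antitone.ge_of_tendsto (H.tendsto_value hy.2.1 ha hya) 0

/-- By the isolation of critical values, the ends of nonconstant flow lines stay apart. -/
theorem IsLojasiewicz.ne_of_tendsto (H : IsLojasiewicz g₀ h) {l : Filter ℕ} [l.NeBot]
    {y : ℕ → ℝ → M} (hy : ∀ n, IsMorseLine g₀ h (y n)) (hn : ∀ n, ¬ ∃ p, ∀ s, y n s = p)
    {a b : ℕ → M} (ha : ∀ n, a n ∈ critOn E S h) (hb : ∀ n, b n ∈ critOn E S h)
    (hya : ∀ n, Tendsto (y n) atBot (𝓝 (a n))) (hyb : ∀ n, Tendsto (y n) atTop (𝓝 (b n)))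
    {p q : M} (hp : p ∈ S) (hap : Tendsto a l (𝓝 p)) (hbq : Tendsto b l (𝓝 q)) : p ≠ q := by
  rintro rfl
  obtain ⟨ε, hε, h1⟩ := H.isolated_values (h p)
  have h2 := (H.tendsto_value (fun n => (ha n).1) hp hap).eventually (Metric.ball_mem_nhds _ hε)
  have h3 := (H.tendsto_value (fun n => (hb n).1) hp hbq).eventually (Metric.ball_mem_nhds _ hε)
  obtain ⟨n, h4, h5⟩ := (h2.and h3).exists
  have h6 := H.lt_of_tendsto (hy n) (hn n) (ha n).1 (hb n).1 (hya n) (hyb n)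
  rw [h1 _ (ha n) h4, h1 _ (hb n) h5] at h6
  exact h6.false

end

variable [CompactSpace M] [T2Space M]
  {g : Bundle.ContMDiffRiemannianMetric 𝓘(ℝ, E) ∞ E (TangentSpace 𝓘(ℝ, E) : M → Type u)}
  {f : M → ℝ} {g₀ : MetricOn E (crit E f)} {h : M → ℝ} {m : ℕ}

/-- Induction from the last cascade backward. A cascade converges to a chain of lines of f, and only
what follows its last line depends on the behaviour of the time to the next cascade. -/
theorem hasOpenLimit [FirstCountableTopology M] {𝒰 : Ultrafilter ℕ} (h𝒰 : (𝒰 : Filter ℕ) ≤ atTop)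
    (hf : IsMorseBott E f) (H : IsLojasiewicz g₀ h) {d : M} (hd : d ∈ critOn E (crit E f) h)
    {x : ℕ → Fin (m + 1) → ℝ → M} {t : ℕ → Fin m → ℝ} {a b : ℕ → Fin (m + 1) → M}
    (hx : ∀ n k, IsGradientLine g f (x n k) ∧ ¬ ∃ p, ∀ s, x n k s = p)
    (ha : ∀ n k, a n k ∈ crit E f ∧ Tendsto (x n k) atBot (𝓝 (a n k)))
    (hb : ∀ n k, b n k ∈ crit E f ∧ Tendsto (x n k) atTop (𝓝 (b n k)))
    {A B : Fin (m + 1) → M}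
    (hA : ∀ k, A k ∈ crit E f ∧ Tendsto (fun n => a n k) 𝒰 (𝓝 (A k)))
    (hB : ∀ k, B k ∈ crit E f ∧ Tendsto (fun n => b n k) 𝒰 (𝓝 (B k)))
    (hm : ∀ n k, 0 ≤ t n k ∧ ∃ y : ℝ → M, IsMorseLine g₀ h y ∧ y 0 = b n k.castSucc ∧
      y (t n k) = a n k.succ)
    (he : ∀ n, ∃ y : ℝ → M, IsMorseLine g₀ h y ∧ y 0 = b n (Fin.last m) ∧ Tendsto y atTop (𝓝 d))
    (k : Fin (m + 1)) : HasOpenLimit g f g₀ h 𝒰 x t d k (A k) := by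
  have Df := hf.isLojasiewicz g
  have hcrit := critOn_univ (E := E) hf.1
  have hiff := fun z : ℝ → M => isGradientLine_iff (x := z) g hf.1
  have key : ∀ k, (∀ (s : ℕ → ℝ) (z : ℝ → M) (p : M), IsGradientLine g f z →
      (¬ ∃ p, ∀ s, z s = p) → Tendsto z atBot (𝓝 p) → Tendsto z atTop (𝓝 (B k)) →
      Tendsto (fun n => x n k (s n)) 𝒰 (𝓝 (z 0)) → HasOpenLimit g f g₀ h 𝒰 x t d k p) →
      HasOpenLimit g f g₀ h 𝒰 x t d k (A k) := by
    intro k hlast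
    have hy := fun n => (hiff _).1 (hx n k).1
    obtain ⟨L, hL⟩ := Df.exists_chain_of_ends h𝒰 hy (hcrit ▸ (hA k).1) (hcrit ▸ (hB k).1)
      (fun n => (ha n k).2) (fun n => (hb n k).2) (hA k).2 (hB k).2
    refine hasOpenLimit_of_isChain (fun z => (hiff z).2)
      (fun p hp => H.exists_isMorseLine (hcrit ▸ hp)) ?_ hL hlast
    -- An empty chain would make both end points converge to the same point, which isolation of the
    -- critical values of f forbids for nonconstant lines.
    rintro rfl
    exact Df.ne_of_tendsto hy (fun n => (hx n k).2) (fun n => hcrit ▸ (ha n k).1)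
      (fun n => hcrit ▸ (hb n k).1) (fun n => (ha n k).2) (fun n => (hb n k).2) (mem_univ _)
      (hA k).2 (hB k).2 hL
  choose ht ym hym hym0 hymt using hm
  choose ye hye hye0 hyed using he
  induction k using Fin.reverseInduction with
  | last =>
    refine key _ fun s z p hz hn hp hq hs => ?_
    -- The Morse lines into d take unbounded time to come close to d, so they break as in the case
    -- of infinite t; the last link ends at d because the line through d is constant.
    obtain ⟨τ, hτ, hτ'⟩ := exists_times_atTop h𝒰 hyed (tendsto_const_nhds (x := d))
    obtain ⟨q, hq', hbq, L, q', -, hL, w, hw, hw0, hwq⟩ := H.exists_breaking h𝒰 hye hd.1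
      (hB (Fin.last m)).1 (by simpa only [hye0] using (hB (Fin.last m)).2) hτ hτ'
    have hqd : q' = d := by
      have h1 : w = fun _ => d := funext fun r => (H.eq_const hw (hw0.symm ▸ hd) r).trans hw0
      rw [h1] at hwq
      exact tendsto_nhds_unique hwq tendsto_const_nhds
    have h2 : HasClosedLimit g f g₀ h 𝒰 x t d (m + 1) d :=
      ⟨[], [], rfl, ⟨rfl, by simp, by simp, by simp, List.isChain_nil, by simp⟩, by simp,
        fun _ => rfl⟩
    refine HasClosedLimit.single (c := q) ?_ hq' hz hn hp hq hbq hs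
      (fun hk => absurd hk (lt_irrefl _))
    exact h2.prepend hye (j := Fin.last m) (fun n => Or.inr (hye0 n ▸ (hb n _).2)) (hqd ▸ hL)
  | cast i ih =>
    refine key _ fun s z p hz hn hp hq hs => ?_
    -- Infinite limit: the connecting lines break and a new piece begins. Finite limit T: they
    -- converge to a Morse line that joins the two cascades in time T.
    rcases 𝒰.tendsto_atTop_or_nhds (u := fun n => t n i) (b := 0)
      (Eventually.of_forall fun n => ht n i) with hti | ⟨T, hT, hti⟩
    · obtain ⟨q, hq', hbq, L, q', hq'', hL, hAu⟩ := H.exists_breaking h𝒰 (fun n => hym n i)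
        (hA i.succ).1 (hB i.castSucc).1 (by simpa only [hym0] using (hB i.castSucc).2)
        (by simpa only [hymt] using (hA i.succ).2) hti
      refine HasClosedLimit.single (c := q) ?_ hq' hz hn hp hq hbq hs (fun hk => hti)
      exact (ih.close hAu).prepend (fun n => hym n i) (j := i.castSucc)
        (fun n => Or.inr (hym0 n i ▸ (hb n _).2)) hL
    · obtain ⟨y, hy, hy0⟩ := H.exists_isMorseLine (hB i.castSucc).1
      refine ih.cons hz hn hp hT hy (hy0.symm ▸ hq) ?_ hs (Or.inr ⟨by simp, fun hk => hti⟩)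
      refine tendsto_nhds_unique (H.tendsto_apply (fun n => hym n i) hy (s₁ := 0) ?_ hti)
        (by simpa only [hymt] using (hA i.succ).2)
      simpa only [hym0, hy0] using (hB i.castSucc).2

/-- Compactness for flow lines with a fixed number of cascades between fixed critical points. -/
theorem exists_tendsto_cascades (hf : IsMorseBott E f) (H : IsLojasiewicz g₀ h) {c d : M}
    (hc : c ∈ critOn E (crit E f) h) (hd : d ∈ critOn E (crit E f) h)
    {x : ℕ → Fin (m + 1) → ℝ → M} {t : ℕ → Fin m → ℝ}
    (hv : ∀ n, IsFlowLine g f g₀ h c d (.cascades m (x n) (t n))) :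
    ∃ θ : ℕ → ℕ, StrictMono θ ∧ ∃ b : BrokenFlowLine g f g₀ h c d,
      FloerGromovTendsto (fun n => .cascades m (x (θ n)) (t (θ n))) b := by
  have : ProperSpace E := FiniteDimensional.proper_real E
  have : SecondCountableTopology M := ChartedSpace.secondCountable_of_sigmaCompact E M
  set 𝒰 : Ultrafilter ℕ := hyperfilter ℕ
  have h𝒰 : (𝒰 : Filter ℕ) ≤ atTop := Nat.hyperfilter_le_atTop
  have Df := hf.isLojasiewicz g
  have hcrit := critOn_univ (E := E) hf.1
  have hline := fun n k => (isGradientLine_iff g hf.1).1 ((hv n).1 k).1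
  choose a ha hxa using fun n k => Df.exists_tendsto_atBot (hline n k)
  choose b hb hxb using fun n k => Df.exists_tendsto_atTop (hline n k)
  rw [hcrit] at ha hb
  choose A hA hAa using fun k => H.exists_limit 𝒰 (a := fun n => a n k) fun n => ha n k
  choose B hB hBb using fun k => H.exists_limit 𝒰 (a := fun n => b n k) fun n => hb n k
  have hstart : ∀ n, ∃ y : ℝ → M, IsMorseLine g₀ h y ∧ y 0 = a n 0 ∧ Tendsto y atBot (𝓝 c) := by
    intro n
    obtain ⟨-, ⟨p, ⟨y, hy, hy0, hyc⟩, hp⟩, -⟩ := hv n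
    exact ⟨y, hy, hy0.trans (tendsto_nhds_unique hp (hxa n 0)), hyc⟩
  choose ys hys hys0 hysc using hstart
  have hopen := hasOpenLimit h𝒰 hf H hd (fun n => (hv n).1) (fun n k => ⟨ha n k, hxa n k⟩)
    (fun n k => ⟨hb n k, hxb n k⟩) (fun k => ⟨hA k, hAa k⟩) (fun k => ⟨hB k, hBb k⟩)
    (fun n k => by
      obtain ⟨-, -, -, hm⟩ := hv n
      obtain ⟨ht, y, hy, hy0, hyt⟩ := hm k
      exact ⟨ht, y, hy, tendsto_nhds_unique hy0 (hxb n _), tendsto_nhds_unique hyt (hxa n _)⟩)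
    (fun n => by
      obtain ⟨-, -, ⟨q, ⟨y, hy, hy0, hyd⟩, hq⟩, -⟩ := hv n
      exact ⟨y, hy, hy0.trans (tendsto_nhds_unique hq (hxb n _)), hyd⟩) 0
  obtain ⟨r, hr, hr'⟩ := exists_times_atBot h𝒰 hysc (tendsto_const_nhds (x := c))
  obtain ⟨w, hw, hw0⟩ := H.exists_isMorseLine (hA 0)
  -- The initial Morse lines, from c to the start of the first cascade at time 0, break as well;
  -- this places the limiting start on an unstable manifold.
  obtain ⟨L, q', -, hL, hwq⟩ := H.exists_chain h𝒰 hys hc (t := fun _ => 0) hr hw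
    (by simpa only [hys0, hw0] using hAa 0)
    (by simpa using hr')
  have hclosed : HasClosedLimit g f g₀ h 𝒰 x t d 0 c :=
    (hopen.close ⟨w, hw, hw0, hwq⟩).prepend hys (j := 0)
      (fun n => Or.inl (hys0 n ▸ hxa n 0)) hL
  exact hclosed.exists_tendsto h𝒰 hf H.toIsCompactGradient hc hv

end CascadeLimits

/-! ### Sequences without cascades. -/

section ZeroLimits

variable [FiniteDimensional ℝ E] [IsManifold 𝓘(ℝ, E) ∞ M]
  {g : Bundle.ContMDiffRiemannianMetric 𝓘(ℝ, E) ∞ E (TangentSpace 𝓘(ℝ, E) : M → Type u)}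
  {f : M → ℝ} {g₀ : MetricOn E (crit E f)} {h : M → ℝ}

theorem IsChain.isBroken {l : Filter ℕ} {y : ℕ → ℝ → M} {q q' : M}
    {L : List ((ℕ → ℝ) × (ℝ → M))} (hL : IsChain g₀ h l y q L q') :
    IsBroken g f g₀ h q (L.map fun e => .zero e.2) q' := by
  induction L generalizing q with
  | nil => exact hL
  | cons e L ih =>
    obtain ⟨h1, -, -, h4, q₁, hq₁, h5, h6⟩ := hL
    exact ⟨q₁, hq₁, ⟨h1, h4, h5⟩, ih h6⟩

theorem IsChain.tendsto {l : Filter ℕ} {y : ℕ → ℝ → M} {q q' : M}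
    {L : List ((ℕ → ℝ) × (ℝ → M))} (hL : IsChain g₀ h l y q L q') :
    ∀ e ∈ L, IsMorseLine g₀ h e.2 ∧ Tendsto (fun n => y n (e.1 n)) l (𝓝 (e.2 0)) := by
  induction L generalizing q with
  | nil => simp
  | cons e L ih =>
    obtain ⟨h1, -, h3, -, q₁, -, -, h6⟩ := hL
    exact List.forall_mem_cons.2 ⟨⟨h1, h3⟩, ih h6⟩

variable [CompactSpace M] [T2Space M]

/-- Compactness for flow lines with zero cascades between fixed critical points. -/
theorem exists_tendsto_zero (H : IsLojasiewicz g₀ h) {c d : M}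
    (hc : c ∈ critOn E (crit E f) h) (hd : d ∈ critOn E (crit E f) h) {y : ℕ → ℝ → M}
    (hv : ∀ n, IsFlowLine g f g₀ h c d (.zero (y n))) :
    ∃ θ : ℕ → ℕ, StrictMono θ ∧ ∃ b : BrokenFlowLine g f g₀ h c d,
      FloerGromovTendsto (fun n => .zero (y (θ n))) b := by
  have : ProperSpace E := FiniteDimensional.proper_real E
  have : SecondCountableTopology M := ChartedSpace.secondCountable_of_sigmaCompact E M
  set 𝒰 : Ultrafilter ℕ := hyperfilter ℕ
  have h𝒰 : (𝒰 : Filter ℕ) ≤ atTop := Nat.hyperfilter_le_atTop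
  obtain ⟨L, hne, hL, hLt⟩ : ∃ L : List ((ℕ → ℝ) × (ℝ → M)), L ≠ [] ∧
      IsBroken g f g₀ h c (L.map fun e => .zero e.2) d ∧
      ∀ e ∈ L, IsMorseLine g₀ h e.2 ∧ Tendsto (fun n => y n (e.1 n)) 𝒰 (𝓝 (e.2 0)) := by
    -- If the ends coincide, strict decay of h forces every line to be constant. The chain would be
    -- empty, but a broken flow line needs a piece, so the constant line is used.
    by_cases hcd : c = d
    · subst hcd
      refine ⟨[(fun _ => 0, fun _ => c)], by simp, ⟨c, hc, ⟨H.isMorseLine_const hc,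
        tendsto_const_nhds, tendsto_const_nhds⟩, rfl⟩, ?_⟩
      simp only [List.mem_singleton, forall_eq]
      refine ⟨H.isMorseLine_const hc, ?_⟩
      have hyc : ∀ n, y n 0 = c := by
        intro n
        by_contra hn
        refine (H.lt_of_tendsto (hv n).1 ?_ hc.1 hc.1 (hv n).2.1 (hv n).2.2).false
        rintro ⟨p, hp⟩
        rw [hp] at hn
        have h1 := (hv n).2.1
        rw [show y n = fun _ => p from funext hp] at h1
        exact hn (tendsto_nhds_unique tendsto_const_nhds h1)
      simp only [hyc]
      exact tendsto_const_nhds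
    · obtain ⟨L, hL⟩ := H.exists_chain_of_ends h𝒰 (fun n => (hv n).1) hc hd (fun n => (hv n).2.1)
        (fun n => (hv n).2.2) tendsto_const_nhds tendsto_const_nhds
      refine ⟨L, ?_, hL.isBroken, hL.tendsto⟩
      rintro rfl
      exact hcd hL
  obtain ⟨b, hb, -, -⟩ := hL.exists_brokenFlowLine hc (by simpa using hne)
  have hpiece : ∀ j : Fin b.length, ∃ e ∈ L, b.piece j = .zero e.2 := fun j => by
    obtain ⟨e, he, he'⟩ := List.mem_map.1 (List.mem_of_getElem? (hb j))
    exact ⟨e, he, he'.symm⟩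
  choose e heL he using hpiece
  obtain ⟨θ, hθ, hlim⟩ := exists_subseq_tendsto h𝒰 fun j => (hLt _ (heL j)).2
  refine ⟨θ, hθ, b, 0, fun n _ => hv (θ n), Or.inl ⟨fun n => y (θ n), fun n => rfl, fun j =>
    ⟨_, he j, fun n => (e j).1 (θ n), ?_⟩⟩⟩
  exact H.tendstoCInftyLoc (fun n => (hv (θ n)).1.comp_add _) (hLt _ (heL j)).1 (s₁ := 0)
    (by simpa using hlim j)

end ZeroLimits

/-! ### Bounding the number of cascades, and the conclusion. -/

section Compactness

variable [FiniteDimensional ℝ E] [IsManifold 𝓘(ℝ, E) ∞ M] [CompactSpace M] [T2Space M]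
  {g : Bundle.ContMDiffRiemannianMetric 𝓘(ℝ, E) ∞ E (TangentSpace 𝓘(ℝ, E) : M → Type u)}
  {f : M → ℝ} {g₀ : MetricOn E (crit E f)} {h : M → ℝ}

/-- The number of cascades is at most the number of critical values of `f`, because `f` strictly
decreases along each cascade and is constant between two cascades. -/
theorem IsFlowLine.num_le (g : Bundle.ContMDiffRiemannianMetric 𝓘(ℝ, E) ∞ E
      (TangentSpace 𝓘(ℝ, E) : M → Type u)) (hf : IsMorseBott E f) {c d : M} {v : CascadeData M}
    (hv : IsFlowLine g f g₀ h c d v) :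
    v.num ≤ ((hf.isLojasiewicz g).finite_values).toFinset.card := by
  cases v with
  | zero y => exact Nat.zero_le _
  | cascades m x t =>
    have Df := hf.isLojasiewicz g
    have hline := fun k => (isGradientLine_iff g hf.1).1 (hv.1 k).1
    choose a ha hxa using fun k => Df.exists_tendsto_atBot (hline k)
    choose b hb hxb using fun k => Df.exists_tendsto_atTop (hline k)
    -- The starting points of the cascades have distinct critical values: f drops along a cascade
    -- and is constant along the Morse line to the next one.
    have hanti : StrictAnti fun k => f (a k) := by
      refine Fin.strictAnti_iff_succ_lt.2 fun k => ?_
      obtain ⟨-, y, hy, hy0, hyt⟩ := hv.2.2.2 k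
      rw [tendsto_nhds_unique (hxa _) hyt, apply_eq_of_isMorseLine hf.1 hy (t k) 0,
        ← tendsto_nhds_unique (hxb _) hy0]
      exact Df.lt_of_tendsto (hline _) (hv.1 _).2 (mem_univ _) (mem_univ _) (hxa _) (hxb _)
    calc m + 1 = (Finset.univ : Finset (Fin (m + 1))).card := (Finset.card_fin _).symm
      _ ≤ _ := Finset.card_le_card_of_injOn (fun k => f (a k))
        (fun k _ => by simpa using ⟨a k, ha k, rfl⟩) hanti.injective.injOn

theorem exists_floerGromovTendsto (hf : IsMorseBott E f) (hh : IsMorseOn E (crit E f) h)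
    {v : ℕ → CascadeData M} (hv : ∀ n, ∃ c ∈ critOn E (crit E f) h,
      ∃ d ∈ critOn E (crit E f) h, IsFlowLine g f g₀ h c d (v n)) :
    ∃ φ : ℕ → ℕ, StrictMono φ ∧ ∃ c ∈ critOn E (crit E f) h, ∃ d ∈ critOn E (crit E f) h,
      ∃ b : BrokenFlowLine g f g₀ h c d, FloerGromovTendsto (v ∘ φ) b := by
  have hS : IsCompact (crit E f) :=
    (critOn_univ (E := E) hf.1 ▸ (hf.isLojasiewicz g).isClosed_critOn).isCompact
  have H : IsLojasiewicz g₀ h := hh.isLojasiewicz hf.2.1 hS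
  have hfin := hh.finite_critOn hf.2.1 hS
  choose c hc d hd hcd using hv
  set N := ((hf.isLojasiewicz g).finite_values).toFinset.card
  -- There are only finitely many triples of two ends and a number of cascades, so an ultrafilter
  -- singles out one of them, which then occurs infinitely often.
  obtain ⟨⟨c₀, d₀, k⟩, ⟨hc₀, hd₀, -⟩, hev⟩ := (Ultrafilter.eventually_exists_mem_iff
    (f := hyperfilter ℕ) (hfin.prod (hfin.prod (finite_Iic N)))
    (P := fun a n => a = (c n, d n, (v n).num))).1
    (Eventually.of_forall fun n => ⟨(c n, d n, (v n).num), ⟨hc n, hd n, (hcd n).num_le g hf⟩, rfl⟩)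
  obtain ⟨φ, hφ, hφ'⟩ := extraction_of_frequently_atTop
    (hev.frequently.filter_mono Nat.hyperfilter_le_atTop)
  simp only [Prod.mk.injEq] at hφ'
  have hv' : ∀ n, IsFlowLine g f g₀ h c₀ d₀ (v (φ n)) := fun n => by
    rw [(hφ' n).1, (hφ' n).2.1]
    exact hcd (φ n)
  obtain ⟨θ, hθ, b, hb⟩ : ∃ θ : ℕ → ℕ, StrictMono θ ∧ ∃ b : BrokenFlowLine g f g₀ h c₀ d₀,
      FloerGromovTendsto (fun n => v (φ (θ n))) b := by
    have hnum := fun n => (hφ' n).2.2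
    cases k with
    | zero =>
      have hy : ∀ n, ∃ y, v (φ n) = .zero y := fun n => by
        have h1 := hnum n
        cases h2 : v (φ n) with
        | zero y => exact ⟨y, rfl⟩
        | cascades m x t => simp [h2, CascadeData.num] at h1
      choose y hy using hy
      simp only [hy] at hv' ⊢
      exact exists_tendsto_zero H hc₀ hd₀ hv'
    | succ m =>
      have hx : ∀ n, ∃ x t, v (φ n) = .cascades m x t := fun n => by
        have h1 := hnum n
        cases h2 : v (φ n) with
        | zero y => simp [h2, CascadeData.num] at h1
        | cascades m' x t =>
          obtain rfl : m = m' := by simpa [h2, CascadeData.num] using h1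
          exact ⟨x, t, rfl⟩
      choose x t hx using hx
      simp only [hx] at hv' ⊢
      exact exists_tendsto_cascades hf H hc₀ hd₀ hv'
  exact ⟨φ ∘ θ, hφ.comp hθ, c₀, hc₀, d₀, hd₀, b, hb⟩

end Compactness

end MorseBott

end

theorem mainTheorem12
    {E : Type*} [NormedAddCommGroup E] [NormedSpace ℝ E] [FiniteDimensional ℝ E]
    {M : Type*} [TopologicalSpace M] [ChartedSpace E M] [IsManifold 𝓘(ℝ, E) ∞ M]
    [CompactSpace M] [T2Space M]
    (g : Bundle.ContMDiffRiemannianMetric 𝓘(ℝ, E) ∞ E (TangentSpace 𝓘(ℝ, E) : M → Type _))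
    (f : M → ℝ) (hf : MorseBott.IsMorseBott E f)
    (g₀ : MorseBott.MetricOn E (MorseBott.crit E f))
    (h : M → ℝ) (hh : MorseBott.IsMorseOn E (MorseBott.crit E f) h)
    (v : ℕ → MorseBott.CascadeData M)
    (hv : ∀ n, ∃ c ∈ MorseBott.critOn E (MorseBott.crit E f) h,
      ∃ d ∈ MorseBott.critOn E (MorseBott.crit E f) h,
        MorseBott.IsFlowLine g f g₀ h c d (v n)) :
    ∃ φ : ℕ → ℕ, StrictMono φ ∧
      ∃ c ∈ MorseBott.critOn E (MorseBott.crit E f) h,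
      ∃ d ∈ MorseBott.critOn E (MorseBott.crit E f) h,
      ∃ b : MorseBott.BrokenFlowLine g f g₀ h c d,
        MorseBott.FloerGromovTendsto (v ∘ φ) b :=
  MorseBott.exists_floerGromovTendsto hf hh hv
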